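/- **Setting.** There are $N$ players; player $i$ has a compact convex action set $\mathcal X_i\subseteq\mathbb R^{n_i}$ with nonempty interior, $\mathcal X=\prod_i\mathcal X_i$, $n=\sum_i n_i$, and a payoff $u_i:\mathcal X\to\mathbb R$ which is continuous on $\mathcal X$, concave and continuously differentiable in $x_i$ for fixed $x_{-i}$, and whose individual gradient $v_i(x)=\nabla_i u_i(x_i;x_{-i})$ is Lipschitz on $\mathcal X$. The game is $\beta$-strongly monotone: for some $\beta>0$ and weights $\lambda_i>0$, $$\sum_i\lambda_i\langle x_i'-x_i,\,v_i(x')-v_i(x)\rangle\le-\beta\|x-x'\|^2\qquad(x,x'\in\mathcal X).$$ Let $x^\star$ be the (necessarily unique) Nash equilibrium, i.e. $x^\star\in\mathcal X$ and $u_i(x_i^\star;x_{-i}^\star)\ge u_i(x_i;x_{-i}^\star)$ for all $i$ and $x_i\in\mathcal X_i$. Let $|u_i(x)|\le L$ for all $i$ and $x\in\mathcal X$. For each $i$ let $R_i$ be a $\nu_i$-self-concordant barrier for $\mathcal X_i$: a convex $C^3$ function on $\mathrm{int}(\mathcal X_i)$ with $R_i(x)\to\infty$ as $x\to\partial\mathcal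 X_i$, $|\nabla^3R_i(x)[h,h,h]|\le2(h^\top\nabla^2R_i(x)h)^{3/2}$ and $|\nabla R_i(x)^\top h|\le\sqrt{\nu_i}\,(h^\top\nabla^2R_i(x)h)^{1/2}$. Put $D_{R_i}(y,x)=R_i(y)-R_i(x)-\langle\nabla R_i(x),y-x\rangle$. **Algorithm.** Let $\sigma\ge0$ and $\eta_t=\frac{1}{2n(L+\sigma)\sqrt t}$. Start from $x_i^1=\operatorname{argmin}R_i$. At each round $t=1,2,\dots$, every player $i$ 1. sets $A_i^t=\big(\nabla^2R_i(x_i^t)+\frac{\eta_t\beta(t+1)}{\lambda_i}I\big)^{-1/2}$, draws $z_i^t$ uniformly from the unit sphere of $\mathbb R^{n_i}$ (independently across players and of everything before round $t$) and plays $\hat x_i^t=x_i^t+A_i^tz_i^t$; 2. observes the noisy payoff $\hat u_i^t=u_i(\hat x^t)+\xi_{i,t}$ and sets $\hat v_i^t=n_i\hat u_i^t(A_i^t)^{-1}z_i^t$; 3. updates $$x_i^{t+1}=\operatorname*{argmin}_{y}\ \eta_t\langle\hat v_i^t,x_i^t-y\rangle+\frac{\eta_t\beta(t+1)}{2\lambda_i}\|x_i^t-y\|^2+D_{R_i}(y,x_i^t),$$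 both argmins being over $\mathrm{int}(\mathcal X_i)$ (on $\partial\mathcal X_i$ the objective is $+\infty$). **Noise.** With $\mathcal F_t$ the history generated by the actions $\hat x^1,\dots,\hat x^t$ and the noise $\xi_1,\dots,\xi_{t-1}$, almost surely $\mathbb E[\xi_{i,t}\mid\mathcal F_t]=0$ and $|\xi_{i,t}|\le\sigma$ for all $i$ and $t\ge1$. **Theorem.** Under these assumptions $$\mathbb E\Big[\sum_{i}\|\hat x_i^T-x_i^\star\|^2\Big]=\tilde O\Big(\frac1{\sqrt T}\Big),$$ that is, there are $C\in\mathbb R$ and $k\in\mathbb N$, depending only on the game, the barriers, $\beta$, the weights $\lambda_i$, $L$ and $\sigma$ (not on the probability space or the noise process), such that for every $T\ge2$ the random variable is integrable and its expectation is at most $C(\log T)^k/\sqrt T$. -/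

import Mathlib

open MeasureTheory ProbabilityTheory Set Filter Topology
open scoped InnerProductSpace

noncomputable section

namespace BanditGame

/-- Joint action space: player `i` acts in `ℝ^(d i)` with its Euclidean norm. -/
abbrev Profile {N : ℕ} (d : Fin N → ℕ) : Type :=
  ∀ i : Fin N, EuclideanSpace ℝ (Fin (d i))

/-! ### Self-concordant barriers -/

/-- The Hessian of `R` at `x`, as a linear operator. -/
def hessian {m : ℕ} (R : EuclideanSpace ℝ (Fin m) → ℝ) (x : EuclideanSpace ℝ (Fin m)) :
    EuclideanSpace ℝ (Fin m) →L[ℝ] EuclideanSpace ℝ (Fin m) :=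
  fderiv ℝ (gradient R) x

/-- `R` is a `ν`-self-concordant barrier for the closed convex set `X`. Only the values of `R` on
the interior of `X` matter. Convexity, which makes the powers below meaningful, is part of the
standard definition. -/
structure IsSelfConcordantBarrier {m : ℕ} (X : Set (EuclideanSpace ℝ (Fin m))) (ν : ℝ)
    (R : EuclideanSpace ℝ (Fin m) → ℝ) : Prop where
  nonneg : 0 ≤ ν
  contDiffOn : ContDiffOn ℝ 3 R (interior X)
  convexOn : ConvexOn ℝ (interior X) R
  barrier : ∀ y ∈ frontier X, Tendsto R (𝓝[interior X] y) atTop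
  selfConcordant : ∀ x ∈ interior X, ∀ h : EuclideanSpace ℝ (Fin m),
    |iteratedFDeriv ℝ 3 R x (fun _ => h)| ≤ 2 * ⟪h, hessian R x h⟫_ℝ ^ (3 / 2 : ℝ)
  gradient_le : ∀ x ∈ interior X, ∀ h : EuclideanSpace ℝ (Fin m),
    |⟪gradient R x, h⟫_ℝ| ≤ √ν * √(⟪h, hessian R x h⟫_ℝ)

/-- Bregman divergence `D_R(y, x) = R(y) - R(x) - ⟨∇R(x), y - x⟩`. -/
def bregman {m : ℕ} (R : EuclideanSpace ℝ (Fin m) → ℝ) (y x : EuclideanSpace ℝ (Fin m)) : ℝ :=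
  R y - R x - ⟪gradient R x, y - x⟫_ℝ

/-- `A = M^(-1/2)`: the positive operator whose square is the inverse of `M`. -/
def IsInvSqrt {m : ℕ} (A M : EuclideanSpace ℝ (Fin m) →L[ℝ] EuclideanSpace ℝ (Fin m)) : Prop :=
  A.IsPositive ∧ (A ∘L A) ∘L M = ContinuousLinearMap.id ℝ _ ∧
    M ∘L (A ∘L A) = ContinuousLinearMap.id ℝ _

/-! ### Games -/

/-- The individual payoff gradient `v_i(x) = ∇_i u_i(x_i; x_{-i})`, taken within `X i` so that it
also makes sense at boundary points. -/
def payoffGrad {N : ℕ} {d : Fin N → ℕ} (X : ∀ i, Set (EuclideanSpace ℝ (Fin (d i))))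
    (u : Fin N → Profile d → ℝ) (i : Fin N) (x : Profile d) : EuclideanSpace ℝ (Fin (d i)) :=
  gradientWithin (fun y => u i (Function.update x i y)) (X i) (x i)

/-- Smooth concave games with compact convex action sets `X i` and payoffs `u i`, of which only the
values on `∏ X i` matter. The Lipschitz condition may be read in any norm of the product space,
since the constant is existential; it contains the continuity of the gradient. -/
structure IsSmoothConcaveGame {N : ℕ} {d : Fin N → ℕ}
    (X : ∀ i, Set (EuclideanSpace ℝ (Fin (d i)))) (u : Fin N → Profile d → ℝ) : Prop where
  convex : ∀ i, Convex ℝ (X i)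
  isCompact : ∀ i, IsCompact (X i)
  continuousOn : ∀ i, ContinuousOn (u i) (univ.pi X)
  concaveOn : ∀ i, ∀ x ∈ univ.pi X, ConcaveOn ℝ (X i) (fun y => u i (Function.update x i y))
  differentiableOn : ∀ i, ∀ x ∈ univ.pi X,
    DifferentiableOn ℝ (fun y => u i (Function.update x i y)) (X i)
  lipschitz : ∀ i, ∃ K, LipschitzOnWith K (payoffGrad X u i) (univ.pi X)

/-- `β`-strong monotonicity with weights `lam i`. -/
def IsStronglyMonotone {N : ℕ} {d : Fin N → ℕ} (X : ∀ i, Set (EuclideanSpace ℝ (Fin (d i))))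
    (u : Fin N → Profile d → ℝ) (lam : Fin N → ℝ) (β : ℝ) : Prop :=
  ∀ x ∈ univ.pi X, ∀ x' ∈ univ.pi X,
    ∑ i, lam i * ⟪x' i - x i, payoffGrad X u i x' - payoffGrad X u i x⟫_ℝ
      ≤ -β * ∑ i, ‖x' i - x i‖ ^ 2

/-- Pure-strategy Nash equilibria. -/
def IsNash {N : ℕ} {d : Fin N → ℕ} (X : ∀ i, Set (EuclideanSpace ℝ (Fin (d i))))
    (u : Fin N → Profile d → ℝ) (x : Profile d) : Prop :=
  x ∈ univ.pi X ∧ ∀ i, ∀ y ∈ X i, u i (Function.update x i y) ≤ u i x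

/-! ### The learning algorithm -/

/-- The step size `η_t = 1 / (2 n (L + σ) √t)`, where `n` is the total dimension. -/
def stepSize {N : ℕ} (d : Fin N → ℕ) (L σ : ℝ) (t : ℕ) : ℝ :=
  1 / (2 * ((∑ i, d i : ℕ) : ℝ) * (L + σ) * √(t : ℝ))

/-- The function of `y` minimised by the prox-mapping; `c = η β (t + 1) / lam`. -/
def proxObjective {m : ℕ} (R : EuclideanSpace ℝ (Fin m) → ℝ) (x v : EuclideanSpace ℝ (Fin m))
    (η c : ℝ) (y : EuclideanSpace ℝ (Fin m)) : ℝ :=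
  η * ⟪v, x - y⟫_ℝ + c / 2 * ‖x - y‖ ^ 2 + bregman R y x

/-- `x` (pivots), `A` (scaling operators) and `xhat` (played actions) are what the multi-agent
eager self-concordant barrier bandit algorithm produces, at the rounds `t = 1, 2, …`, from the
perturbation directions `z` and the payoff noise `ξ`. The barriers and Bregman divergences are
`+∞` on the boundary, hence the minimisations run over the interiors of the action sets. -/
structure IsRun {N : ℕ} {d : Fin N → ℕ} (X : ∀ i, Set (EuclideanSpace ℝ (Fin (d i))))
    (u : Fin N → Profile d → ℝ) (R : ∀ i, EuclideanSpace ℝ (Fin (d i)) → ℝ)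
    (lam : Fin N → ℝ) (β : ℝ) (η : ℕ → ℝ)
    (z : ℕ → ∀ i, Metric.sphere (0 : EuclideanSpace ℝ (Fin (d i))) 1) (ξ : ℕ → Fin N → ℝ)
    (x : ℕ → Profile d)
    (A : ℕ → ∀ i, EuclideanSpace ℝ (Fin (d i)) →L[ℝ] EuclideanSpace ℝ (Fin (d i)))
    (xhat : ℕ → Profile d) : Prop where
  init : ∀ i, x 1 i ∈ interior (X i) ∧ IsMinOn (R i) (interior (X i)) (x 1 i)
  scaling : ∀ t, 1 ≤ t → ∀ i, IsInvSqrt (A t i)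
    (hessian (R i) (x t i) + (η t * β * (t + 1) / lam i) • ContinuousLinearMap.id ℝ _)
  play : ∀ t, 1 ≤ t → ∀ i, xhat t i = x t i + A t i (z t i)
  update : ∀ t, 1 ≤ t → ∀ i, x (t + 1) i ∈ interior (X i) ∧
    IsMinOn
      (proxObjective (R i) (x t i)
        (((d i : ℝ) * (u i (xhat t) + ξ t i)) • (A t i).inverse (z t i))
        (η t) (η t * β * (t + 1) / lam i))
      (interior (X i)) (x (t + 1) i)

/-! ### Randomness -/

/-- The uniform probability measure on the unit sphere of `ℝ^m` (normalised surface measure). -/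
def sphereUniform (m : ℕ) : Measure (Metric.sphere (0 : EuclideanSpace ℝ (Fin m)) 1) :=
  ((volume : Measure (EuclideanSpace ℝ (Fin m))).toSphere univ)⁻¹ •
    (volume : Measure (EuclideanSpace ℝ (Fin m))).toSphere

variable {Ω : Type*} {N : ℕ} {d : Fin N → ℕ}

/-- The σ-algebra generated by the directions drawn at round `t`. -/
abbrev drawSigma (z : ℕ → ∀ i, Ω → Metric.sphere (0 : EuclideanSpace ℝ (Fin (d i))) 1) (t : ℕ) :
    MeasurableSpace Ω :=
  ⨆ i, MeasurableSpace.comap (z t i) inferInstance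

/-- What happened strictly before round `t`: directions and noise of the rounds `1, …, t - 1`. -/
abbrev pastSigma (z : ℕ → ∀ i, Ω → Metric.sphere (0 : EuclideanSpace ℝ (Fin (d i))) 1)
    (ξ : ℕ → Fin N → Ω → ℝ) (t : ℕ) : MeasurableSpace Ω :=
  ⨆ s ∈ Ico 1 t, drawSigma z s ⊔ ⨆ i, MeasurableSpace.comap (ξ s i) inferInstance

/-- The history `ℱ_t` of the actions played up to round `t`, and of the noise up to round `t - 1`.
The actions of the rounds `1, …, t` and the noise before `t` determine the directions of the
rounds `1, …, t`, and conversely, so that these directions may serve as generators. -/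
abbrev historySigma (z : ℕ → ∀ i, Ω → Metric.sphere (0 : EuclideanSpace ℝ (Fin (d i))) 1)
    (ξ : ℕ → Fin N → Ω → ℝ) (t : ℕ) : MeasurableSpace Ω :=
  pastSigma z ξ t ⊔ drawSigma z t

/-- At every round the directions are uniform on the unit spheres, independent across the players
and independent of everything that happened before. -/
structure IsSphereSampling [MeasurableSpace Ω] (μ : Measure Ω)
    (z : ℕ → ∀ i, Ω → Metric.sphere (0 : EuclideanSpace ℝ (Fin (d i))) 1)
    (ξ : ℕ → Fin N → Ω → ℝ) : Prop where
  measurable : ∀ t, 1 ≤ t → ∀ i, Measurable (z t i)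
  law : ∀ t, 1 ≤ t → ∀ i, μ.map (z t i) = sphereUniform (d i)
  indep_players : ∀ t, 1 ≤ t → iIndepFun (z t) μ
  indep_past : ∀ t, 1 ≤ t → Indep (drawSigma z t) (pastSigma z ξ t) μ

/-- The noise is a martingale-difference sequence with respect to the history, bounded by `σ`. -/
structure IsBoundedNoise [MeasurableSpace Ω] (μ : Measure Ω) (σ : ℝ)
    (z : ℕ → ∀ i, Ω → Metric.sphere (0 : EuclideanSpace ℝ (Fin (d i))) 1)
    (ξ : ℕ → Fin N → Ω → ℝ) : Prop where
  measurable : ∀ t, 1 ≤ t → ∀ i, Measurable (ξ t i)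
  zero_mean : ∀ t, 1 ≤ t → ∀ i, μ[ξ t i | historySigma z ξ t] =ᵐ[μ] 0
  bounded : ∀ t, 1 ≤ t → ∀ i, ∀ᵐ ω ∂μ, |ξ t i ω| ≤ σ

end BanditGame

end

/-! The pivots are compared with an interior point `p` at distance `O(1/T)` from `xstar`, through
`V_t = E[∑ λ_i D_{R_i}(p_i, x_i^t) + (η_t β t / 2) ∑ ‖x_i^t - p_i‖²]`.

By `prox_step`, one update raises `λ_i D_{R_i} + (η_t β (t+1) / 2) ‖·‖²` by at most `η_t λ_i ⟨v̂_i,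
x_i - p_i⟩ + 2 λ_i (η_t ‖A_i v̂_i‖)²`. The scaling `A_i` cancels its inverse in the estimator, so
`‖A_i v̂_i‖ = n_i |û_i| ≤ n_i (L + σ)` however close the pivot is to the boundary, and the step size
turns the last term into at most `λ_i / (2t)`.

In expectation `v̂_i` is the payoff gradient up to a bias proportional to the perturbation radius
`α_t` (`abs_integral_estimator_sub_le`). The quadratic term in the scaling forces `α_t² = O(1/√t)`.
Strong monotonicity and the variational inequality at `xstar` produce the drift `-β ‖x - p‖²`
(`sum_inner_payoffGrad_add_le`). Half of it absorbs the bias by Young's inequality, at a cost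
`O(α_t²)`; the other half lowers the quadratic coefficient from `t + 1` to `t`. As `η_t` decreases,
the recursion closes: `V_{t+1} ≤ V_t + O(1/t)`.

A barrier grows only logarithmically towards the boundary (`sub_le_mul_log`), so `V_1 = O(log T)`
and hence `V_T = O(log T)`. The quadratic coefficient in `V_T` is of order `√T`, which gives the
rate for the pivots. Passing to the played action and to `xstar` costs a further `O(α_T² + T⁻²)`.

Self-concordance enters through one fact: along a line, the second derivative to the power `-1/2` is
1-Lipschitz. It yields the Dikin ellipsoid, which makes the played actions feasible, and the lower
bound `r - log (1 + r)` on Bregman divergences behind `prox_step`. On the probabilistic side, a run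
is given only by implicit conditions, so the pivots must first be shown measurable with respect to
the past. Independence then allows averaging over the current directions with the past frozen. -/

namespace BanditGame

/-! ### Smooth convex functions along lines. -/

section Ray

variable {m : ℕ} {U X : Set (EuclideanSpace ℝ (Fin m))} {ν : ℝ}
  {R : EuclideanSpace ℝ (Fin m) → ℝ} {x s : EuclideanSpace ℝ (Fin m)}

theorem hasDerivAt_line (x s : EuclideanSpace ℝ (Fin m)) (τ : ℝ) :
    HasDerivAt (fun τ : ℝ => x + τ • s) s τ := by
  simpa using ((hasDerivAt_id τ).smul_const s).const_add x

theorem hasFDerivAt_gradient (hU : IsOpen U) (hR : ContDiffOn ℝ 3 R U) (hx : x ∈ U) :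
    HasFDerivAt (gradient R) (hessian R x) x := by
  have hxU : U ∈ 𝓝 x := hU.mem_nhds hx
  have h1 : ContDiffAt ℝ 2 (fderiv ℝ R) x :=
    (hR.contDiffAt hxU).fderiv_right (m := 2) (by norm_num)
  have h2 : DifferentiableAt ℝ (gradient R) x :=
    ((InnerProductSpace.toDual ℝ (EuclideanSpace ℝ (Fin m))).symm.toContinuousLinearEquiv
      |>.differentiableAt).comp x (h1.differentiableAt (by norm_num))
  exact h2.hasFDerivAt

theorem hasDerivAt_ray (hU : IsOpen U) (hR : ContDiffOn ℝ 3 R U) {τ : ℝ} (hx : x + τ • s ∈ U) :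
    HasDerivAt (fun τ : ℝ => R (x + τ • s)) ⟪gradient R (x + τ • s), s⟫_ℝ τ := by
  have h : DifferentiableAt ℝ R (x + τ • s) :=
    (hR.contDiffAt (hU.mem_nhds hx)).differentiableAt (by norm_num)
  have := h.hasFDerivAt.comp_hasDerivAt τ (hasDerivAt_line x s τ)
  rw [inner_gradient_left]
  exact this

theorem hasDerivAt_ray_gradient (hU : IsOpen U) (hR : ContDiffOn ℝ 3 R U) {τ : ℝ}
    (hx : x + τ • s ∈ U) :
    HasDerivAt (fun τ : ℝ => ⟪gradient R (x + τ • s), s⟫_ℝ)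
      ⟪s, hessian R (x + τ • s) s⟫_ℝ τ := by
  have h := (hasFDerivAt_gradient hU hR hx).comp_hasDerivAt τ (hasDerivAt_line x s τ)
  have h2 := h.inner ℝ (hasDerivAt_const τ s)
  simpa [real_inner_comm] using h2

/-- Bridges the operator `hessian` and the multilinear derivatives, in which the third-order
condition on a barrier is phrased. -/
theorem inner_hessian_eq (hU : IsOpen U) (hR : ContDiffOn ℝ 3 R U) (hx : x ∈ U)
    (s t : EuclideanSpace ℝ (Fin m)) :
    ⟪s, hessian R x t⟫_ℝ = fderiv ℝ (fderiv ℝ R) x t s := by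
  have h1 : ContDiffAt ℝ 2 (fderiv ℝ R) x :=
    (hR.contDiffAt (hU.mem_nhds hx)).fderiv_right (m := 2) (by norm_num)
  have h2 := ((h1.differentiableAt (by norm_num)).hasFDerivAt).clm_apply
    (hasFDerivAt_const s x)
  have h3 := (hasFDerivAt_gradient hU hR hx).inner ℝ (hasFDerivAt_const s x)
  have h4 : (fun y => ⟪gradient R y, s⟫_ℝ) = fun y => fderiv ℝ R y s := by
    ext y; rw [inner_gradient_left]
  rw [h4] at h3
  have := congrArg (fun L => L t) (h3.unique h2)
  simpa [real_inner_comm] using this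

theorem hasDerivAt_ray_hessian (hU : IsOpen U) (hR : ContDiffOn ℝ 3 R U) {τ : ℝ}
    (hx : x + τ • s ∈ U) :
    HasDerivAt (fun τ : ℝ => ⟪s, hessian R (x + τ • s) s⟫_ℝ)
      (iteratedFDeriv ℝ 3 R (x + τ • s) (fun _ => s)) τ := by
  have hxU := hU.mem_nhds hx
  have h1 : ContDiffAt ℝ 2 (fderiv ℝ R) (x + τ • s) :=
    (hR.contDiffAt hxU).fderiv_right (m := 2) (by norm_num)
  have h2 : DifferentiableAt ℝ (iteratedFDeriv ℝ 2 R) (x + τ • s) :=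
    (hR.contDiffAt hxU).differentiableAt_iteratedFDeriv (by norm_num)
  have h3 := h2.hasFDerivAt.comp_hasDerivAt τ (hasDerivAt_line x s τ)
  have h4 : HasDerivAt (fun τ : ℝ => iteratedFDeriv ℝ 2 R (x + τ • s) (fun _ => s))
      (fderiv ℝ (iteratedFDeriv ℝ 2 R) (x + τ • s) s (fun _ => s)) τ := by
    have := (ContinuousMultilinearMap.apply ℝ (fun _ : Fin 2 => EuclideanSpace ℝ (Fin m)) ℝ
      (fun _ => s)).hasFDerivAt.comp_hasDerivAt τ h3
    exact this
  have h5 : (iteratedFDeriv ℝ 3 R (x + τ • s) (fun _ => s)) =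
      fderiv ℝ (iteratedFDeriv ℝ 2 R) (x + τ • s) s (fun _ => s) := by
    rw [iteratedFDeriv_succ_apply_left]; rfl
  rw [h5]
  refine h4.congr_of_eventuallyEq ?_
  have hcont : ContinuousAt (fun τ : ℝ => x + τ • s) τ := (hasDerivAt_line x s τ).continuousAt
  filter_upwards [hcont.preimage_mem_nhds hxU] with τ' hτ'
  rw [inner_hessian_eq hU hR hτ', iteratedFDeriv_two_apply]

theorem inner_gradient_le_sub (hU : IsOpen U) (hR : ContDiffOn ℝ 3 R U) (hc : ConvexOn ℝ U R)
    {y : EuclideanSpace ℝ (Fin m)} (hx : x ∈ U) (hy : y ∈ U) :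
    ⟪gradient R x, y - x⟫_ℝ ≤ R y - R x := by
  have hmem : ∀ τ ∈ Icc (0 : ℝ) 1, x + τ • (y - x) ∈ U := fun τ hτ =>
    hc.1.add_smul_sub_mem hx hy hτ
  have hconv : ConvexOn ℝ (Icc (0 : ℝ) 1) (fun τ : ℝ => R (x + τ • (y - x))) := by
    have := hc.comp_affineMap (AffineMap.lineMap x y : ℝ →ᵃ[ℝ] _)
    refine (this.subset (s := Icc (0:ℝ) 1) ?_ (convex_Icc 0 1)).congr ?_
    · intro τ hτ
      have := hmem τ hτ
      simpa [AffineMap.lineMap_apply, add_comm] using this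
    · intro τ hτ
      simp [AffineMap.lineMap_apply, add_comm]
  have hd := hasDerivAt_ray (s := y - x) (τ := 0) hU hR (by simpa using hx)
  have := hconv.le_slope_of_hasDerivAt (x := 0) (y := 1) (by simp) (by simp) one_pos hd
  simpa [slope] using this

theorem bregman_nonneg (hU : IsOpen U) (hR : ContDiffOn ℝ 3 R U) (hc : ConvexOn ℝ U R)
    {y : EuclideanSpace ℝ (Fin m)} (hx : x ∈ U) (hy : y ∈ U) : 0 ≤ bregman R y x := by
  have := inner_gradient_le_sub hU hR hc hx hy
  unfold bregman; linarith

theorem inner_gradient_sub_nonneg (hU : IsOpen U) (hR : ContDiffOn ℝ 3 R U) (hc : ConvexOn ℝ U R)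
    {y : EuclideanSpace ℝ (Fin m)} (hx : x ∈ U) (hy : y ∈ U) :
    0 ≤ ⟪gradient R y - gradient R x, y - x⟫_ℝ := by
  have h1 := inner_gradient_le_sub hU hR hc hx hy
  have h2 := inner_gradient_le_sub hU hR hc hy hx
  rw [← neg_sub y x, inner_neg_right] at h2
  rw [inner_sub_left]; linarith

/-- The gradient of a convex function is monotone, so its difference quotients along `s` are
nonnegative. -/
theorem inner_hessian_nonneg (hU : IsOpen U) (hR : ContDiffOn ℝ 3 R U) (hc : ConvexOn ℝ U R)
    (hx : x ∈ U) (s : EuclideanSpace ℝ (Fin m)) : 0 ≤ ⟪s, hessian R x s⟫_ℝ := by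
  have hd := hasDerivAt_ray_gradient (s := s) (τ := 0) hU hR (by simpa using hx)
  simp only [zero_smul, add_zero] at hd
  have ht := (hasDerivAt_iff_tendsto_slope.1 hd).mono_left
    (nhdsWithin_mono (0 : ℝ) (s := Ioi 0) (fun a (ha : 0 < a) => ha.ne'))
  refine ge_of_tendsto ht ?_
  have hcont : ContinuousAt (fun τ : ℝ => x + τ • s) 0 := (hasDerivAt_line x s 0).continuousAt
  have hev : ∀ᶠ τ : ℝ in 𝓝 0, x + τ • s ∈ U :=
    hcont.preimage_mem_nhds (by simpa using hU.mem_nhds hx)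
  filter_upwards [hev.filter_mono nhdsWithin_le_nhds, self_mem_nhdsWithin] with τ hτ hpos
  have h0 : (0:ℝ) < τ := hpos
  have := inner_gradient_sub_nonneg hU hR hc hx hτ
  rw [add_sub_cancel_left, inner_smul_right, inner_sub_left] at this
  have h1 := nonneg_of_mul_nonneg_right this h0
  simp only [slope, vsub_eq_sub, zero_smul, add_zero, sub_zero, smul_eq_mul]
  positivity

theorem continuousOn_gradient (hU : IsOpen U) (hR : ContDiffOn ℝ 3 R U) :
    ContinuousOn (gradient R) U := fun _ hx =>
  (hasFDerivAt_gradient hU hR hx).continuousAt.continuousWithinAt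

theorem continuousOn_hessian (hU : IsOpen U) (hR : ContDiffOn ℝ 3 R U) :
    ContinuousOn (hessian R) U := by
  intro x hx
  have h1 : ContDiffAt ℝ 2 (fderiv ℝ R) x :=
    (hR.contDiffAt (hU.mem_nhds hx)).fderiv_right (m := 2) (by norm_num)
  have h2 : ContDiffAt ℝ 2 (gradient R) x :=
    ((InnerProductSpace.toDual ℝ (EuclideanSpace ℝ (Fin m))).symm.toContinuousLinearEquiv
      |>.contDiff.contDiffAt).comp x h1
  exact ((h2.fderiv_right (m := 1) (by norm_num)).continuousAt).continuousWithinAt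

end Ray

end BanditGame

namespace BanditGame

/-! ### Self-concordance: Dikin ellipsoid, Bregman lower bound, logarithmic growth. -/

section SelfConcordance

/-- The derivative of `ψ^(-1/2)` is `-ψ' / (2 ψ^(3/2))`, so the self-concordance inequality is
exactly a Lipschitz bound with constant 1. -/
theorem abs_inv_sqrt_sub_inv_sqrt_le {ψ ψ' : ℝ → ℝ} {a : ℝ} (ha : 0 ≤ a)
    (hd : ∀ τ ∈ Icc 0 a, HasDerivAt ψ (ψ' τ) τ) (hpos : ∀ τ ∈ Icc 0 a, 0 < ψ τ)
    (hb : ∀ τ ∈ Icc 0 a, |ψ' τ| ≤ 2 * ψ τ ^ (3 / 2 : ℝ)) :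
    |(√(ψ a))⁻¹ - (√(ψ 0))⁻¹| ≤ a := by
  have key : ∀ τ ∈ Icc 0 a, HasDerivWithinAt (fun τ => (√(ψ τ))⁻¹)
      (-(ψ' τ / (2 * √(ψ τ))) / √(ψ τ) ^ 2) (Icc 0 a) τ := fun τ hτ =>
    (((hd τ hτ).sqrt (hpos τ hτ).ne').inv (Real.sqrt_pos.2 (hpos τ hτ)).ne').hasDerivWithinAt
  have hbound : ∀ τ ∈ Icc 0 a, ‖-(ψ' τ / (2 * √(ψ τ))) / √(ψ τ) ^ 2‖ ≤ 1 := by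
    intro τ hτ
    have h0 := Real.sqrt_pos.2 (hpos τ hτ)
    have h1 : ψ τ ^ (3 / 2 : ℝ) = √(ψ τ) ^ 3 := by
      rw [Real.sqrt_eq_rpow, ← Real.rpow_natCast, ← Real.rpow_mul (hpos τ hτ).le]
      norm_num
    have h2 := hb τ hτ
    rw [h1] at h2
    rw [norm_div, norm_neg, norm_div, Real.norm_eq_abs, Real.norm_eq_abs, Real.norm_eq_abs,
      abs_of_pos (show 0 < 2 * √(ψ τ) by positivity), abs_of_pos (show 0 < √(ψ τ) ^ 2 by positivity),
      div_div, div_le_one (by positivity)]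
    nlinarith
  have := (convex_Icc (0 : ℝ) a).norm_image_sub_le_of_norm_hasDerivWithin_le key hbound
    (left_mem_Icc.2 ha) (right_mem_Icc.2 ha)
  simpa [Real.norm_eq_abs, abs_of_nonneg ha] using this

theorem add_mul_le_of_second_deriv_nonneg {h h' h'' : ℝ → ℝ} {a : ℝ} (ha : 0 ≤ a)
    (hd : ∀ τ ∈ Icc 0 a, HasDerivAt h (h' τ) τ) (hd' : ∀ τ ∈ Icc 0 a, HasDerivAt h' (h'' τ) τ)
    (hnn : ∀ τ ∈ Icc 0 a, 0 ≤ h'' τ) : h 0 + h' 0 * a ≤ h a := by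
  have hmono : MonotoneOn h' (Icc 0 a) :=
    monotoneOn_of_hasDerivWithinAt_nonneg (convex_Icc 0 a)
      (fun τ hτ => (hd' τ hτ).continuousAt.continuousWithinAt)
      (fun τ hτ => (hd' τ (interior_subset hτ)).hasDerivWithinAt)
      (fun τ hτ => hnn τ (interior_subset hτ))
  have hd2 : ∀ τ ∈ Icc 0 a, HasDerivAt (fun τ => h τ - h' 0 * τ) (h' τ - h' 0) τ := by
    intro τ hτ
    exact ((hd τ hτ).sub ((hasDerivAt_id τ).const_mul (h' 0))).congr_deriv (by ring)
  have hmono2 : MonotoneOn (fun τ => h τ - h' 0 * τ) (Icc 0 a) :=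
    monotoneOn_of_hasDerivWithinAt_nonneg (convex_Icc 0 a)
      (fun τ hτ => (hd2 τ hτ).continuousAt.continuousWithinAt)
      (fun τ hτ => (hd2 τ (interior_subset hτ)).hasDerivWithinAt)
      (fun τ hτ => sub_nonneg.2 (hmono (left_mem_Icc.2 ha) (interior_subset hτ)
        (interior_subset hτ).1))
  have := hmono2 (left_mem_Icc.2 ha) (right_mem_Icc.2 ha) ha
  simp only [mul_zero, sub_zero] at this
  linarith

variable {m : ℕ} {X : Set (EuclideanSpace ℝ (Fin m))} {ν : ℝ}
  {R : EuclideanSpace ℝ (Fin m) → ℝ} {x s : EuclideanSpace ℝ (Fin m)}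

namespace IsSelfConcordantBarrier

theorem hessian_nonneg (hR : IsSelfConcordantBarrier X ν R) (hx : x ∈ interior X)
    (s : EuclideanSpace ℝ (Fin m)) : 0 ≤ ⟪s, hessian R x s⟫_ℝ :=
  inner_hessian_nonneg isOpen_interior hR.contDiffOn hR.convexOn hx s

/-- Adding the constant `e` keeps the third-order inequality, since it enlarges only the right side.
It handles degenerate directions and later carries the quadratic term of the prox-mapping. -/
theorem abs_inv_sqrt_ray (hR : IsSelfConcordantBarrier X ν R) {e a : ℝ} (he : 0 < e) (ha : 0 ≤ a)
    (hmem : ∀ τ ∈ Icc 0 a, x + τ • s ∈ interior X) :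
    |(√(⟪s, hessian R (x + a • s) s⟫_ℝ + e))⁻¹ - (√(⟪s, hessian R x s⟫_ℝ + e))⁻¹| ≤ a := by
  have h := abs_inv_sqrt_sub_inv_sqrt_le
    (ψ := fun τ => ⟪s, hessian R (x + τ • s) s⟫_ℝ + e)
    (ψ' := fun τ => iteratedFDeriv ℝ 3 R (x + τ • s) (fun _ => s)) ha
    (fun τ hτ => (hasDerivAt_ray_hessian isOpen_interior hR.contDiffOn (hmem τ hτ)).add_const e)
    (fun τ hτ => add_pos_of_nonneg_of_pos (hR.hessian_nonneg (hmem τ hτ) s) he)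
    (fun τ hτ => (hR.selfConcordant _ (hmem τ hτ) s).trans <| by
      have := hR.hessian_nonneg (hmem τ hτ) s
      gcongr
      linarith)
  simpa using h

/-- The open Dikin ellipsoid around an interior point stays in the interior. -/
theorem add_mem_interior (hR : IsSelfConcordantBarrier X ν R) (hx : x ∈ interior X)
    (hs : ⟪s, hessian R x s⟫_ℝ < 1) : x + s ∈ interior X := by
  by_contra hcon
  -- `b` will be the first exit parameter of the segment. Before `b` the second derivative stays
  -- bounded, hence so does `R`, although `R` must blow up at the exit point.
  set S : Set ℝ := {τ | x + τ • s ∉ interior X} ∩ Icc 0 1 with hS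
  have hcont : Continuous (fun τ : ℝ => x + τ • s) := by fun_prop
  have hSc : IsClosed S :=
    (isOpen_interior.isClosed_compl.preimage hcont).inter isClosed_Icc
  have hSne : S.Nonempty := ⟨1, by simpa using hcon, by simp⟩
  have hbdd : BddBelow S := ⟨0, fun τ hτ => hτ.2.1⟩
  set b := sInf S with hb
  have hbS : b ∈ S := hSc.csInf_mem hSne hbdd
  have hlt : ∀ τ, 0 ≤ τ → τ < b → x + τ • s ∈ interior X := by
    intro τ h0 h1
    by_contra hτ
    exact absurd (csInf_le hbdd ⟨hτ, h0, h1.le.trans hbS.2.2⟩) (not_le.2 h1)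
  have hb0 : 0 < b := by
    refine lt_of_le_of_ne hbS.2.1 fun h => hbS.1 ?_
    rw [← h]; simpa using hx
  have hb1 : b ≤ 1 := hbS.2.2
  have hev : ∀ᶠ τ in 𝓝[<] b, x + τ • s ∈ interior X := by
    filter_upwards [Ioo_mem_nhdsLT hb0] with τ hτ using hlt τ hτ.1.le hτ.2
  have htend : Tendsto (fun τ : ℝ => x + τ • s) (𝓝[<] b) (𝓝[interior X] (x + b • s)) :=
    tendsto_nhdsWithin_iff.2 ⟨(hcont.tendsto b).mono_left nhdsWithin_le_nhds, hev⟩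
  have hfr : x + b • s ∈ frontier X :=
    ⟨closure_mono interior_subset (mem_closure_of_tendsto
      ((hcont.tendsto b).mono_left nhdsWithin_le_nhds) hev), hbS.1⟩
  have htop := (hR.barrier _ hfr).comp htend
  set q0 := ⟪s, hessian R x s⟫_ℝ with hq0
  have hq0n : 0 ≤ q0 := hR.hessian_nonneg hx s
  -- Small enough that `q0 + e < 1`. Then `(q0 + e)^(-1/2)` exceeds 1 by `δ`, and as it changes by
  -- at most `τ ≤ 1` it stays at least `δ`.
  set e := (1 - q0) / 2 with he
  have hepos : 0 < e := by rw [he]; linarith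
  have hr1 : √(q0 + e) < 1 := by
    rw [Real.sqrt_lt' one_pos]; rw [he]; linarith
  have hr0 : 0 < √(q0 + e) := Real.sqrt_pos.2 (by linarith)
  set δ := (√(q0 + e))⁻¹ - 1 with hδ
  have hδ0 : 0 < δ := by
    rw [hδ, sub_pos]; exact (one_lt_inv₀ hr0).2 hr1
  have hB : ∀ τ, 0 ≤ τ → τ < b → ⟪s, hessian R (x + τ • s) s⟫_ℝ ≤ (δ ^ 2)⁻¹ := by
    intro τ h0 h1
    have h := hR.abs_inv_sqrt_ray (x := x) (s := s) hepos h0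
      (fun τ' hτ' => hlt τ' hτ'.1 (hτ'.2.trans_lt h1))
    set w := ⟪s, hessian R (x + τ • s) s⟫_ℝ with hw
    have hwn : 0 ≤ w := hR.hessian_nonneg (hlt τ h0 h1) s
    have h2 : δ ≤ (√(w + e))⁻¹ := by
      have := (abs_le.1 h).1
      rw [hδ]; linarith
    have h3 : √(w + e) ≤ δ⁻¹ := (le_inv_comm₀ hδ0 (Real.sqrt_pos.2 (by linarith))).1 h2
    have h4 := (Real.sqrt_le_left (by positivity)).1 h3
    rw [inv_pow] at h4
    linarith
  set B := (δ ^ 2)⁻¹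
  have hup : ∀ τ, 0 ≤ τ → τ < b → R (x + τ • s) ≤ R x + |⟪gradient R x, s⟫_ℝ| + B := by
    intro τ h0 h1
    have h := add_mul_le_of_second_deriv_nonneg
      (h := fun τ => B / 2 * τ ^ 2 - R (x + τ • s))
      (h' := fun τ => B * τ - ⟪gradient R (x + τ • s), s⟫_ℝ)
      (h'' := fun τ => B - ⟪s, hessian R (x + τ • s) s⟫_ℝ) h0
      (fun τ' hτ' => by
        have h1 := ((hasDerivAt_pow 2 τ').const_mul (B / 2)).sub
          (hasDerivAt_ray isOpen_interior hR.contDiffOn (hlt τ' hτ'.1 (hτ'.2.trans_lt h1)))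
        exact h1.congr_deriv (by push_cast; ring))
      (fun τ' hτ' => by
        have h1 := ((hasDerivAt_id τ').const_mul B).sub
          (hasDerivAt_ray_gradient isOpen_interior hR.contDiffOn
            (hlt τ' hτ'.1 (hτ'.2.trans_lt h1)))
        exact h1.congr_deriv (by ring))
      (fun τ' hτ' => sub_nonneg.2 (hB τ' hτ'.1 (hτ'.2.trans_lt h1)))
    simp only [zero_smul, add_zero, mul_zero] at h
    have hτ1 : τ ≤ 1 := h1.le.trans hb1
    have hBn : 0 ≤ B := by positivity
    have h5 : ⟪gradient R x, s⟫_ℝ * τ ≤ |⟪gradient R x, s⟫_ℝ| :=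
      (le_abs_self _).trans (by
        rw [abs_mul, abs_of_nonneg h0]
        exact mul_le_of_le_one_right (abs_nonneg _) hτ1)
    have h6 : B * τ ^ 2 ≤ B := mul_le_of_le_one_right hBn (pow_le_one₀ h0 hτ1)
    nlinarith
  obtain ⟨τ, hτ1, hτ2⟩ := ((htop.eventually_gt_atTop (R x + |⟪gradient R x, s⟫_ℝ| + B)).and
    (Ioo_mem_nhdsLT hb0)).exists
  exact absurd (hup τ hτ2.1.le hτ2.2) (not_le.2 hτ1)

/-- The standard lower bound on the Bregman divergence of a self-concordant function. -/
theorem sub_log_le_bregman_add (hR : IsSelfConcordantBarrier X ν R) (hX : Convex ℝ X)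
    (hx : x ∈ interior X) (hxs : x + s ∈ interior X) {e : ℝ} (he : 0 < e) :
    √(⟪s, hessian R x s⟫_ℝ + e) - Real.log (1 + √(⟪s, hessian R x s⟫_ℝ + e)) ≤
      bregman R (x + s) x + e / 2 := by
  have hmem : ∀ τ ∈ Icc (0 : ℝ) 1, x + τ • s ∈ interior X := fun τ hτ => by
    have := hX.interior.add_smul_sub_mem hx hxs hτ
    simpa using this
  set r := √(⟪s, hessian R x s⟫_ℝ + e) with hr
  have hr0 : 0 < r := Real.sqrt_pos.2 (add_pos_of_nonneg_of_pos (hR.hessian_nonneg hx s) he)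
  -- The Lipschitz estimate bounds the second derivative below by that of `r τ - log (1 + r τ)`; two
  -- integrations then give the claim.
  have hlow : ∀ τ ∈ Icc (0 : ℝ) 1,
      r ^ 2 / (1 + r * τ) ^ 2 ≤ ⟪s, hessian R (x + τ • s) s⟫_ℝ + e := by
    intro τ hτ
    have h := hR.abs_inv_sqrt_ray (x := x) (s := s) he hτ.1
      (fun τ' hτ' => hmem τ' ⟨hτ'.1, hτ'.2.trans hτ.2⟩)
    have hwn : 0 ≤ ⟪s, hessian R (x + τ • s) s⟫_ℝ := hR.hessian_nonneg (hmem τ hτ) s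
    set w := ⟪s, hessian R (x + τ • s) s⟫_ℝ with hw
    have hw0 : 0 < √(w + e) := Real.sqrt_pos.2 (by linarith)
    have h2 : (√(w + e))⁻¹ ≤ (1 + r * τ) / r := by
      have := (abs_le.1 h).2
      have h3 : (1 + r * τ) / r = r⁻¹ + τ := by field_simp
      rw [h3]; linarith
    have hτ0 := hτ.1
    have h3 : r / (1 + r * τ) ≤ √(w + e) := by
      rw [← inv_div]
      exact inv_le_of_inv_le₀ hw0 h2
    have h4 := pow_le_pow_left₀ (by positivity) h3 2
    rwa [Real.sq_sqrt (by linarith), div_pow] at h4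
  have h := add_mul_le_of_second_deriv_nonneg
    (h := fun τ => R (x + τ • s) + e / 2 * τ ^ 2 - (r * τ - Real.log (1 + r * τ)))
    (h' := fun τ => ⟪gradient R (x + τ • s), s⟫_ℝ + e * τ - (r - r / (1 + r * τ)))
    (h'' := fun τ => ⟪s, hessian R (x + τ • s) s⟫_ℝ + e - r ^ 2 / (1 + r * τ) ^ 2) zero_le_one
    (fun τ hτ => by
      have hp : 0 < 1 + r * τ := by have := hτ.1; positivity
      have hlin : HasDerivAt (fun τ => 1 + r * τ) r τ := by
        simpa using ((hasDerivAt_id τ).const_mul r).const_add 1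
      have hlin' : HasDerivAt (fun τ => r * τ) r τ := by
        simpa using ((hasDerivAt_id τ).const_mul r)
      have h1 := ((hasDerivAt_ray isOpen_interior hR.contDiffOn (hmem τ hτ)).add
        ((hasDerivAt_pow 2 τ).const_mul (e / 2))).sub (hlin'.sub (hlin.log hp.ne'))
      exact h1.congr_deriv (by push_cast; ring))
    (fun τ hτ => by
      have hp : 0 < 1 + r * τ := by have := hτ.1; positivity
      have hlin : HasDerivAt (fun τ => 1 + r * τ) r τ := by
        simpa using ((hasDerivAt_id τ).const_mul r).const_add 1
      have h1 := ((hasDerivAt_ray_gradient isOpen_interior hR.contDiffOn (hmem τ hτ)).add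
        ((hasDerivAt_id τ).const_mul e)).sub
          ((hasDerivAt_const τ r).sub ((hasDerivAt_const τ r).div hlin hp.ne'))
      exact h1.congr_deriv (by field_simp; ring))
    (fun τ hτ => sub_nonneg.2 (hlow τ hτ))
  simp only [zero_smul, add_zero, mul_zero, one_smul, mul_one] at h
  unfold bregman
  rw [add_sub_cancel_left]
  norm_num only [one_pow, Real.log_one] at h
  linarith

/-- In a bounded set the Hessian of a barrier is positive definite. -/
theorem hessian_pos (hR : IsSelfConcordantBarrier X ν R) (hX : Bornology.IsBounded X)
    (hx : x ∈ interior X) (hs : s ≠ 0) : 0 < ⟪s, hessian R x s⟫_ℝ := by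
  refine lt_of_le_of_ne (hR.hessian_nonneg hx s) fun h0 => ?_
  obtain ⟨D, hD⟩ := hX.exists_norm_le
  have hs0 := norm_pos_iff.2 hs
  -- A degenerate direction would put the whole line inside the Dikin ellipsoid; this multiple of
  -- `s` already leaves the bounded set.
  set k : ℝ := (D + ‖x‖ + 1) / ‖s‖
  have hmem : x + k • s ∈ interior X := hR.add_mem_interior hx (by
    simp [inner_smul_left, inner_smul_right, ← h0])
  have h1 := hD _ (interior_subset hmem)
  have h2 : ‖k • s‖ = D + ‖x‖ + 1 := by
    have hDn : 0 ≤ D := (norm_nonneg _).trans h1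
    rw [norm_smul, Real.norm_eq_abs, abs_of_nonneg (by positivity), div_mul_cancel₀ _ hs0.ne']
  have h3 := norm_sub_le (x + k • s) x
  rw [add_sub_cancel_left] at h3
  linarith

theorem gradient_eq_zero (hx : x ∈ interior X)
    (hmin : IsMinOn R (interior X) x) : gradient R x = 0 := by
  have h : IsLocalMin R x := hmin.isLocalMin (isOpen_interior.mem_nhds hx)
  have := h.fderiv_eq_zero
  simp [gradient, this]

/-- The divergence between two minimisers vanishes, whereas the lower bound `√q - log (1 + √q)`,
reached by letting `e → 0`, is positive because the Hessian is definite. This makes the initial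
pivot deterministic. -/
theorem eq_of_isMinOn (hR : IsSelfConcordantBarrier X ν R) (hX : Convex ℝ X)
    (hXb : Bornology.IsBounded X) {y : EuclideanSpace ℝ (Fin m)} (hx : x ∈ interior X)
    (hy : y ∈ interior X) (hxm : IsMinOn R (interior X) x) (hym : IsMinOn R (interior X) y) :
    x = y := by
  by_contra hne
  have hs : y - x ≠ 0 := sub_ne_zero.2 (Ne.symm hne)
  have hq := hR.hessian_pos hXb hx hs
  set q := ⟪y - x, hessian R x (y - x)⟫_ℝ with hqdef
  have hD : bregman R (x + (y - x)) x = 0 := by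
    unfold bregman
    have h : R y = R x := le_antisymm (hym hx) (hxm hy)
    rw [gradient_eq_zero hx hxm, inner_zero_left, add_sub_cancel, h]
    ring
  have hlim : Tendsto (fun e : ℝ => e / 2 - (√(q + e) - Real.log (1 + √(q + e))))
      (𝓝[>] 0) (𝓝 (0 / 2 - (√(q + 0) - Real.log (1 + √(q + 0))))) := by
    have hc : ContinuousAt (fun e : ℝ => e / 2 - (√(q + e) - Real.log (1 + √(q + e)))) 0 := by
      have : (1 : ℝ) + √(q + 0) ≠ 0 := by positivity
      fun_prop (disch := assumption)
    exact hc.tendsto.mono_left nhdsWithin_le_nhds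
  have h0 := ge_of_tendsto (b := 0) hlim (by
    filter_upwards [self_mem_nhdsWithin] with e he
    have := hR.sub_log_le_bregman_add hX hx (s := y - x) (by simpa using hy) he
    rw [hD] at this
    linarith)
  have hr : 0 < √q := Real.sqrt_pos.2 hq
  have hlog := Real.log_lt_sub_one_of_pos (show 0 < 1 + √q by linarith) (by linarith)
  simp only [add_zero, zero_div] at h0
  linarith

/-- A barrier grows at most logarithmically in the inverse distance to the boundary. -/
theorem sub_le_mul_log (hR : IsSelfConcordantBarrier X ν R) {y : EuclideanSpace ℝ (Fin m)}
    (hX : Convex ℝ X) (hx : x ∈ interior X) (hy : y ∈ X) {T : ℝ} (hT : 1 ≤ T) :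
    R (x + (1 - 1 / T) • (y - x)) - R x ≤ ν * Real.log T := by
  have hmem : ∀ τ : ℝ, 0 ≤ τ → τ < 1 → x + τ • (y - x) ∈ interior X := by
    intro τ h0 h1
    have := hX.combo_interior_self_mem_interior hx hy (a := 1 - τ) (b := τ) (by linarith) h0
      (by ring)
    convert this using 1
    module
  have hν := hR.nonneg
  set s := y - x with hs
  -- The slope `g` satisfies `g² ≤ ν g'`, so `1/g` decreases at rate at least `1/ν` wherever `g >
  -- 0`. If the bound failed, `1/g` would reach zero by time `τ + ν / g τ < 1`, inside the domain.
  have hd1 : ∀ τ : ℝ, 0 ≤ τ → τ < 1 → ⟪gradient R (x + τ • s), s⟫_ℝ * (1 - τ) ≤ ν := by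
    intro τ h0 h1
    by_contra hcon
    push Not at hcon
    have hgpos : 0 < ⟪gradient R (x + τ • s), s⟫_ℝ := by
      by_contra hneg
      push Not at hneg
      nlinarith
    set g : ℝ → ℝ := fun τ => ⟪gradient R (x + τ • s), s⟫_ℝ with hg
    set q : ℝ → ℝ := fun τ => ⟪s, hessian R (x + τ • s) s⟫_ℝ with hq
    have hgd : ∀ τ' : ℝ, 0 ≤ τ' → τ' < 1 → HasDerivAt g (q τ') τ' := fun τ' h0' h1' =>
      hasDerivAt_ray_gradient isOpen_interior hR.contDiffOn (hmem τ' h0' h1')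
    have hqn : ∀ τ' : ℝ, 0 ≤ τ' → τ' < 1 → 0 ≤ q τ' := fun τ' h0' h1' =>
      hR.hessian_nonneg (hmem τ' h0' h1') s
    have hsq : ∀ τ' : ℝ, 0 ≤ τ' → τ' < 1 → g τ' ^ 2 ≤ ν * q τ' := by
      intro τ' h0' h1'
      have h := hR.gradient_le _ (hmem τ' h0' h1') s
      rw [← Real.sqrt_mul hν] at h
      have h2 := pow_le_pow_left₀ (abs_nonneg _) h 2
      rwa [sq_abs, Real.sq_sqrt (mul_nonneg hν (hqn τ' h0' h1'))] at h2
    have hg0 : 0 < g τ := hgpos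
    have hν0 : 0 < ν := by
      have h2 := hsq τ h0 h1
      by_contra hneg
      have : ν = 0 := le_antisymm (not_lt.1 hneg) hν
      rw [this] at h2
      nlinarith [pow_pos hg0 2]
    have hτ'1 : τ + ν / g τ < 1 := by
      have : ν / g τ < 1 - τ := (div_lt_iff₀' hg0).2 hcon
      linarith
    have hsub : ∀ w ∈ Icc τ (τ + ν / g τ), 0 ≤ w ∧ w < 1 := fun w hw =>
      ⟨h0.trans hw.1, hw.2.trans_lt hτ'1⟩
    have hτle : τ ≤ τ + ν / g τ := by have := div_pos hν0 hg0; linarith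
    have hmono : MonotoneOn g (Icc τ (τ + ν / g τ)) :=
      monotoneOn_of_hasDerivWithinAt_nonneg (convex_Icc _ _)
        (fun w hw => (hgd w (hsub w hw).1 (hsub w hw).2).continuousAt.continuousWithinAt)
        (fun w hw => (hgd w (hsub w (interior_subset hw)).1
          (hsub w (interior_subset hw)).2).hasDerivWithinAt)
        (fun w hw => hqn w (hsub w (interior_subset hw)).1 (hsub w (interior_subset hw)).2)
    have hgw : ∀ w ∈ Icc τ (τ + ν / g τ), 0 < g w := fun w hw =>
      hg0.trans_le (hmono (left_mem_Icc.2 hτle) hw hw.1)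
    have hFd : ∀ w ∈ Icc τ (τ + ν / g τ),
        HasDerivAt (fun w => (g w)⁻¹ + w / ν) (-q w / g w ^ 2 + 1 / ν) w := fun w hw =>
      ((hgd w (hsub w hw).1 (hsub w hw).2).inv (hgw w hw).ne').add
        ((hasDerivAt_id w).div_const ν)
    have hanti : AntitoneOn (fun w => (g w)⁻¹ + w / ν) (Icc τ (τ + ν / g τ)) :=
      antitoneOn_of_hasDerivWithinAt_nonpos (convex_Icc _ _)
        (fun w hw => (hFd w hw).continuousAt.continuousWithinAt)
        (fun w hw => (hFd w (interior_subset hw)).hasDerivWithinAt)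
        (fun w hw => by
          have hw := interior_subset hw
          have h2 := hsq w (hsub w hw).1 (hsub w hw).2
          have h3 : 1 / ν ≤ q w / g w ^ 2 := by
            rw [div_le_div_iff₀ hν0 (pow_pos (hgw w hw) 2)]
            linarith
          rw [neg_div]
          linarith)
    have h2 := hanti (left_mem_Icc.2 hτle) (right_mem_Icc.2 hτle) hτle
    have h3 : (τ + ν / g τ) / ν = τ / ν + (g τ)⁻¹ := by field_simp
    simp only [h3] at h2
    have h4 := inv_pos.2 (hgw _ (right_mem_Icc.2 hτle))
    linarith
  have hT0 : 0 < T := by linarith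
  have hb0 : 0 ≤ 1 - 1 / T := by
    rw [sub_nonneg, div_le_one hT0]; exact hT
  have hb1 : 1 - 1 / T < 1 := by
    have : 0 < 1 / T := by positivity
    linarith
  have hlt : ∀ w ∈ Icc 0 (1 - 1 / T), w < 1 := fun w hw => hw.2.trans_lt hb1
  -- Integrates the slope bound `ν / (1 - w)`; the endpoint `1 - 1/T` yields `ν log T`.
  have hFd : ∀ w ∈ Icc 0 (1 - 1 / T), HasDerivAt (fun w => R (x + w • s) + ν * Real.log (1 - w))
      (⟪gradient R (x + w • s), s⟫_ℝ + ν * (-1 / (1 - w))) w := fun w hw =>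
    (hasDerivAt_ray isOpen_interior hR.contDiffOn (hmem w hw.1 (hlt w hw))).add
      ((((hasDerivAt_id w).const_sub 1).log (sub_pos.2 (hlt w hw)).ne').const_mul ν)
  have hanti : AntitoneOn (fun w => R (x + w • s) + ν * Real.log (1 - w)) (Icc 0 (1 - 1 / T)) :=
    antitoneOn_of_hasDerivWithinAt_nonpos (convex_Icc _ _)
      (fun w hw => (hFd w hw).continuousAt.continuousWithinAt)
      (fun w hw => (hFd w (interior_subset hw)).hasDerivWithinAt)
      (fun w hw => by
        have hw := interior_subset hw
        have hpos := sub_pos.2 (hlt w hw)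
        have h2 := (le_div_iff₀ hpos).2 (hd1 w hw.1 (hlt w hw))
        have h3 : ν * (-1 / (1 - w)) = -(ν / (1 - w)) := by ring
        rw [h3]
        linarith)
  have h2 := hanti (left_mem_Icc.2 hb0) (right_mem_Icc.2 hb0) hb0
  have h3 : 1 - (1 - 1 / T) = T⁻¹ := by rw [one_div]; ring
  simp only [h3, Real.log_inv, zero_smul, add_zero, sub_zero, Real.log_one, mul_zero] at h2
  linarith

end IsSelfConcordantBarrier

end SelfConcordance

end BanditGame

namespace BanditGame

/-! ### Local norms and the one-step inequality of the prox-mapping. -/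

section ProxStep

variable {m : ℕ} {X : Set (EuclideanSpace ℝ (Fin m))} {ν : ℝ}
  {R : EuclideanSpace ℝ (Fin m) → ℝ} {x x' v : EuclideanSpace ℝ (Fin m)} {η c : ℝ}

theorem IsSelfConcordantBarrier.isCompact_sublevel (hR : IsSelfConcordantBarrier X ν R)
    (hX : IsCompact X) (b : ℝ) : IsCompact {y | y ∈ interior X ∧ R y ≤ b} := by
  refine hX.of_isClosed_subset ?_ fun y hy => interior_subset hy.1
  refine isClosed_of_closure_subset fun y hy => ?_
  have hne : (𝓝[{y | y ∈ interior X ∧ R y ≤ b}] y).NeBot := mem_closure_iff_nhdsWithin_neBot.1 hy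
  have hyX : y ∈ closure X :=
    closure_mono (fun w hw => interior_subset hw.1) hy
  have hle : 𝓝[{y | y ∈ interior X ∧ R y ≤ b}] y ≤ 𝓝[interior X] y :=
    nhdsWithin_mono _ fun w hw => hw.1
  have hint : y ∈ interior X := by
    by_contra hcon
    have h := ((hR.barrier y ⟨hyX, hcon⟩).mono_left hle).eventually_gt_atTop b
    obtain ⟨w, hw1, hw2⟩ := (h.and self_mem_nhdsWithin).exists
    exact absurd hw2.2 (not_le.2 hw1)
  refine ⟨hint, ?_⟩
  have hc : Tendsto R (𝓝[{y | y ∈ interior X ∧ R y ≤ b}] y) (𝓝 (R y)) :=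
    (hR.contDiffOn.continuousOn y hint).tendsto.mono_left hle
  exact le_of_tendsto hc (by filter_upwards [self_mem_nhdsWithin] with w hw using hw.2)

namespace IsInvSqrt

variable {A M : EuclideanSpace ℝ (Fin m) →L[ℝ] EuclideanSpace ℝ (Fin m)}

theorem apply_apply_apply (hA : IsInvSqrt A M) (y : EuclideanSpace ℝ (Fin m)) :
    A (A (M y)) = y := congrArg (fun L => L y) hA.2.1

theorem apply_apply_apply' (hA : IsInvSqrt A M) (y : EuclideanSpace ℝ (Fin m)) :
    M (A (A y)) = y := congrArg (fun L => L y) hA.2.2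

/-- Applying `A²` to `A M A y` gives `A² y`, and cancelling `A²` leaves `A M A = id`; no separate
commutation argument is needed. -/
theorem inverse_eq (hA : IsInvSqrt A M) : A.inverse = M ∘L A := by
  refine ContinuousLinearMap.inverse_eq ?_ ?_
  · ext1 y
    have h := hA.apply_apply_apply' (A (M (A y)))
    rw [hA.apply_apply_apply] at h
    have h2 : A (A (A (M (A y)))) = A (A y) := by rw [hA.apply_apply_apply]
    have h3 := congrArg M h2
    rw [hA.apply_apply_apply', hA.apply_apply_apply'] at h3
    exact h3
  · ext1 y
    exact hA.apply_apply_apply' y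

theorem apply_inverse (hA : IsInvSqrt A M) (y : EuclideanSpace ℝ (Fin m)) :
    A (A.inverse y) = y := by
  have h2 : A (A (A (M (A y)))) = A (A y) := by rw [hA.apply_apply_apply]
  have h3 := congrArg M h2
  rw [hA.apply_apply_apply', hA.apply_apply_apply'] at h3
  rw [hA.inverse_eq]
  exact h3

theorem inverse_apply (hA : IsInvSqrt A M) (y : EuclideanSpace ℝ (Fin m)) :
    A.inverse (A y) = y := by
  rw [hA.inverse_eq]
  exact hA.apply_apply_apply' y

theorem inner_left (hA : IsInvSqrt A M) (y w : EuclideanSpace ℝ (Fin m)) :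
    ⟪A y, w⟫_ℝ = ⟪y, A w⟫_ℝ := by
  have := hA.1.isSymmetric y w
  exact this

theorem inner_inverse_left (hA : IsInvSqrt A M) (y w : EuclideanSpace ℝ (Fin m)) :
    ⟪A.inverse y, w⟫_ℝ = ⟪y, A.inverse w⟫_ℝ := by
  conv_lhs => rw [← hA.apply_inverse w]
  rw [← hA.inner_left, hA.apply_inverse]

theorem inverse_inverse (hA : IsInvSqrt A M) (y : EuclideanSpace ℝ (Fin m)) :
    A.inverse (A.inverse y) = M y := by
  rw [← hA.apply_apply_apply y, hA.inverse_apply, hA.inverse_apply, hA.apply_apply_apply]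

theorem inner_self_eq (hA : IsInvSqrt A M) (y : EuclideanSpace ℝ (Fin m)) :
    ⟪y, M y⟫_ℝ = ‖A.inverse y‖ ^ 2 := by
  rw [← hA.inverse_inverse, ← hA.inner_inverse_left, real_inner_self_eq_norm_sq]

end IsInvSqrt

section Dikin

variable {A : EuclideanSpace ℝ (Fin m) →L[ℝ] EuclideanSpace ℝ (Fin m)}

/-- Identifies `‖A⁻¹ y‖` as the local norm at `x` of the regularised barrier. -/
theorem inner_hessian_add_eq (hA : IsInvSqrt A (hessian R x + c • ContinuousLinearMap.id ℝ _))
    (y : EuclideanSpace ℝ (Fin m)) :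
    ⟪y, hessian R x y⟫_ℝ + c * ‖y‖ ^ 2 = ‖A.inverse y‖ ^ 2 := by
  rw [← hA.inner_self_eq]
  simp [inner_add_right, inner_smul_right]

theorem mul_norm_sq_le (hR : IsSelfConcordantBarrier X ν R) (hx : x ∈ interior X)
    (hA : IsInvSqrt A (hessian R x + c • ContinuousLinearMap.id ℝ _))
    (z : EuclideanSpace ℝ (Fin m)) : c * ‖A z‖ ^ 2 ≤ ‖z‖ ^ 2 := by
  have h := inner_hessian_add_eq hA (A z)
  rw [hA.inverse_apply] at h
  have := hR.hessian_nonneg hx (A z)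
  linarith

/-- Even for `‖z‖ = 1` the Hessian norm of `A z` is strictly below 1 when `A z ≠ 0`, because the
quadratic part takes a positive share. Played actions are therefore feasible. -/
theorem add_apply_mem_interior (hR : IsSelfConcordantBarrier X ν R) (hx : x ∈ interior X)
    (hc : 0 < c) (hA : IsInvSqrt A (hessian R x + c • ContinuousLinearMap.id ℝ _))
    {z : EuclideanSpace ℝ (Fin m)} (hz : ‖z‖ ≤ 1) : x + A z ∈ interior X := by
  by_cases h0 : A z = 0
  · simpa [h0] using hx
  · refine hR.add_mem_interior hx ?_
    have h := inner_hessian_add_eq hA (A z)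
    rw [hA.inverse_apply] at h
    have h1 : 0 < c * ‖A z‖ ^ 2 := by have := norm_pos_iff.2 h0; positivity
    have h2 : ‖z‖ ^ 2 ≤ 1 := pow_le_one₀ (norm_nonneg _) hz
    linarith

end Dikin

/-- The convex conjugate of `r - log (1 + r)` at `a` is `-a - log (1 - a)`, which is at most `2 a²`
in this range. -/
theorem mul_sub_add_log_le {a r : ℝ} (ha' : a ≤ 1 / 2) (hr : 0 ≤ r) :
    a * r - r + Real.log (1 + r) ≤ 2 * a ^ 2 := by
  have h1a : 0 < 1 - a := by linarith
  have h1 := Real.log_le_sub_one_of_pos (show 0 < (1 - a) * (1 + r) by positivity)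
  rw [Real.log_mul h1a.ne' (by positivity)] at h1
  have h2 := Real.one_sub_inv_le_log_of_pos h1a
  have h3 : (1 - a)⁻¹ ≤ 1 + a + 2 * a ^ 2 := by
    rw [inv_le_iff_one_le_mul₀ h1a]
    nlinarith [mul_nonneg (sq_nonneg a) (sub_nonneg.2 ha')]
  nlinarith

theorem prox_first_order (hR : IsSelfConcordantBarrier X ν R) (hx' : x' ∈ interior X)
    (hmin : IsMinOn (proxObjective R x v η c) (interior X) x') (s : EuclideanSpace ℝ (Fin m)) :
    ⟪gradient R x' - gradient R x, s⟫_ℝ = η * ⟪v, s⟫_ℝ - c * ⟪x' - x, s⟫_ℝ := by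
  have hcont : ContinuousAt (fun τ : ℝ => x' + τ • s) 0 := by fun_prop
  have hev : ∀ᶠ τ : ℝ in 𝓝 0, x' + τ • s ∈ interior X :=
    hcont.preimage_mem_nhds (by simpa using isOpen_interior.mem_nhds hx')
  have hloc : IsLocalMin (fun τ : ℝ => proxObjective R x v η c (x' + τ • s)) 0 := by
    filter_upwards [hev] with τ hτ
    simpa using hmin hτ
  have h1 : HasDerivAt (fun τ : ℝ => x' + τ • s) s 0 := hasDerivAt_line x' s 0
  have h2 : HasDerivAt (fun τ : ℝ => ⟪v, x - (x' + τ • s)⟫_ℝ) (⟪v, -s⟫_ℝ) 0 := by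
    have := (hasDerivAt_const (0 : ℝ) v).inner ℝ (h1.const_sub x)
    simpa using this
  have h3 := (h1.const_sub x).norm_sq
  have h4 : HasDerivAt (fun τ : ℝ => R (x' + τ • s)) ⟪gradient R x', s⟫_ℝ 0 := by
    have := hasDerivAt_ray (x := x') (s := s) (τ := 0) isOpen_interior hR.contDiffOn
      (by simpa using hx')
    simpa using this
  have h5 : HasDerivAt (fun τ : ℝ => ⟪gradient R x, x' + τ • s - x⟫_ℝ) (⟪gradient R x, s⟫_ℝ) 0 := by
    have := (hasDerivAt_const (0 : ℝ) (gradient R x)).inner ℝ (h1.sub_const x)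
    simpa using this
  have h6 := ((h2.const_mul η).add (h3.const_mul (c / 2))).add ((h4.sub_const (R x)).sub h5)
  have h7 := hloc.hasDerivAt_eq_zero h6
  simp only [zero_smul, add_zero, inner_neg_right] at h7
  have h8 : ⟪x - x', s⟫_ℝ = -⟪x' - x, s⟫_ℝ := by rw [← inner_neg_left, neg_sub]
  rw [h8] at h7
  rw [inner_sub_left]
  linarith

theorem prox_gradient_eq (hR : IsSelfConcordantBarrier X ν R) (hx' : x' ∈ interior X)
    (hmin : IsMinOn (proxObjective R x v η c) (interior X) x') :
    gradient R x' + c • x' = gradient R x + c • x + η • v := by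
  refine ext_inner_right ℝ fun s => ?_
  have h := prox_first_order hR hx' hmin s
  simp only [inner_sub_left, inner_add_left, inner_smul_left, conj_trivial] at h ⊢
  linarith

/-- Comparison with the candidate `y = x`. It keeps the barrier value of the next pivot under
control, which is what integrability requires. -/
theorem prox_value_le (hc : 0 ≤ c) (hx : x ∈ interior X)
    (hmin : IsMinOn (proxObjective R x v η c) (interior X) x') :
    R x' ≤ R x + ⟪gradient R x, x' - x⟫_ℝ + η * ⟪v, x' - x⟫_ℝ := by
  have h := hmin hx
  simp only [mem_ofPred_eq, proxObjective, bregman, sub_self, inner_zero_right, norm_zero] at h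
  have h1 : ⟪v, x - x'⟫_ℝ = -⟪v, x' - x⟫_ℝ := by rw [← inner_neg_right, neg_sub]
  rw [h1] at h
  have : 0 ≤ c / 2 * ‖x - x'‖ ^ 2 := by positivity
  nlinarith

/-- With `e = c ‖x' - x‖²` the Bregman lower bound is in terms of `‖A⁻¹ (x' - x)‖`, and `e / 2` is
exactly the quadratic term. Duality of the norms `‖A v‖` and `‖A⁻¹ ·‖` reduces the rest to the
scalar inequality. -/
theorem inner_sub_bregman_le (hR : IsSelfConcordantBarrier X ν R) (hX : Convex ℝ X)
    (hx : x ∈ interior X) (hx' : x' ∈ interior X) (hc : 0 < c) (hη : 0 ≤ η)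
    {A : EuclideanSpace ℝ (Fin m) →L[ℝ] EuclideanSpace ℝ (Fin m)}
    (hA : IsInvSqrt A (hessian R x + c • ContinuousLinearMap.id ℝ _))
    (ha : η * ‖A v‖ ≤ 1 / 2) :
    η * ⟪v, x' - x⟫_ℝ - (bregman R x' x + c / 2 * ‖x' - x‖ ^ 2) ≤ 2 * (η * ‖A v‖) ^ 2 := by
  by_cases h0 : x' = x
  · subst h0
    simp only [sub_self, inner_zero_right, bregman, norm_zero]
    have : 0 ≤ 2 * (η * ‖A v‖) ^ 2 := by positivity
    linarith
  · have hs := norm_pos_iff.2 (sub_ne_zero.2 h0)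
    have h := hR.sub_log_le_bregman_add hX hx (s := x' - x) (by simpa using hx')
      (e := c * ‖x' - x‖ ^ 2) (by positivity)
    rw [inner_hessian_add_eq hA, Real.sqrt_sq (norm_nonneg _), add_sub_cancel] at h
    have h1 : ⟪v, x' - x⟫_ℝ ≤ ‖A v‖ * ‖A.inverse (x' - x)‖ := by
      rw [← hA.apply_inverse (x' - x), ← hA.inner_left, hA.inverse_apply]
      exact real_inner_le_norm _ _
    have h2 := mul_sub_add_log_le ha (norm_nonneg (A.inverse (x' - x)))
    have h3 := mul_le_mul_of_nonneg_left h1 hη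
    nlinarith

/-- One step of the prox-mapping, compared with an arbitrary point `p`. -/
theorem prox_step (hR : IsSelfConcordantBarrier X ν R) (hX : Convex ℝ X)
    (hx : x ∈ interior X) (hx' : x' ∈ interior X) (hc : 0 < c) (hη : 0 ≤ η)
    {A : EuclideanSpace ℝ (Fin m) →L[ℝ] EuclideanSpace ℝ (Fin m)}
    (hA : IsInvSqrt A (hessian R x + c • ContinuousLinearMap.id ℝ _))
    (ha : η * ‖A v‖ ≤ 1 / 2)
    (hmin : IsMinOn (proxObjective R x v η c) (interior X) x') (p : EuclideanSpace ℝ (Fin m)) :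
    bregman R p x' + c / 2 * ‖x' - p‖ ^ 2 ≤
      bregman R p x + c / 2 * ‖x - p‖ ^ 2 + η * ⟪v, x - p⟫_ℝ + 2 * (η * ‖A v‖) ^ 2 := by
  have h1 := inner_sub_bregman_le hR hX hx hx' hc hη hA ha
  have h2 := prox_first_order hR hx' hmin (p - x')
  -- Three-point identity for the quadratic part; `h5` is its analogue for the divergence, and
  -- stationarity tested on `p - x'` links the two.
  have h3 : ‖x - p‖ ^ 2 = ‖x' - p‖ ^ 2 + ‖x' - x‖ ^ 2 + 2 * ⟪x' - x, p - x'⟫_ℝ := by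
    rw [← norm_neg (x - p), ← norm_neg (x' - p),
      show -(x - p) = (p - x') + (x' - x) by abel, neg_sub, norm_add_sq_real,
      real_inner_comm (p - x')]
    ring
  have h4 : ⟪v, x - p⟫_ℝ = -⟪v, p - x'⟫_ℝ - ⟪v, x' - x⟫_ℝ := by
    rw [← inner_neg_right, ← inner_sub_right]
    congr 1
    abel
  have h5 : ⟪gradient R x, p - x⟫_ℝ = ⟪gradient R x, p - x'⟫_ℝ + ⟪gradient R x, x' - x⟫_ℝ := by
    rw [← inner_add_right]
    congr 1
    abel
  rw [inner_sub_left] at h2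
  rw [h3, h4]
  unfold bregman at h1 ⊢
  rw [h5]
  nlinarith

end ProxStep

end BanditGame

namespace BanditGame

/-! ### Invariance and second moments of the uniform measure on the sphere. -/

section Sphere

variable {m : ℕ}

/-- The action of a linear isometry on the unit sphere. -/
noncomputable def sphereMap (e : EuclideanSpace ℝ (Fin m) ≃ₗᵢ[ℝ] EuclideanSpace ℝ (Fin m))
    (z : Metric.sphere (0 : EuclideanSpace ℝ (Fin m)) 1) :
    Metric.sphere (0 : EuclideanSpace ℝ (Fin m)) 1 :=
  ⟨e z, by simp⟩

theorem continuous_sphereMap (e : EuclideanSpace ℝ (Fin m) ≃ₗᵢ[ℝ] EuclideanSpace ℝ (Fin m)) :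
    Continuous (sphereMap e) :=
  (e.continuous.comp continuous_subtype_val).subtype_mk _

theorem measurable_sphereMap (e : EuclideanSpace ℝ (Fin m) ≃ₗᵢ[ℝ] EuclideanSpace ℝ (Fin m)) :
    Measurable (sphereMap e) := (continuous_sphereMap e).measurable

-- Surface measure is defined by the volume of cones over subsets of the sphere, and isometries
-- preserve volume and commute with forming cones.
open scoped Pointwise in
theorem measurePreserving_sphereMap
    (e : EuclideanSpace ℝ (Fin m) ≃ₗᵢ[ℝ] EuclideanSpace ℝ (Fin m)) :
    MeasurePreserving (sphereMap e) (sphereUniform m) (sphereUniform m) := by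
  refine ⟨measurable_sphereMap e, ?_⟩
  unfold sphereUniform
  rw [Measure.map_smul]
  congr 1
  ext s hs
  rw [Measure.map_apply (measurable_sphereMap e) hs, Measure.toSphere_apply' _ hs,
    Measure.toSphere_apply' _ (measurable_sphereMap e hs)]
  congr 1
  have hset : (Ioo (0 : ℝ) 1 • (Subtype.val '' (sphereMap e ⁻¹' s)) : Set (EuclideanSpace ℝ (Fin m))) =
      e ⁻¹' (Ioo (0 : ℝ) 1 • (Subtype.val '' s)) := by
    ext y
    simp only [Set.mem_smul, mem_image, mem_preimage]
    constructor
    · rintro ⟨r, hr, w, ⟨z, hz, rfl⟩, rfl⟩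
      exact ⟨r, hr, _, ⟨_, hz, rfl⟩, by simp [sphereMap]⟩
    · rintro ⟨r, hr, w, ⟨z, hz, rfl⟩, h⟩
      refine ⟨r, hr, e.symm z, ⟨⟨e.symm z, by simp⟩, ?_, rfl⟩, ?_⟩
      · convert hz using 1
        ext1
        simp [sphereMap]
      · apply e.injective
        simp [h]
  rw [hset]
  exact e.measurePreserving.measure_preimage_emb e.toHomeomorph.measurableEmbedding _

theorem integrable_inner_sq [IsFiniteMeasure (sphereUniform m)] (a : EuclideanSpace ℝ (Fin m)) :
    Integrable (fun z : Metric.sphere (0 : EuclideanSpace ℝ (Fin m)) 1 =>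
      ⟪(z : EuclideanSpace ℝ (Fin m)), a⟫_ℝ ^ 2) (sphereUniform m) := by
  refine Integrable.of_bound (C := ‖a‖ ^ 2) ?_ (ae_of_all _ fun z => ?_)
  · exact (by fun_prop : Continuous _).aestronglyMeasurable
  · have h := abs_real_inner_le_norm (z : EuclideanSpace ℝ (Fin m)) a
    rw [norm_eq_of_mem_sphere z, one_mul] at h
    rw [norm_pow]
    exact pow_le_pow_left₀ (norm_nonneg _) h 2

theorem integral_inner_sq_eq {a b : EuclideanSpace ℝ (Fin m)} (hab : ‖a‖ = ‖b‖) :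
    ∫ z, ⟪(z : EuclideanSpace ℝ (Fin m)), a⟫_ℝ ^ 2 ∂(sphereUniform m) =
      ∫ z, ⟪(z : EuclideanSpace ℝ (Fin m)), b⟫_ℝ ^ 2 ∂(sphereUniform m) := by
  set e := (ℝ ∙ (a - b))ᗮ.reflection with he
  have h := (measurePreserving_sphereMap e).map_eq
  conv_rhs => rw [← h]
  rw [integral_map (measurable_sphereMap e).aemeasurable
    (by fun_prop : Continuous _).aestronglyMeasurable]
  congr 1
  ext z
  have h2 : e a = b := Submodule.reflection_sub hab
  simp only [sphereMap]
  rw [← h2, e.inner_map_map]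

/-- By reflection invariance the second moment depends only on `‖a‖`; summing over an orthonormal
basis scaled by `‖a‖` gives the constant `‖a‖²`. -/
theorem mul_integral_inner_sq [IsProbabilityMeasure (sphereUniform m)]
    (a : EuclideanSpace ℝ (Fin m)) :
    m * ∫ z, ⟪(z : EuclideanSpace ℝ (Fin m)), a⟫_ℝ ^ 2 ∂(sphereUniform m) = ‖a‖ ^ 2 := by
  let b := EuclideanSpace.basisFun (Fin m) ℝ
  have h1 : ∀ j, ∫ z, ⟪(z : EuclideanSpace ℝ (Fin m)), ‖a‖ • b j⟫_ℝ ^ 2 ∂(sphereUniform m) =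
      ∫ z, ⟪(z : EuclideanSpace ℝ (Fin m)), a⟫_ℝ ^ 2 ∂(sphereUniform m) := fun j =>
    integral_inner_sq_eq (by rw [norm_smul, b.orthonormal.1 j]; simp)
  have h2 : ∑ j, ∫ z, ⟪(z : EuclideanSpace ℝ (Fin m)), ‖a‖ • b j⟫_ℝ ^ 2 ∂(sphereUniform m) =
      ‖a‖ ^ 2 := by
    rw [← integral_finsetSum _ fun j _ => integrable_inner_sq _]
    have : ∀ z : Metric.sphere (0 : EuclideanSpace ℝ (Fin m)) 1,
        ∑ j, ⟪(z : EuclideanSpace ℝ (Fin m)), ‖a‖ • b j⟫_ℝ ^ 2 = ‖a‖ ^ 2 := by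
      intro z
      have h := b.sum_sq_norm_inner_left (z : EuclideanSpace ℝ (Fin m))
      simp only [norm_eq_of_mem_sphere z, Real.norm_eq_abs, sq_abs] at h
      simp only [inner_smul_right, mul_pow, ← Finset.mul_sum, h]
      simp
    simp [this]
  simp_rw [h1] at h2
  simpa using h2

end Sphere

end BanditGame

namespace BanditGame

/-! ### Bias of the one-point gradient estimator. -/

section GradientEstimate

variable {N : ℕ} {d : Fin N → ℕ} {X : ∀ i, Set (EuclideanSpace ℝ (Fin (d i)))}
  {u : Fin N → Profile d → ℝ}

/-- The joint action played from the pivot `x` with scalings `A` in the directions `Z`. -/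
def playedAction (x : Profile d)
    (A : ∀ i, EuclideanSpace ℝ (Fin (d i)) →L[ℝ] EuclideanSpace ℝ (Fin (d i)))
    (Z : ∀ i, Metric.sphere (0 : EuclideanSpace ℝ (Fin (d i))) 1) : Profile d :=
  fun i => x i + A i (Z i)

theorem IsSmoothConcaveGame.hasFDerivWithinAt (hgame : IsSmoothConcaveGame X u) (i : Fin N)
    {P : Profile d} (hP : P ∈ univ.pi X) {y : EuclideanSpace ℝ (Fin (d i))} (hy : y ∈ X i) :
    HasFDerivWithinAt (fun y => u i (Function.update P i y))
      (InnerProductSpace.toDual ℝ _ (payoffGrad X u i (Function.update P i y))) (X i) y := by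
  have h := (hgame.differentiableOn i P hP y hy).hasGradientWithinAt
  rw [hasGradientWithinAt_iff_hasFDerivWithinAt] at h
  have hg : payoffGrad X u i (Function.update P i y) =
      gradientWithin (fun y => u i (Function.update P i y)) (X i) y := by
    unfold payoffGrad
    simp only [Function.update_idem, Function.update_self]
  rw [hg]
  exact h

theorem update_mem_pi {P : Profile d} (hP : P ∈ univ.pi X) {i : Fin N}
    {y : EuclideanSpace ℝ (Fin (d i))} (hy : y ∈ X i) : Function.update P i y ∈ univ.pi X := by
  intro j _
  by_cases h : j = i
  · subst h; simpa using hy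
  · simpa [h] using hP j trivial

/-- Mean value inequality on `S`: every gradient met there is within `K α` of the one at `x`,
distances in the product being measured in the sup norm. -/
theorem IsSmoothConcaveGame.abs_sub_sub_inner_le (hgame : IsSmoothConcaveGame X u) (i : Fin N)
    {K : NNReal} (hK : LipschitzOnWith K (payoffGrad X u i) (univ.pi X))
    {x P : Profile d} (hx : x ∈ univ.pi X) (hP : P ∈ univ.pi X) {α : ℝ}
    {S : Set (EuclideanSpace ℝ (Fin (d i)))} (hS : Convex ℝ S) (hSX : S ⊆ X i)
    (hα : 0 ≤ α) (hPα : ∀ j, ‖P j - x j‖ ≤ α) (hSα : ∀ y ∈ S, ‖y - x i‖ ≤ α)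
    {y w : EuclideanSpace ℝ (Fin (d i))} (hy : y ∈ S) (hw : w ∈ S) :
    |u i (Function.update P i y) - u i (Function.update P i w) - ⟪payoffGrad X u i x, y - w⟫_ℝ| ≤
      K * α * ‖y - w‖ := by
  have h := Convex.norm_image_sub_le_of_norm_hasFDerivWithin_le'
    (f := fun y => u i (Function.update P i y))
    (φ := InnerProductSpace.toDual ℝ _ (payoffGrad X u i x)) (C := K * α)
    (fun y hy => (hgame.hasFDerivWithinAt i hP (hSX hy)).mono hSX) (fun y hy => ?_) hS hw hy
  · simpa using h
  · rw [← map_sub, LinearIsometryEquiv.norm_map]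
    refine (hK.norm_sub_le (update_mem_pi hP (hSX hy)) hx).trans ?_
    gcongr
    refine (pi_norm_le_iff_of_nonneg hα).2 fun j => ?_
    by_cases h : j = i
    · subst h; simpa using hSα y hy
    · simpa [h] using hPα j

theorem two_mul_inner_sub_reflection {m : ℕ} (h z : EuclideanSpace ℝ (Fin m)) :
    z - (ℝ ∙ h)ᗮ.reflection z = (2 * ⟪z, h⟫_ℝ / ‖h‖ ^ 2) • h := by
  rw [Submodule.reflection_orthogonal_apply, Submodule.reflection_singleton_apply,
    real_inner_comm]
  simp only [RCLike.ofReal_real_eq_id, id_eq]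
  rw [← Nat.cast_smul_eq_nsmul ℝ, smul_smul, mul_div_assoc]
  simp

theorem continuous_payoff_playedAction (hgame : IsSmoothConcaveGame X u) (i : Fin N)
    {x : Profile d} {A : ∀ i, EuclideanSpace ℝ (Fin (d i)) →L[ℝ] EuclideanSpace ℝ (Fin (d i))}
    (hmem : ∀ j, ∀ z : EuclideanSpace ℝ (Fin (d j)), ‖z‖ ≤ 1 → x j + A j z ∈ X j) :
    Continuous fun Z => u i (playedAction x A Z) := by
  refine (hgame.continuousOn i).comp_continuous (f := playedAction x A) ?_ fun Z j _ =>
    hmem j _ (norm_eq_of_mem_sphere (Z j)).le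
  unfold playedAction
  fun_prop

/-- The one-point estimator of the payoff gradient, paired with a vector `q`, is unbiased up to
the size `α` of the perturbation. -/
theorem IsSmoothConcaveGame.abs_integral_estimator_sub_le (hgame : IsSmoothConcaveGame X u)
    [∀ j, IsProbabilityMeasure (sphereUniform (d j))] (i : Fin N)
    {K : NNReal} (hK : LipschitzOnWith K (payoffGrad X u i) (univ.pi X))
    {x : Profile d} (hx : x ∈ univ.pi X)
    {A : ∀ i, EuclideanSpace ℝ (Fin (d i)) →L[ℝ] EuclideanSpace ℝ (Fin (d i))} {α : ℝ}
    (hα : 0 ≤ α)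
    (hmem : ∀ j, ∀ z : EuclideanSpace ℝ (Fin (d j)), ‖z‖ ≤ 1 → x j + A j z ∈ X j)
    (hAα : ∀ j, ∀ z : EuclideanSpace ℝ (Fin (d j)), ‖z‖ ≤ 1 → ‖A j z‖ ≤ α)
    (h q : EuclideanSpace ℝ (Fin (d i))) (hq : A i h = q) :
    |d i * ∫ Z, u i (playedAction x A Z) * ⟪(Z i : EuclideanSpace ℝ (Fin (d i))), h⟫_ℝ
        ∂(Measure.pi fun j => sphereUniform (d j)) - ⟪payoffGrad X u i x, q⟫_ℝ| ≤
      K * α * ‖q‖ := by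
  by_cases hh : h = 0
  · subst hh
    have hq0 : q = 0 := by rw [← hq, map_zero]
    simp [hq0]
  have hh0 : 0 < ‖h‖ ^ 2 := by have := norm_pos_iff.2 hh; positivity
  set π := Measure.pi fun j => sphereUniform (d j) with hπ
  -- Reflecting only player `i`'s direction preserves the product measure and changes the sign of
  -- `⟨z_i, h⟩`. The one-point estimator thus becomes an average of two-point differences, without
  -- any smoothed payoff.
  set ρ := (ℝ ∙ h)ᗮ.reflection with hρ
  let f : ∀ j, Metric.sphere (0 : EuclideanSpace ℝ (Fin (d j))) 1 →
      Metric.sphere (0 : EuclideanSpace ℝ (Fin (d j))) 1 :=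
    Function.update (fun j => id) i (sphereMap ρ)
  have hf : ∀ j, MeasurePreserving (f j) (sphereUniform (d j)) (sphereUniform (d j)) := by
    intro j
    by_cases hj : j = i
    · subst hj; simpa [f] using measurePreserving_sphereMap ρ
    · simpa [f, hj] using MeasurePreserving.id _
  have hfc : ∀ j, Continuous (f j) := by
    intro j
    by_cases hj : j = i
    · subst hj
      simpa [f] using continuous_sphereMap ρ
    · simpa [f, hj] using continuous_id
  have hF : MeasurePreserving (fun Z j => f j (Z j)) π π := measurePreserving_pi _ _ hf
  set F : (∀ j, Metric.sphere (0 : EuclideanSpace ℝ (Fin (d j))) 1) →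
    (∀ j, Metric.sphere (0 : EuclideanSpace ℝ (Fin (d j))) 1) := fun Z j => f j (Z j) with hFdef
  have hFc : Continuous F := by fun_prop
  have hFi : ∀ Z, ((F Z) i : EuclideanSpace ℝ (Fin (d i))) = ρ (Z i) := by
    intro Z; simp [F, f, sphereMap]
  set g := fun Z => u i (playedAction x A Z) with hg
  have hgc : Continuous g := continuous_payoff_playedAction hgame i hmem
  set c := fun Z : (∀ j, Metric.sphere (0 : EuclideanSpace ℝ (Fin (d j))) 1) =>
    ⟪(Z i : EuclideanSpace ℝ (Fin (d i))), h⟫_ℝ with hc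
  have hcc : Continuous c := by fun_prop
  have hint : ∀ {φ : (∀ j, Metric.sphere (0 : EuclideanSpace ℝ (Fin (d j))) 1) → ℝ},
      Continuous φ → Integrable φ π := fun hφ =>
    hφ.integrable_of_hasCompactSupport (HasCompactSupport.of_compactSpace _)
  have hcF : ∀ Z, c (F Z) = -c Z := by
    intro Z
    have h1 : ρ h = -h := Submodule.reflection_orthogonalComplement_singleton_eq_neg h
    have h2 : ρ (-h) = h := by rw [map_neg, h1, neg_neg]
    simp only [hc]
    rw [hFi]
    conv_lhs => rw [← h2]
    rw [ρ.inner_map_map, inner_neg_right]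
  have hI : ∫ Z, g Z * c Z ∂π = -∫ Z, g (F Z) * c Z ∂π := by
    have h1 : ∫ Z, g (F Z) * c (F Z) ∂π = ∫ Z, g Z * c Z ∂π := by
      conv_rhs => rw [← hF.map_eq]
      exact (integral_map hF.measurable.aemeasurable (hgc.mul hcc).aestronglyMeasurable).symm
    rw [← h1, ← integral_neg]
    simp [hcF]
  have hI2 : ∫ Z, (g Z - g (F Z)) * c Z ∂π = 2 * ∫ Z, g Z * c Z ∂π := by
    simp_rw [sub_mul]
    have h1 : Integrable (fun Z => g Z * c Z) π := hint (hgc.mul hcc)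
    have h2 : Integrable (fun Z => g (F Z) * c Z) π := hint ((hgc.comp hFc).mul hcc)
    rw [integral_sub h1 h2]
    linarith
  have hsq : d i * ∫ Z, c Z ^ 2 ∂π = ‖h‖ ^ 2 := by
    rw [← mul_integral_inner_sq h]
    congr 1
    exact integral_comp_eval (μ := fun j => sphereUniform (d j)) (i := i)
      (f := fun z => ⟪(z : EuclideanSpace ℝ (Fin (d i))), h⟫_ℝ ^ 2)
      (by fun_prop : Continuous _).aestronglyMeasurable
  -- The two played actions differ only in coordinate `i`, by `(2 c / ‖h‖²) q`. After multiplication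
  -- by `c`, main term and error are both multiples of `c²`, whose mean is known from `hsq`.
  have hpt : ∀ Z, |(g Z - g (F Z)) * c Z - 2 * ⟪payoffGrad X u i x, q⟫_ℝ / ‖h‖ ^ 2 * c Z ^ 2| ≤
      2 * (K * α * ‖q‖) / ‖h‖ ^ 2 * c Z ^ 2 := by
    intro Z
    set P := playedAction x A Z with hPdef
    set S := (fun w => x i + A i w) '' Metric.closedBall 0 1 with hS
    have hZn : ∀ j, ‖(Z j : EuclideanSpace ℝ (Fin (d j)))‖ ≤ 1 := fun j =>
      (norm_eq_of_mem_sphere (Z j)).le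
    have hP : P ∈ univ.pi X := fun j _ => hmem j _ (hZn j)
    have hSc : Convex ℝ S := by
      have h1 : S = (fun w => x i + w) '' (A i '' Metric.closedBall 0 1) := by
        rw [image_image]
      rw [h1]
      exact ((convex_closedBall 0 1).is_linear_image (A i).isLinear).translate _
    have hup : ∀ w, P i = w → Function.update P i w = P := by
      rintro w rfl; simp
    have hFu : playedAction x A (F Z) = Function.update P i (x i + A i (ρ (Z i))) := by
      ext1 j
      by_cases hj : j = i
      · subst hj
        simp [playedAction, hFi]
      · simp [playedAction, F, f, hj, P]
    have h1 := hgame.abs_sub_sub_inner_le i hK hx hP hSc (S := S) (α := α)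
      (by rintro _ ⟨w, hw, rfl⟩; exact hmem i w (by simpa using hw)) hα
      (fun j => by simpa [P, playedAction] using hAα j _ (hZn j))
      (by rintro _ ⟨w, hw, rfl⟩; simpa using hAα i w (by simpa using hw))
      (y := x i + A i (Z i)) (w := x i + A i (ρ (Z i)))
      ⟨_, by simp, rfl⟩ ⟨_, by simp, rfl⟩
    rw [hup (x i + A i (Z i)) rfl, ← hFu] at h1
    have h2 : x i + A i (Z i) - (x i + A i (ρ (Z i))) = (2 * c Z / ‖h‖ ^ 2) • q := by
      rw [add_sub_add_left_eq_sub, ← map_sub, two_mul_inner_sub_reflection, map_smul, hq]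
    rw [h2, inner_smul_right, norm_smul, Real.norm_eq_abs] at h1
    have h3 : (g Z - g (F Z)) * c Z - 2 * ⟪payoffGrad X u i x, q⟫_ℝ / ‖h‖ ^ 2 * c Z ^ 2 =
        (g Z - g (F Z) - 2 * c Z / ‖h‖ ^ 2 * ⟪payoffGrad X u i x, q⟫_ℝ) * c Z := by
      ring
    rw [h3, abs_mul]
    refine (mul_le_mul_of_nonneg_right h1 (abs_nonneg _)).trans (le_of_eq ?_)
    rw [abs_div, abs_mul, abs_of_pos hh0, abs_of_pos (zero_lt_two' ℝ), ← sq_abs (c Z)]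
    ring
  have hc2 : Integrable (fun Z => c Z ^ 2) π := hint (hcc.pow 2)
  have hprod : Integrable (fun Z => (g Z - g (F Z)) * c Z) π :=
    hint ((hgc.sub (hgc.comp hFc)).mul hcc)
  have hfin := (norm_integral_le_integral_norm (μ := π)
    (fun Z => (g Z - g (F Z)) * c Z - 2 * ⟪payoffGrad X u i x, q⟫_ℝ / ‖h‖ ^ 2 * c Z ^ 2)).trans
    (integral_mono (hprod.sub (hc2.const_mul _)).norm
      (hc2.const_mul (2 * (K * α * ‖q‖) / ‖h‖ ^ 2)) hpt)
  rw [integral_sub hprod (hc2.const_mul _), integral_const_mul, integral_const_mul, hI2,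
    Real.norm_eq_abs] at hfin
  have hd : (0 : ℝ) ≤ d i / 2 := by positivity
  have h4 := mul_le_mul_of_nonneg_left hfin hd
  rw [← abs_of_nonneg hd, ← abs_mul, abs_of_nonneg hd] at h4
  set J := ∫ Z, c Z ^ 2 ∂π
  set I := ∫ Z, g Z * c Z ∂π
  have h5 : (d i : ℝ) / 2 * (2 * I - 2 * ⟪payoffGrad X u i x, q⟫_ℝ / ‖h‖ ^ 2 * J) =
      d i * I - ⟪payoffGrad X u i x, q⟫_ℝ * (d i * J / ‖h‖ ^ 2) := by ring
  have h6 : (d i : ℝ) / 2 * (2 * (K * α * ‖q‖) / ‖h‖ ^ 2 * J) =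
      K * α * ‖q‖ * (d i * J / ‖h‖ ^ 2) := by ring
  rw [h5, h6, hsq, div_self hh0.ne', mul_one, mul_one] at h4
  exact h4

end GradientEstimate

end BanditGame

namespace BanditGame

/-! ### Measurability of implicitly defined quantities. -/

section Measurability

theorem _root_.ContinuousOn.measurable_comp {Ω α β : Type*} [MeasurableSpace Ω]
    [TopologicalSpace α] [MeasurableSpace α] [OpensMeasurableSpace α] [TopologicalSpace β]
    [MeasurableSpace β] [BorelSpace β] {f : α → β} {U : Set α} (hf : ContinuousOn f U)
    {x : Ω → α} (hx : Measurable x) (hxU : ∀ ω, x ω ∈ U) : Measurable fun ω => f (x ω) :=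
  (continuousOn_iff_continuous_domRestrict.1 hf).measurable.comp (hx.subtype_mk (h := hxU))

variable {m : ℕ}

/-- On an eigenvector `v` of `A - B` with eigenvalue `c`, equality of squares gives `c (⟨A v, v⟩ +
⟨B v, v⟩) = 0`. If `c ≠ 0`, positivity kills both forms, so `c ‖v‖² = 0`. -/
theorem eq_of_isPositive_of_sq_eq {A B : EuclideanSpace ℝ (Fin m) →L[ℝ] EuclideanSpace ℝ (Fin m)}
    (hA : A.IsPositive) (hB : B.IsPositive) (h : A ∘L A = B ∘L B) : A = B := by
  have hD : ((A - B : EuclideanSpace ℝ (Fin m) →L[ℝ] EuclideanSpace ℝ (Fin m)) :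
      EuclideanSpace ℝ (Fin m) →ₗ[ℝ] EuclideanSpace ℝ (Fin m)).IsSymmetric := by
    have h1 := hA.isSymmetric.sub hB.isSymmetric
    exact h1
  have hn : Module.finrank ℝ (EuclideanSpace ℝ (Fin m)) = m := finrank_euclideanSpace_fin
  rw [← sub_eq_zero]
  have hz : ∀ j, (A - B) (hD.eigenvectorBasis hn j) = 0 := by
    intro j
    set v := hD.eigenvectorBasis hn j with hv
    have hev : (A - B) v = hD.eigenvalues hn j • v := hD.apply_eigenvectorBasis hn j
    set c := hD.eigenvalues hn j
    have h1 : A v - B v = c • v := hev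
    have h2 : ⟪A (A v), v⟫_ℝ = ⟪B (B v), v⟫_ℝ := by
      have := congrArg (fun L => ⟪L v, v⟫_ℝ) h
      exact this
    have hAs : ∀ y w, ⟪A y, w⟫_ℝ = ⟪y, A w⟫_ℝ := fun y w => hA.isSymmetric y w
    have hBs : ∀ y w, ⟪B y, w⟫_ℝ = ⟪y, B w⟫_ℝ := fun y w => hB.isSymmetric y w
    have hAp : 0 ≤ ⟪A v, v⟫_ℝ := by simpa using hA.re_inner_nonneg_left v
    have hBp : 0 ≤ ⟪B v, v⟫_ℝ := by simpa using hB.re_inner_nonneg_left v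
    have hA' : A v = B v + c • v := by rw [← h1]; abel
    have h3 : c * (⟪A v, v⟫_ℝ + ⟪B v, v⟫_ℝ) = 0 := by
      rw [hAs, hBs (B v)] at h2
      have h4 : ⟪A v, A v⟫_ℝ = ⟪A v, B v⟫_ℝ + c * ⟪A v, v⟫_ℝ := by
        conv_lhs => rw [show ⟪A v, A v⟫_ℝ = ⟪A v, B v + c • v⟫_ℝ by rw [← hA']]
        rw [inner_add_right, inner_smul_right]
      have h5 : ⟪A v, B v⟫_ℝ = ⟪B v, B v⟫_ℝ + c * ⟪B v, v⟫_ℝ := by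
        rw [hA', inner_add_left, inner_smul_left, real_inner_comm v]
        simp
      linarith
    rw [hev]
    rcases mul_eq_zero.1 h3 with h4 | h4
    · rw [h4, zero_smul]
    · have h5 : ⟪A v - B v, v⟫_ℝ = 0 := by rw [inner_sub_left]; linarith
      rw [h1, inner_smul_left] at h5
      rcases mul_eq_zero.1 h5 with h6 | h6
      · simp only [conj_trivial] at h6
        rw [h6, zero_smul]
      · rw [inner_self_eq_zero.1 h6, smul_zero]
  have := (hD.eigenvectorBasis hn).toBasis.ext (f₁ := ((A - B :
    EuclideanSpace ℝ (Fin m) →L[ℝ] EuclideanSpace ℝ (Fin m)) :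
      EuclideanSpace ℝ (Fin m) →ₗ[ℝ] EuclideanSpace ℝ (Fin m))) (f₂ := 0) (by simpa using hz)
  ext1 y
  exact congrArg (fun L => L y) this

/-- The positive operators form a closed, hence Polish, set on which squaring is continuous and
injective, so the Lusin–Souslin theorem applies. A random positive operator is then measurable as
soon as its square is. -/
theorem measurableEmbedding_sq : MeasurableEmbedding
    fun A : {A : EuclideanSpace ℝ (Fin m) →L[ℝ] EuclideanSpace ℝ (Fin m) // A.IsPositive} =>
      A.1 ∘L A.1 := by
  have hclosed : IsClosed
      {A : EuclideanSpace ℝ (Fin m) →L[ℝ] EuclideanSpace ℝ (Fin m) | A.IsPositive} := by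
    have : {A : EuclideanSpace ℝ (Fin m) →L[ℝ] EuclideanSpace ℝ (Fin m) | A.IsPositive} =
        (⋂ y, ⋂ w, {A | ⟪A y, w⟫_ℝ = ⟪y, A w⟫_ℝ}) ∩ ⋂ y, {A | 0 ≤ ⟪A y, y⟫_ℝ} := by
      ext A
      simp only [mem_inter_iff, mem_iInter, mem_ofPred_eq]
      constructor
      · exact fun hA => ⟨fun y w => hA.isSymmetric y w, fun y => by
          simpa using hA.re_inner_nonneg_left y⟩
      · exact fun hA => ⟨fun y w => hA.1 y w, fun y => by
          simpa [ContinuousLinearMap.reApplyInnerSelf] using hA.2 y⟩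
    rw [this]
    refine (isClosed_iInter fun y => isClosed_iInter fun w => isClosed_eq ?_ ?_).inter
      (isClosed_iInter fun y => isClosed_le continuous_const ?_) <;> fun_prop
  have : PolishSpace {A : EuclideanSpace ℝ (Fin m) →L[ℝ] EuclideanSpace ℝ (Fin m) //
      A.IsPositive} := hclosed.polishSpace
  refine Continuous.measurableEmbedding ?_ ?_
  · fun_prop
  · intro A B h
    exact Subtype.ext (eq_of_isPositive_of_sq_eq A.2 B.2 h)

variable {X : Set (EuclideanSpace ℝ (Fin m))} {ν : ℝ} {R : EuclideanSpace ℝ (Fin m) → ℝ}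
  {Ω : Type*} [MeasurableSpace Ω] {x x' v : Ω → EuclideanSpace ℝ (Fin m)} {η c : ℝ}

theorem measurable_hessian (hR : IsSelfConcordantBarrier X ν R) (hx : Measurable x)
    (hmem : ∀ ω, x ω ∈ interior X) : Measurable fun ω => hessian R (x ω) :=
  (continuousOn_hessian isOpen_interior hR.contDiffOn).measurable_comp hx hmem

theorem measurable_scaling (hR : IsSelfConcordantBarrier X ν R) (hx : Measurable x)
    (hmem : ∀ ω, x ω ∈ interior X)
    {A : Ω → EuclideanSpace ℝ (Fin m) →L[ℝ] EuclideanSpace ℝ (Fin m)}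
    (hA : ∀ ω, IsInvSqrt (A ω) (hessian R (x ω) + c • ContinuousLinearMap.id ℝ _)) :
    Measurable A := by
  have hM : Measurable fun ω => hessian R (x ω) + c • ContinuousLinearMap.id ℝ
      (EuclideanSpace ℝ (Fin m)) := (measurable_hessian hR hx hmem).add_const _
  have hinv : ContinuousOn (Ring.inverse : (EuclideanSpace ℝ (Fin m) →L[ℝ]
      EuclideanSpace ℝ (Fin m)) → _) {M | IsUnit M} := by
    rintro _ ⟨M, rfl⟩
    exact (NormedRing.inverse_continuousAt M).continuousWithinAt
  have hunit : ∀ ω, ∃ M : (EuclideanSpace ℝ (Fin m) →L[ℝ] EuclideanSpace ℝ (Fin m))ˣ,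
      (M : EuclideanSpace ℝ (Fin m) →L[ℝ] EuclideanSpace ℝ (Fin m)) =
        hessian R (x ω) + c • ContinuousLinearMap.id ℝ _ ∧ M.inv = A ω ∘L A ω := fun ω =>
    ⟨⟨_, A ω ∘L A ω, (hA ω).2.2, (hA ω).2.1⟩, rfl, rfl⟩
  have h1 := hinv.measurable_comp hM (fun ω => by
    obtain ⟨M, hM, -⟩ := hunit ω
    exact ⟨M, hM⟩)
  have h2 : Measurable fun ω => A ω ∘L A ω := by
    convert h1 using 2 with ω
    obtain ⟨M, hM, hM'⟩ := hunit ω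
    rw [← hM, Ring.inverse_unit, ← hM']
    rfl
  have h3 := measurableEmbedding_sq.measurable_comp_iff (mα := inferInstance)
    (f := fun ω => (⟨A ω, (hA ω).1⟩ : {A : EuclideanSpace ℝ (Fin m) →L[ℝ]
      EuclideanSpace ℝ (Fin m) // A.IsPositive}))
  exact measurable_subtype_coe.comp (h3.1 h2)

/-- Stationarity says that `y ↦ ∇R y + c y` sends the new pivot to measurable data. This map is
strictly monotone, hence injective, and an injective measurable map on a standard Borel space is a
measurable embedding. -/
theorem measurable_prox (hR : IsSelfConcordantBarrier X ν R) (hc : 0 < c) (hx : Measurable x)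
    (hv : Measurable v) (hmem : ∀ ω, x ω ∈ interior X) (hmem' : ∀ ω, x' ω ∈ interior X)
    (hmin : ∀ ω, IsMinOn (proxObjective R (x ω) (v ω) η c) (interior X) (x' ω)) :
    Measurable x' := by
  have hgc := continuousOn_gradient isOpen_interior hR.contDiffOn
  have : StandardBorelSpace (interior X) := isOpen_interior.measurableSet.standardBorel
  have hemb : MeasurableEmbedding fun y : interior X =>
      gradient R (y : EuclideanSpace ℝ (Fin m)) + c • (y : EuclideanSpace ℝ (Fin m)) := by
    refine Measurable.measurableEmbedding ?_ ?_
    · exact (hgc.measurable_comp measurable_subtype_coe fun y => y.2).add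
        (measurable_subtype_coe.const_smul c)
    · intro y w h
      by_contra hne
      have hne' : (y : EuclideanSpace ℝ (Fin m)) - w ≠ 0 :=
        sub_ne_zero.2 fun h => hne (Subtype.ext h)
      have h1 := inner_gradient_sub_nonneg isOpen_interior hR.contDiffOn hR.convexOn w.2 y.2
      have h2 : gradient R (y : EuclideanSpace ℝ (Fin m)) - gradient R w =
          -(c • ((y : EuclideanSpace ℝ (Fin m)) - w)) := by
        rw [smul_sub, neg_sub, sub_eq_sub_iff_add_eq_add]
        simpa [add_comm] using h
      rw [h2, inner_neg_left, inner_smul_left, real_inner_self_eq_norm_sq] at h1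
      have h3 := norm_pos_iff.2 hne'
      have : 0 < c * ‖(y : EuclideanSpace ℝ (Fin m)) - w‖ ^ 2 := by positivity
      simp only [conj_trivial] at h1
      linarith
  have h3 := hemb.measurable_comp_iff (mα := inferInstance) (f := fun ω => (⟨x' ω, hmem' ω⟩ : interior X))
  refine measurable_subtype_coe.comp (h3.1 ?_)
  have h4 : Measurable fun ω => gradient R (x ω) + c • x ω + η • v ω :=
    ((hgc.measurable_comp hx hmem).add (hx.const_smul c)).add (hv.const_smul η)
  convert h4 using 2 with ω
  exact prox_gradient_eq hR (hmem' ω) (hmin ω)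

end Measurability

end BanditGame

namespace BanditGame

/-! ### Feasibility of runs and their dependence on the past. -/

section Algorithm

variable {Ω : Type*} {N : ℕ} {d : Fin N → ℕ} {X : ∀ i, Set (EuclideanSpace ℝ (Fin (d i)))}
  {u : Fin N → Profile d → ℝ} {R : ∀ i, EuclideanSpace ℝ (Fin (d i)) → ℝ} {ν lam : Fin N → ℝ}
  {β L σ : ℝ}
  {z : ℕ → ∀ i, Ω → Metric.sphere (0 : EuclideanSpace ℝ (Fin (d i))) 1}
  {ξ : ℕ → Fin N → Ω → ℝ} {x : ℕ → Ω → Profile d}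
  {A : ℕ → Ω → ∀ i, EuclideanSpace ℝ (Fin (d i)) →L[ℝ] EuclideanSpace ℝ (Fin (d i))}
  {xhat : ℕ → Ω → Profile d}

/-- A smooth concave game with self-concordant barriers and nondegenerate parameters. -/
structure IsBanditSetting (X : ∀ i, Set (EuclideanSpace ℝ (Fin (d i))))
    (u : Fin N → Profile d → ℝ) (R : ∀ i, EuclideanSpace ℝ (Fin (d i)) → ℝ) (ν lam : Fin N → ℝ)
    (β L σ : ℝ) : Prop where
  game : IsSmoothConcaveGame X u
  interior_nonempty : ∀ i, (interior (X i)).Nonempty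
  barrier : ∀ i, IsSelfConcordantBarrier (X i) (ν i) (R i)
  lam_pos : ∀ i, 0 < lam i
  beta_pos : 0 < β
  payoff_le : ∀ i, ∀ x ∈ univ.pi X, |u i x| ≤ L
  sigma_nonneg : 0 ≤ σ
  size_pos : 0 < L + σ
  dim_pos : 0 < ∑ i, d i

/-- The weight of the quadratic term in the prox-mapping of player `i` at round `t`. -/
noncomputable abbrev proxWeight (d : Fin N → ℕ) (lam : Fin N → ℝ) (β L σ : ℝ) (t : ℕ) (i : Fin N) :
    ℝ :=
  stepSize d L σ t * β * (t + 1) / lam i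

/-- The gradient estimator of player `i` at round `t`. -/
noncomputable def estimator (u : Fin N → Profile d → ℝ)
    (z : ℕ → ∀ i, Ω → Metric.sphere (0 : EuclideanSpace ℝ (Fin (d i))) 1)
    (ξ : ℕ → Fin N → Ω → ℝ)
    (A : ℕ → Ω → ∀ i, EuclideanSpace ℝ (Fin (d i)) →L[ℝ] EuclideanSpace ℝ (Fin (d i)))
    (xhat : ℕ → Ω → Profile d) (t : ℕ) (i : Fin N) (ω : Ω) : EuclideanSpace ℝ (Fin (d i)) :=
  ((d i : ℝ) * (u i (xhat t ω) + ξ t i ω)) • (A t ω i).inverse (z t i ω)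

/-- The runs of the algorithm on a sample space. -/
def IsRunOn (X : ∀ i, Set (EuclideanSpace ℝ (Fin (d i)))) (u : Fin N → Profile d → ℝ)
    (R : ∀ i, EuclideanSpace ℝ (Fin (d i)) → ℝ) (lam : Fin N → ℝ) (β L σ : ℝ)
    (z : ℕ → ∀ i, Ω → Metric.sphere (0 : EuclideanSpace ℝ (Fin (d i))) 1)
    (ξ : ℕ → Fin N → Ω → ℝ) (x : ℕ → Ω → Profile d)
    (A : ℕ → Ω → ∀ i, EuclideanSpace ℝ (Fin (d i)) →L[ℝ] EuclideanSpace ℝ (Fin (d i)))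
    (xhat : ℕ → Ω → Profile d) : Prop :=
  ∀ ω, IsRun X u R lam β (stepSize d L σ) (fun t i => z t i ω) (fun t i => ξ t i ω)
    (fun t => x t ω) (fun t => A t ω) (fun t => xhat t ω)

theorem IsBanditSetting.stepSize_pos (S : IsBanditSetting X u R ν lam β L σ) {t : ℕ} (ht : 1 ≤ t) :
    0 < stepSize d L σ t := by
  have h1 : (0 : ℝ) < ((∑ i, d i : ℕ) : ℝ) := by exact_mod_cast S.dim_pos
  have h2 : 0 < √(t : ℝ) := Real.sqrt_pos.2 (by exact_mod_cast ht)
  have h3 := S.size_pos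
  unfold stepSize
  positivity

theorem IsBanditSetting.proxWeight_pos (S : IsBanditSetting X u R ν lam β L σ) {t : ℕ}
    (ht : 1 ≤ t) (i : Fin N) : 0 < proxWeight d lam β L σ t i := by
  have h1 := S.stepSize_pos ht
  have h2 := S.beta_pos
  have h3 := S.lam_pos i
  unfold proxWeight
  positivity

namespace IsRunOn

theorem mem_interior (h : IsRunOn X u R lam β L σ z ξ x A xhat) {t : ℕ} (ht : 1 ≤ t) (ω : Ω)
    (i : Fin N) : x t ω i ∈ interior (X i) := by
  obtain _ | _ | t := t
  · omega
  · exact ((h ω).init i).1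
  · exact ((h ω).update (t + 1) (by omega) i).1

theorem mem_pi (h : IsRunOn X u R lam β L σ z ξ x A xhat) {t : ℕ} (ht : 1 ≤ t) (ω : Ω) :
    x t ω ∈ univ.pi X := fun i _ => interior_subset (h.mem_interior ht ω i)

theorem isInvSqrt (h : IsRunOn X u R lam β L σ z ξ x A xhat) {t : ℕ} (ht : 1 ≤ t) (ω : Ω)
    (i : Fin N) : IsInvSqrt (A t ω i) (hessian (R i) (x t ω i) +
      proxWeight d lam β L σ t i • ContinuousLinearMap.id ℝ _) :=
  (h ω).scaling t ht i

theorem xhat_eq (h : IsRunOn X u R lam β L σ z ξ x A xhat) {t : ℕ} (ht : 1 ≤ t) (ω : Ω) :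
    xhat t ω = playedAction (x t ω) (A t ω) fun i => z t i ω :=
  funext fun i => (h ω).play t ht i

theorem isMinOn (h : IsRunOn X u R lam β L σ z ξ x A xhat) {t : ℕ} (ht : 1 ≤ t) (ω : Ω)
    (i : Fin N) : IsMinOn (proxObjective (R i) (x t ω i) (estimator u z ξ A xhat t i ω)
      (stepSize d L σ t) (proxWeight d lam β L σ t i)) (interior (X i)) (x (t + 1) ω i) :=
  ((h ω).update t ht i).2

theorem add_apply_mem (h : IsRunOn X u R lam β L σ z ξ x A xhat)
    (S : IsBanditSetting X u R ν lam β L σ) {t : ℕ} (ht : 1 ≤ t) (ω : Ω) (i : Fin N)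
    {y : EuclideanSpace ℝ (Fin (d i))} (hy : ‖y‖ ≤ 1) : x t ω i + A t ω i y ∈ X i :=
  interior_subset (add_apply_mem_interior (S.barrier i) (h.mem_interior ht ω i)
    (S.proxWeight_pos ht i) (h.isInvSqrt ht ω i) hy)

theorem playedAction_mem (h : IsRunOn X u R lam β L σ z ξ x A xhat)
    (S : IsBanditSetting X u R ν lam β L σ) {t : ℕ} (ht : 1 ≤ t) (ω : Ω)
    (Z : ∀ i, Metric.sphere (0 : EuclideanSpace ℝ (Fin (d i))) 1) :
    playedAction (x t ω) (A t ω) Z ∈ univ.pi X := fun i _ =>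
  h.add_apply_mem S ht ω i (norm_eq_of_mem_sphere (Z i)).le

theorem xhat_mem (h : IsRunOn X u R lam β L σ z ξ x A xhat)
    (S : IsBanditSetting X u R ν lam β L σ) {t : ℕ} (ht : 1 ≤ t) (ω : Ω) :
    xhat t ω ∈ univ.pi X := by
  rw [h.xhat_eq ht]
  exact h.playedAction_mem S ht ω _

section Measurable

variable [MeasurableSpace Ω]

theorem measurable_clm_apply {m : ℕ}
    {B : Ω → EuclideanSpace ℝ (Fin m) →L[ℝ] EuclideanSpace ℝ (Fin m)}
    {y : Ω → EuclideanSpace ℝ (Fin m)} (hB : Measurable B) (hy : Measurable y) :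
    Measurable fun ω => B ω (y ω) :=
  (by fun_prop : Continuous fun p : (EuclideanSpace ℝ (Fin m) →L[ℝ] EuclideanSpace ℝ (Fin m)) ×
    EuclideanSpace ℝ (Fin m) => p.1 p.2).measurable.comp (hB.prodMk hy)

theorem measurable_A (h : IsRunOn X u R lam β L σ z ξ x A xhat)
    (S : IsBanditSetting X u R ν lam β L σ) {t : ℕ} (ht : 1 ≤ t) (i : Fin N)
    (hx : Measurable fun ω => x t ω i) : Measurable fun ω => A t ω i :=
  measurable_scaling (S.barrier i) hx (fun ω => h.mem_interior ht ω i)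
    fun ω => h.isInvSqrt ht ω i

theorem measurable_inverse_apply (h : IsRunOn X u R lam β L σ z ξ x A xhat)
    (S : IsBanditSetting X u R ν lam β L σ) {t : ℕ} (ht : 1 ≤ t) (i : Fin N)
    (hx : Measurable fun ω => x t ω i) {y : Ω → EuclideanSpace ℝ (Fin (d i))}
    (hy : Measurable y) : Measurable fun ω => (A t ω i).inverse (y ω) := by
  have h1 : ∀ ω, (A t ω i).inverse (y ω) =
      hessian (R i) (x t ω i) (A t ω i (y ω)) + proxWeight d lam β L σ t i • A t ω i (y ω) := by
    intro ω
    rw [(h.isInvSqrt ht ω i).inverse_eq]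
    rfl
  simp_rw [h1]
  have h2 := measurable_clm_apply (h.measurable_A S ht i hx) hy
  have h3 : Measurable fun ω => proxWeight d lam β L σ t i • A t ω i (y ω) :=
    h2.const_smul (proxWeight d lam β L σ t i)
  exact (measurable_clm_apply (measurable_hessian (S.barrier i) hx
    fun ω => h.mem_interior ht ω i) h2).add h3

theorem measurable_xhat (h : IsRunOn X u R lam β L σ z ξ x A xhat)
    (S : IsBanditSetting X u R ν lam β L σ) {t : ℕ} (ht : 1 ≤ t)
    (hx : ∀ i, Measurable fun ω => x t ω i) (hz : ∀ i, Measurable (z t i)) :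
    Measurable (xhat t) := by
  refine measurable_pi_iff.2 fun i => ?_
  have : (fun ω => xhat t ω i) = fun ω => x t ω i + A t ω i (z t i ω) :=
    funext fun ω => (h ω).play t ht i
  rw [this]
  exact (hx i).add (measurable_clm_apply (h.measurable_A S ht i (hx i))
    (measurable_subtype_coe.comp (hz i)))

theorem measurable_payoff (h : IsRunOn X u R lam β L σ z ξ x A xhat)
    (S : IsBanditSetting X u R ν lam β L σ) {t : ℕ} (ht : 1 ≤ t)
    (hx : ∀ i, Measurable fun ω => x t ω i) (hz : ∀ i, Measurable (z t i)) (i : Fin N) :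
    Measurable fun ω => u i (xhat t ω) :=
  (S.game.continuousOn i).measurable_comp (h.measurable_xhat S ht hx hz) (h.xhat_mem S ht)

theorem measurable_estimator (h : IsRunOn X u R lam β L σ z ξ x A xhat)
    (S : IsBanditSetting X u R ν lam β L σ) {t : ℕ} (ht : 1 ≤ t)
    (hx : ∀ i, Measurable fun ω => x t ω i) (hz : ∀ i, Measurable (z t i))
    (hξ : ∀ i, Measurable (ξ t i)) (i : Fin N) :
    Measurable (estimator u z ξ A xhat t i) :=
  (((h.measurable_payoff S ht hx hz i).add (hξ i)).const_mul (d i : ℝ)).smul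
    (h.measurable_inverse_apply S ht i (hx i) (measurable_subtype_coe.comp (hz i)))

theorem measurable_succ (h : IsRunOn X u R lam β L σ z ξ x A xhat)
    (S : IsBanditSetting X u R ν lam β L σ) {t : ℕ} (ht : 1 ≤ t)
    (hx : ∀ i, Measurable fun ω => x t ω i) (hz : ∀ i, Measurable (z t i))
    (hξ : ∀ i, Measurable (ξ t i)) (i : Fin N) : Measurable fun ω => x (t + 1) ω i :=
  measurable_prox (S.barrier i) (S.proxWeight_pos ht i) (hx i)
    (h.measurable_estimator S ht hx hz hξ i) (fun ω => h.mem_interior ht ω i)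
    (fun ω => h.mem_interior (by omega) ω i) (fun ω => h.isMinOn ht ω i)

end Measurable

theorem measurable_drawSigma (t : ℕ) (i : Fin N) : Measurable[drawSigma z t] (z t i) :=
  (comap_measurable (z t i)).mono (le_iSup (fun i => MeasurableSpace.comap (z t i) inferInstance) i)
    le_rfl

theorem drawSigma_le_pastSigma {s t : ℕ} (hs : 1 ≤ s) (hst : s < t) :
    drawSigma z s ≤ pastSigma z ξ t :=
  le_trans le_sup_left (le_iSup₂_of_le s ⟨hs, hst⟩ le_rfl)

theorem measurable_noise_pastSigma {s t : ℕ} (hs : 1 ≤ s) (hst : s < t) (i : Fin N) :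
    Measurable[pastSigma z ξ t] (ξ s i) :=
  (comap_measurable (ξ s i)).mono ((le_iSup (fun i => MeasurableSpace.comap (ξ s i) inferInstance)
    i).trans (le_trans le_sup_right (le_iSup₂_of_le (f := fun s _ => drawSigma z s ⊔
      ⨆ i, MeasurableSpace.comap (ξ s i) inferInstance) s ⟨hs, hst⟩ le_rfl))) le_rfl

theorem pastSigma_mono {s t : ℕ} (hst : s ≤ t) : pastSigma z ξ s ≤ pastSigma z ξ t :=
  biSup_mono fun _ hr => ⟨hr.1, hr.2.trans_le hst⟩

/-- The pivots are functions of the past. -/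
theorem measurable_pivot (h : IsRunOn X u R lam β L σ z ξ x A xhat)
    (S : IsBanditSetting X u R ν lam β L σ) {t : ℕ} (ht : 1 ≤ t) :
    ∀ i, Measurable[pastSigma z ξ t] fun ω => x t ω i := by
  induction t, ht using Nat.le_induction with
  | base =>
    intro i
    refine @measurable_const' _ _ _ (_) _ fun ω ω' => ?_
    have h1 := (h ω).init i
    have h2 := (h ω').init i
    exact (S.barrier i).eq_of_isMinOn (S.game.convex i) (S.game.isCompact i).isBounded
      h1.1 h2.1 h1.2 h2.2
  | succ t ht ih =>
    -- The measurability lemmas hold for any σ-algebra on `Ω`; here it is the past of round `t + 1`,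
    -- which contains the directions and noise of round `t`.
    exact @measurable_succ _ _ _ _ _ _ _ _ _ _ _ _ _ _ _ _ (pastSigma z ξ (t + 1)) h S t ht
      (fun i => (ih i).mono (pastSigma_mono (by omega)) le_rfl)
      (fun i => (measurable_drawSigma t i).mono
        (drawSigma_le_pastSigma ht (Nat.lt_succ_self t)) le_rfl)
      (fun i => measurable_noise_pastSigma ht (Nat.lt_succ_self t) i)

end IsRunOn

end Algorithm

end BanditGame

/-! ### Freezing the past, almost sure bounds and integrability. -/

namespace BanditGame

/-- Fubini for the product law of an independent pair: bounding the average over `Z` with `Y` frozen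
suffices, so no conditional expectation is involved. -/
theorem integral_le_of_indepFun {Ω Ω' S : Type*} [MeasurableSpace Ω] {μ : Measure Ω}
    [IsProbabilityMeasure μ] [MeasurableSpace Ω'] [MeasurableSpace S] {Y : Ω → Ω'} {Z : Ω → S}
    (hY : Measurable Y) (hZ : Measurable Z) (hind : IndepFun Y Z μ) {f : Ω' × S → ℝ}
    (hf : Measurable f) (hint : Integrable (fun ω => f (Y ω, Z ω)) μ) {G : Ω → ℝ}
    (hG : Integrable G μ) (hle : ∀ ω, ∫ s, f (Y ω, s) ∂(μ.map Z) ≤ G ω) :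
    ∫ ω, f (Y ω, Z ω) ∂μ ≤ ∫ ω, G ω ∂μ := by
  have hmap := (indepFun_iff_map_prod_eq_prod_map_map hY.aemeasurable hZ.aemeasurable).1 hind
  have := Measure.isProbabilityMeasure_map (μ := μ) hZ.aemeasurable
  have := Measure.isProbabilityMeasure_map (μ := μ) hY.aemeasurable
  have hYZ : Measurable fun ω => (Y ω, Z ω) := hY.prodMk hZ
  have hint2 : Integrable f ((μ.map Y).prod (μ.map Z)) := by
    rw [← hmap]
    exact (integrable_map_measure hf.aestronglyMeasurable hYZ.aemeasurable).2 hint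
  have hin := hint2.integral_prod_left
  have h1 : ∫ ω, f (Y ω, Z ω) ∂μ = ∫ ω, ∫ s, f (Y ω, s) ∂(μ.map Z) ∂μ := by
    rw [← integral_map hY.aemeasurable (f := fun y => ∫ s, f (y, s) ∂(μ.map Z))
      hin.aestronglyMeasurable, ← integral_prod _ hint2, ← hmap,
      integral_map hYZ.aemeasurable hf.aestronglyMeasurable]
  rw [h1]
  exact integral_mono ((integrable_map_measure hin.aestronglyMeasurable hY.aemeasurable).1 hin)
    hG hle

section Algorithm

variable {Ω : Type*} {N : ℕ} {d : Fin N → ℕ} {X : ∀ i, Set (EuclideanSpace ℝ (Fin (d i)))}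
  {u : Fin N → Profile d → ℝ} {R : ∀ i, EuclideanSpace ℝ (Fin (d i)) → ℝ} {ν lam : Fin N → ℝ}
  {β L σ : ℝ}
  {z : ℕ → ∀ i, Ω → Metric.sphere (0 : EuclideanSpace ℝ (Fin (d i))) 1}
  {ξ : ℕ → Fin N → Ω → ℝ} {x : ℕ → Ω → Profile d}
  {A : ℕ → Ω → ∀ i, EuclideanSpace ℝ (Fin (d i)) →L[ℝ] EuclideanSpace ℝ (Fin (d i))}
  {xhat : ℕ → Ω → Profile d}

/-- The algorithm driven by uniform directions and by bounded martingale-difference noise. -/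
structure IsBanditProcess (X : ∀ i, Set (EuclideanSpace ℝ (Fin (d i))))
    (u : Fin N → Profile d → ℝ) (R : ∀ i, EuclideanSpace ℝ (Fin (d i)) → ℝ) (lam : Fin N → ℝ)
    (β L σ : ℝ) [MeasurableSpace Ω] (μ : Measure Ω)
    (z : ℕ → ∀ i, Ω → Metric.sphere (0 : EuclideanSpace ℝ (Fin (d i))) 1)
    (ξ : ℕ → Fin N → Ω → ℝ) (x : ℕ → Ω → Profile d)
    (A : ℕ → Ω → ∀ i, EuclideanSpace ℝ (Fin (d i)) →L[ℝ] EuclideanSpace ℝ (Fin (d i)))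
    (xhat : ℕ → Ω → Profile d) : Prop where
  sampling : IsSphereSampling μ z ξ
  noise : IsBoundedNoise μ σ z ξ
  run : IsRunOn X u R lam β L σ z ξ x A xhat

theorem IsSelfConcordantBarrier.exists_bound_of_le {m : ℕ} {X : Set (EuclideanSpace ℝ (Fin m))}
    {ν : ℝ} {R : EuclideanSpace ℝ (Fin m) → ℝ} (hR : IsSelfConcordantBarrier X ν R)
    (hX : IsCompact X) (B : ℝ) :
    ∃ G, 0 ≤ G ∧ ∀ y ∈ interior X, R y ≤ B →
      |R y| ≤ G ∧ ‖gradient R y‖ ≤ G ∧ ‖hessian R y‖ ≤ G := by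
  have hK := hR.isCompact_sublevel hX B
  have hsub : {y | y ∈ interior X ∧ R y ≤ B} ⊆ interior X := fun y hy => hy.1
  obtain ⟨G1, h1⟩ := hK.exists_bound_of_continuousOn (hR.contDiffOn.continuousOn.mono hsub)
  obtain ⟨G2, h2⟩ := hK.exists_bound_of_continuousOn
    ((continuousOn_gradient isOpen_interior hR.contDiffOn).mono hsub)
  obtain ⟨G3, h3⟩ := hK.exists_bound_of_continuousOn
    ((continuousOn_hessian isOpen_interior hR.contDiffOn).mono hsub)
  refine ⟨max 0 (max G1 (max G2 G3)), le_max_left _ _, fun y hy hB => ⟨?_, ?_, ?_⟩⟩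
  · exact (h1 y ⟨hy, hB⟩).trans (by simp)
  · exact (h2 y ⟨hy, hB⟩).trans (by simp)
  · exact (h3 y ⟨hy, hB⟩).trans (by simp)

theorem IsBanditSetting.exists_diameter (S : IsBanditSetting X u R ν lam β L σ) :
    ∃ D, 0 ≤ D ∧ ∀ i, ∀ y ∈ X i, ∀ w ∈ X i, ‖y - w‖ ≤ D := by
  have h : ∀ i, ∃ D, 0 ≤ D ∧ ∀ y ∈ X i, ∀ w ∈ X i, ‖y - w‖ ≤ D := by
    intro i
    obtain ⟨D, hD⟩ := (S.game.isCompact i).isBounded.exists_norm_le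
    obtain ⟨y0, hy0⟩ := S.interior_nonempty i
    have hD0 : 0 ≤ D := (norm_nonneg _).trans (hD _ (interior_subset hy0))
    exact ⟨D + D, by linarith, fun y hy w hw =>
      (norm_sub_le y w).trans (add_le_add (hD y hy) (hD w hw))⟩
  choose D hD0 hD using h
  exact ⟨∑ i, D i, Finset.sum_nonneg fun i _ => hD0 i, fun i y hy w hw =>
    (hD i y hy w hw).trans (Finset.single_le_sum (fun i _ => hD0 i) (Finset.mem_univ i))⟩

namespace IsBanditProcess

variable [MeasurableSpace Ω] {μ : Measure Ω}

theorem pastSigma_le (P : IsBanditProcess X u R lam β L σ μ z ξ x A xhat) (t : ℕ) :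
    pastSigma z ξ t ≤ ‹MeasurableSpace Ω› := by
  refine iSup₂_le fun s hs => sup_le (iSup_le fun i => ?_) (iSup_le fun i => ?_)
  · exact (P.sampling.measurable s hs.1 i).comap_le
  · exact (P.noise.measurable s hs.1 i).comap_le

theorem drawSigma_le (P : IsBanditProcess X u R lam β L σ μ z ξ x A xhat) {t : ℕ} (ht : 1 ≤ t) :
    drawSigma z t ≤ ‹MeasurableSpace Ω› :=
  iSup_le fun i => (P.sampling.measurable t ht i).comap_le

theorem measurable_x (P : IsBanditProcess X u R lam β L σ μ z ξ x A xhat)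
    (S : IsBanditSetting X u R ν lam β L σ) {t : ℕ} (ht : 1 ≤ t) (i : Fin N) :
    Measurable fun ω => x t ω i :=
  (P.run.measurable_pivot S ht i).mono (P.pastSigma_le t) le_rfl

theorem isProbabilityMeasure_sphereUniform [IsProbabilityMeasure μ]
    (P : IsBanditProcess X u R lam β L σ μ z ξ x A xhat)
    (i : Fin N) : IsProbabilityMeasure (sphereUniform (d i)) := by
  rw [← P.sampling.law 1 le_rfl i]
  exact Measure.isProbabilityMeasure_map (P.sampling.measurable 1 le_rfl i).aemeasurable

theorem ae_abs_payoff_le (P : IsBanditProcess X u R lam β L σ μ z ξ x A xhat)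
    (S : IsBanditSetting X u R ν lam β L σ) {t : ℕ} (ht : 1 ≤ t) (i : Fin N) :
    ∀ᵐ ω ∂μ, |u i (xhat t ω) + ξ t i ω| ≤ L + σ := by
  filter_upwards [P.noise.bounded t ht i] with ω hω
  exact (abs_add_le _ _).trans (add_le_add (S.payoff_le i _ (P.run.xhat_mem S ht ω)) hω)

theorem norm_inverse_le (P : IsBanditProcess X u R lam β L σ μ z ξ x A xhat)
    (S : IsBanditSetting X u R ν lam β L σ) {t : ℕ} (ht : 1 ≤ t) (i : Fin N) {ω : Ω} {G : ℝ}
    (hG : ‖hessian (R i) (x t ω i)‖ ≤ G) (y : EuclideanSpace ℝ (Fin (d i))) :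
    ‖(A t ω i).inverse y‖ ≤ √(G + proxWeight d lam β L σ t i) * ‖y‖ := by
  have h := inner_hessian_add_eq (P.run.isInvSqrt ht ω i) y
  have hc := S.proxWeight_pos ht i
  have hG0 : 0 ≤ G := (norm_nonneg _).trans hG
  have h1 : ⟪y, hessian (R i) (x t ω i) y⟫_ℝ ≤ G * ‖y‖ ^ 2 := by
    refine (real_inner_le_norm _ _).trans ?_
    have h2 := (hessian (R i) (x t ω i)).le_of_opNorm_le hG y
    nlinarith [norm_nonneg y]
  refine le_of_sq_le_sq ?_ (by positivity)
  rw [mul_pow, Real.sq_sqrt (by positivity)]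
  nlinarith

/-- Each pivot stays in a deterministic compact subset of the interior. -/
theorem exists_ae_barrier_le (P : IsBanditProcess X u R lam β L σ μ z ξ x A xhat)
    (S : IsBanditSetting X u R ν lam β L σ) {t : ℕ} (ht : 1 ≤ t) (i : Fin N) :
    ∃ B, ∀ᵐ ω ∂μ, R i (x t ω i) ≤ B := by
  induction t, ht using Nat.le_induction with
  | base =>
    obtain ⟨y, hy⟩ := S.interior_nonempty i
    exact ⟨R i y, ae_of_all _ fun ω => ((P.run ω).init i).2 hy⟩
  | succ t ht ih =>
    obtain ⟨B, hB⟩ := ih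
    obtain ⟨G, hG0, hG⟩ := (S.barrier i).exists_bound_of_le (S.game.isCompact i) B
    obtain ⟨D, hD0, hD⟩ := S.exists_diameter
    have hη := S.stepSize_pos ht
    have hs := S.size_pos
    refine ⟨G + G * D + stepSize d L σ t *
      (d i * (L + σ) * (√(G + proxWeight d lam β L σ t i) * 1) * D), ?_⟩
    filter_upwards [hB, P.ae_abs_payoff_le S ht i] with ω hω hpay
    have hx := P.run.mem_interior ht ω i
    have hx' := P.run.mem_interior (t := t + 1) (by omega) ω i
    obtain ⟨h1, h2, h3⟩ := hG _ hx hω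
    -- On the previous sublevel set gradient and Hessian are bounded, hence so is the estimator, and
    -- one step raises the barrier by a deterministic amount. The resulting bound may depend on `t`.
    have h4 := prox_value_le (S.proxWeight_pos ht i).le hx (P.run.isMinOn ht ω i)
    have h5 : ‖x (t + 1) ω i - x t ω i‖ ≤ D :=
      hD i _ (interior_subset hx') _ (interior_subset hx)
    have h6 : ‖estimator u z ξ A xhat t i ω‖ ≤
        d i * (L + σ) * (√(G + proxWeight d lam β L σ t i) * 1) := by
      unfold estimator
      rw [norm_smul, norm_mul, Real.norm_eq_abs, Real.norm_eq_abs, Nat.abs_cast]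
      have h7 := P.norm_inverse_le S ht i h3 (z t i ω)
      rw [norm_eq_of_mem_sphere] at h7
      gcongr
    have h7 : ⟪gradient (R i) (x t ω i), x (t + 1) ω i - x t ω i⟫_ℝ ≤ G * D :=
      (real_inner_le_norm _ _).trans (by gcongr)
    have h8 : ⟪estimator u z ξ A xhat t i ω, x (t + 1) ω i - x t ω i⟫_ℝ ≤
        d i * (L + σ) * (√(G + proxWeight d lam β L σ t i) * 1) * D :=
      (real_inner_le_norm _ _).trans (by gcongr)
    have h9 := mul_le_mul_of_nonneg_left h8 hη.le
    have h10 := le_abs_self (R i (x t ω i))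
    linarith

theorem exists_ae_bound (P : IsBanditProcess X u R lam β L σ μ z ξ x A xhat)
    (S : IsBanditSetting X u R ν lam β L σ) {t : ℕ} (ht : 1 ≤ t) (i : Fin N) :
    ∃ G, 0 ≤ G ∧ ∀ᵐ ω ∂μ, |R i (x t ω i)| ≤ G ∧ ‖gradient (R i) (x t ω i)‖ ≤ G ∧
      ∀ y, ‖(A t ω i).inverse y‖ ≤ G * ‖y‖ := by
  obtain ⟨B, hB⟩ := P.exists_ae_barrier_le S ht i
  obtain ⟨G, hG0, hG⟩ := (S.barrier i).exists_bound_of_le (S.game.isCompact i) B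
  refine ⟨max G (√(G + proxWeight d lam β L σ t i)), le_max_of_le_left hG0, ?_⟩
  filter_upwards [hB] with ω hω
  obtain ⟨h1, h2, h3⟩ := hG _ (P.run.mem_interior ht ω i) hω
  refine ⟨le_max_of_le_left h1, le_max_of_le_left h2, fun y => ?_⟩
  exact (P.norm_inverse_le S ht i h3 y).trans (by gcongr; exact le_max_right _ _)

variable [IsProbabilityMeasure μ]

theorem integrable_bregman (P : IsBanditProcess X u R lam β L σ μ z ξ x A xhat)
    (S : IsBanditSetting X u R ν lam β L σ) {t : ℕ} (ht : 1 ≤ t) (i : Fin N)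
    {p : EuclideanSpace ℝ (Fin (d i))} (hp : p ∈ X i) :
    Integrable (fun ω => bregman (R i) p (x t ω i)) μ := by
  obtain ⟨G, hG0, hG⟩ := P.exists_ae_bound S ht i
  obtain ⟨D, hD0, hD⟩ := S.exists_diameter
  have hx := P.measurable_x S ht i
  have hxi := fun ω => P.run.mem_interior ht ω i
  refine Integrable.of_bound (C := |R i p| + G + G * D) ?_ ?_
  · have h1 : Measurable fun ω => R i (x t ω i) :=
      (S.barrier i).contDiffOn.continuousOn.measurable_comp hx hxi
    have h2 : Measurable fun ω => gradient (R i) (x t ω i) :=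
      (continuousOn_gradient isOpen_interior (S.barrier i).contDiffOn).measurable_comp hx hxi
    exact ((h1.const_sub (R i p)).sub (h2.inner (hx.const_sub p))).aestronglyMeasurable
  · filter_upwards [hG] with ω ⟨h1, h2, _⟩
    unfold bregman
    have h3 : |⟪gradient (R i) (x t ω i), p - x t ω i⟫_ℝ| ≤ G * D :=
      (abs_real_inner_le_norm _ _).trans (by
        gcongr
        exact hD i _ hp _ (interior_subset (hxi ω)))
    refine (norm_sub_le _ _).trans (add_le_add ((norm_sub_le _ _).trans ?_) h3)
    exact add_le_add le_rfl h1

theorem integrable_norm_sub_pow (P : IsBanditProcess X u R lam β L σ μ z ξ x A xhat)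
    (S : IsBanditSetting X u R ν lam β L σ) {t : ℕ} (ht : 1 ≤ t) (i : Fin N)
    {p : EuclideanSpace ℝ (Fin (d i))} (hp : p ∈ X i) (k : ℕ) :
    Integrable (fun ω => ‖x t ω i - p‖ ^ k) μ := by
  obtain ⟨D, hD0, hD⟩ := S.exists_diameter
  refine Integrable.of_bound (C := D ^ k) ?_ (ae_of_all _ fun ω => ?_)
  · exact (((P.measurable_x S ht i).sub_const p).norm.pow_const k).aestronglyMeasurable
  · rw [norm_pow, norm_norm]
    exact pow_le_pow_left₀ (norm_nonneg _)
      (hD i _ (interior_subset (P.run.mem_interior ht ω i)) _ hp) k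

theorem integrable_inner_payoffGrad (P : IsBanditProcess X u R lam β L σ μ z ξ x A xhat)
    (S : IsBanditSetting X u R ν lam β L σ) {t : ℕ} (ht : 1 ≤ t) (i : Fin N)
    {p : EuclideanSpace ℝ (Fin (d i))} (hp : p ∈ X i) :
    Integrable (fun ω => ⟪payoffGrad X u i (x t ω), x t ω i - p⟫_ℝ) μ := by
  obtain ⟨D, hD0, hD⟩ := S.exists_diameter
  obtain ⟨K, hK⟩ := S.game.lipschitz i
  obtain ⟨G, hG⟩ := (isCompact_univ_pi S.game.isCompact).exists_bound_of_continuousOn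
    hK.continuousOn
  have hx : Measurable (x t) := measurable_pi_iff.2 (P.measurable_x S ht)
  refine Integrable.of_bound (C := G * D) ?_ (ae_of_all _ fun ω => ?_)
  · exact ((hK.continuousOn.measurable_comp hx (P.run.mem_pi ht)).inner
      ((P.measurable_x S ht i).sub_const p)).aestronglyMeasurable
  · have h1 := hG _ (P.run.mem_pi ht ω)
    have h2 := hD i _ (interior_subset (P.run.mem_interior ht ω i)) _ hp
    exact (norm_inner_le_norm _ _).trans
      (mul_le_mul h1 h2 (norm_nonneg _) ((norm_nonneg _).trans h1))

end IsBanditProcess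

end Algorithm

end BanditGame

namespace BanditGame

/-! ### Expectation of the estimator along the run. -/

section Estimator

variable {Ω : Type*} {N : ℕ} {d : Fin N → ℕ} {X : ∀ i, Set (EuclideanSpace ℝ (Fin (d i)))}
  {u : Fin N → Profile d → ℝ} {R : ∀ i, EuclideanSpace ℝ (Fin (d i)) → ℝ} {ν lam : Fin N → ℝ}
  {β L σ : ℝ}
  {z : ℕ → ∀ i, Ω → Metric.sphere (0 : EuclideanSpace ℝ (Fin (d i))) 1}
  {ξ : ℕ → Fin N → Ω → ℝ} {x : ℕ → Ω → Profile d}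
  {A : ℕ → Ω → ∀ i, EuclideanSpace ℝ (Fin (d i)) →L[ℝ] EuclideanSpace ℝ (Fin (d i))}
  {xhat : ℕ → Ω → Profile d}

theorem inner_estimator (h : IsRunOn X u R lam β L σ z ξ x A xhat) {t : ℕ} (ht : 1 ≤ t) (i : Fin N)
    (ω : Ω) (q : EuclideanSpace ℝ (Fin (d i))) :
    ⟪estimator u z ξ A xhat t i ω, q⟫_ℝ =
      d i * ((u i (xhat t ω) + ξ t i ω) *
        ⟪(z t i ω : EuclideanSpace ℝ (Fin (d i))), (A t ω i).inverse q⟫_ℝ) := by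
  unfold estimator
  rw [inner_smul_left, (h.isInvSqrt ht ω i).inner_inverse_left]
  simp [mul_assoc]

theorem norm_apply_estimator (h : IsRunOn X u R lam β L σ z ξ x A xhat) {t : ℕ} (ht : 1 ≤ t)
    (i : Fin N) (ω : Ω) :
    ‖A t ω i (estimator u z ξ A xhat t i ω)‖ = d i * |u i (xhat t ω) + ξ t i ω| := by
  unfold estimator
  rw [map_smul, (h.isInvSqrt ht ω i).apply_inverse, norm_smul, norm_eq_of_mem_sphere]
  simp

theorem measurable_payoff_mul_inner [MeasurableSpace Ω]
    (h : IsRunOn X u R lam β L σ z ξ x A xhat)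
    (S : IsBanditSetting X u R ν lam β L σ) {t : ℕ} (ht : 1 ≤ t)
    (hx : ∀ i, Measurable fun ω => x t ω i) (i : Fin N) (p : EuclideanSpace ℝ (Fin (d i))) :
    Measurable fun w : Ω × (∀ i, Metric.sphere (0 : EuclideanSpace ℝ (Fin (d i))) 1) =>
      u i (playedAction (x t w.1) (A t w.1) w.2) *
        ⟪(w.2 i : EuclideanSpace ℝ (Fin (d i))), (A t w.1 i).inverse (x t w.1 i - p)⟫_ℝ := by
  have h1 : Measurable fun w : Ω × (∀ i, Metric.sphere (0 : EuclideanSpace ℝ (Fin (d i))) 1) =>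
      playedAction (x t w.1) (A t w.1) w.2 := by
    refine measurable_pi_iff.2 fun j => ?_
    exact ((hx j).comp measurable_fst).add (IsRunOn.measurable_clm_apply
      ((h.measurable_A S ht j (hx j)).comp measurable_fst)
      (measurable_subtype_coe.comp ((measurable_pi_apply j).comp measurable_snd)))
  refine ((S.game.continuousOn i).measurable_comp h1 fun w =>
    h.playedAction_mem S ht w.1 w.2).mul ?_
  exact (measurable_subtype_coe.comp ((measurable_pi_apply i).comp measurable_snd)).inner
    ((h.measurable_inverse_apply S ht i (hx i) ((hx i).sub_const p)).comp measurable_fst)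

namespace IsBanditProcess

variable [MeasurableSpace Ω] {μ : Measure Ω}

theorem exists_ae_inner_le (P : IsBanditProcess X u R lam β L σ μ z ξ x A xhat)
    (S : IsBanditSetting X u R ν lam β L σ) {t : ℕ} (ht : 1 ≤ t) (i : Fin N)
    {p : EuclideanSpace ℝ (Fin (d i))} (hp : p ∈ X i) :
    ∃ G, ∀ᵐ ω ∂μ,
      |⟪(z t i ω : EuclideanSpace ℝ (Fin (d i))), (A t ω i).inverse (x t ω i - p)⟫_ℝ| ≤ G := by
  obtain ⟨G, hG0, hG⟩ := P.exists_ae_bound S ht i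
  obtain ⟨D, hD0, hD⟩ := S.exists_diameter
  refine ⟨1 * (G * D), ?_⟩
  filter_upwards [hG] with ω hω
  refine (abs_real_inner_le_norm _ _).trans ?_
  rw [norm_eq_of_mem_sphere]
  gcongr
  exact (hω.2.2 _).trans (by
    gcongr
    exact hD i _ (interior_subset (P.run.mem_interior ht ω i)) _ hp)

variable [IsProbabilityMeasure μ]

theorem map_directions (P : IsBanditProcess X u R lam β L σ μ z ξ x A xhat) {t : ℕ} (ht : 1 ≤ t) :
    μ.map (fun ω i => z t i ω) = Measure.pi fun i => sphereUniform (d i) := by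
  rw [(iIndepFun_iff_map_fun_eq_pi_map fun i =>
    (P.sampling.measurable t ht i).aemeasurable).1 (P.sampling.indep_players t ht)]
  congr 1
  ext1 i
  exact P.sampling.law t ht i

theorem integral_noise_mul_eq_zero (P : IsBanditProcess X u R lam β L σ μ z ξ x A xhat)
    (S : IsBanditSetting X u R ν lam β L σ) {t : ℕ} (ht : 1 ≤ t) (i : Fin N)
    {p : EuclideanSpace ℝ (Fin (d i))} (hp : p ∈ X i) :
    Integrable (fun ω => ξ t i ω *
      ⟪(z t i ω : EuclideanSpace ℝ (Fin (d i))), (A t ω i).inverse (x t ω i - p)⟫_ℝ) μ ∧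
    ∫ ω, ξ t i ω *
      ⟪(z t i ω : EuclideanSpace ℝ (Fin (d i))), (A t ω i).inverse (x t ω i - p)⟫_ℝ ∂μ = 0 := by
  set g := fun ω =>
    ⟪(z t i ω : EuclideanSpace ℝ (Fin (d i))), (A t ω i).inverse (x t ω i - p)⟫_ℝ with hg
  have hle : historySigma z ξ t ≤ ‹MeasurableSpace Ω› :=
    sup_le (P.pastSigma_le t) (P.drawSigma_le ht)
  have hxH : Measurable[historySigma z ξ t] fun ω => x t ω i :=
    (P.run.measurable_pivot S ht i).mono le_sup_left le_rfl
  have hzH : Measurable[historySigma z ξ t] (z t i) :=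
    (IsRunOn.measurable_drawSigma t i).mono le_sup_right le_rfl
  -- The history includes the directions of round `t`, so `g` can be pulled out of the conditional
  -- expectation of the noise.
  have hgH : Measurable[historySigma z ξ t] g :=
    (measurable_subtype_coe.comp hzH).inner
      (@IsRunOn.measurable_inverse_apply _ _ _ _ _ _ _ _ _ _ _ _ _ _ _ _
        (historySigma z ξ t) P.run S t ht i hxH _ (hxH.sub_const p))
  obtain ⟨G, hG⟩ := P.exists_ae_inner_le S ht i hp
  have hξi : Integrable (ξ t i) μ :=
    Integrable.of_bound (P.noise.measurable t ht i).aestronglyMeasurable σ (P.noise.bounded t ht i)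
  have hint : Integrable (fun ω => ξ t i ω * g ω) μ :=
    hξi.mul_bdd (c := G) (hgH.mono hle le_rfl).aestronglyMeasurable hG
  refine ⟨hint, ?_⟩
  rw [← integral_condExp hle]
  have h1 := condExp_mul_of_stronglyMeasurable_right (m := historySigma z ξ t) (μ := μ)
    (f := ξ t i) (g := g) hgH.stronglyMeasurable hint hξi
  have h2 : μ[fun ω => ξ t i ω * g ω | historySigma z ξ t] =ᵐ[μ] 0 := by
    filter_upwards [h1, P.noise.zero_mean t ht i] with ω h3 h4
    have h5 : (μ[fun ω => ξ t i ω * g ω | historySigma z ξ t]) ω =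
      (μ[ξ t i * g | historySigma z ξ t]) ω := rfl
    rw [h5, h3, Pi.mul_apply, h4]
    simp
  rw [integral_congr_ae h2]
  simp

/-- The expected inner product of the estimator with `x i - p`. -/
theorem integral_inner_estimator_le (P : IsBanditProcess X u R lam β L σ μ z ξ x A xhat)
    (S : IsBanditSetting X u R ν lam β L σ) {t : ℕ} (ht : 1 ≤ t) (i : Fin N)
    {p : EuclideanSpace ℝ (Fin (d i))} (hp : p ∈ X i) {K : NNReal}
    (hK : LipschitzOnWith K (payoffGrad X u i) (univ.pi X)) {α : ℝ} (hα : 0 ≤ α)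
    (hAα : ∀ j, 1 ≤ proxWeight d lam β L σ t j * α ^ 2) :
    Integrable (fun ω => ⟪estimator u z ξ A xhat t i ω, x t ω i - p⟫_ℝ) μ ∧
    ∫ ω, ⟪estimator u z ξ A xhat t i ω, x t ω i - p⟫_ℝ ∂μ ≤
      ∫ ω, (⟪payoffGrad X u i (x t ω), x t ω i - p⟫_ℝ + K * α * ‖x t ω i - p‖) ∂μ := by
  have hprob := P.isProbabilityMeasure_sphereUniform
  obtain ⟨hn1, hn2⟩ := P.integral_noise_mul_eq_zero S ht i hp
  set g := fun ω =>
    ⟪(z t i ω : EuclideanSpace ℝ (Fin (d i))), (A t ω i).inverse (x t ω i - p)⟫_ℝ with hg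
  obtain ⟨G, hG⟩ := P.exists_ae_inner_le S ht i hp
  have hZ : Measurable fun ω i => z t i ω := measurable_pi_iff.2 (P.sampling.measurable t ht)
  have hxm := P.measurable_x S ht
  have hgm : Measurable g := (measurable_subtype_coe.comp (P.sampling.measurable t ht i)).inner
    (P.run.measurable_inverse_apply S ht i (hxm i) ((hxm i).sub_const p))
  have hum := P.run.measurable_payoff S ht hxm (P.sampling.measurable t ht) i
  have hui : Integrable (fun ω => u i (xhat t ω) * g ω) μ :=
    (Integrable.of_bound hum.aestronglyMeasurable L (ae_of_all _ fun ω =>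
      S.payoff_le i _ (P.run.xhat_mem S ht ω))).mul_bdd (c := G) hgm.aestronglyMeasurable hG
  have heq : ∀ ω, ⟪estimator u z ξ A xhat t i ω, x t ω i - p⟫_ℝ =
      d i * (u i (xhat t ω) * g ω) + d i * (ξ t i ω * g ω) := fun ω => by
    rw [inner_estimator P.run ht]
    ring
  simp_rw [heq]
  refine ⟨(hui.const_mul _).add (hn1.const_mul _), ?_⟩
  rw [integral_add (hui.const_mul _) (hn1.const_mul _), integral_const_mul (d i : ℝ)
    (fun ω => ξ t i ω * g ω), hn2, mul_zero, add_zero]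
  -- The past is encoded as the identity map into `Ω` with the smaller σ-algebra; frozen pivots and
  -- scalings are then simply functions of this variable.
  have hind : @IndepFun _ _ _ _ (pastSigma z ξ t) _ (id : Ω → Ω) (fun ω i => z t i ω) μ := by
    refine (@IndepFun_iff_Indep Ω Ω _ _ (pastSigma z ξ t) _ id _ μ).2 ?_
    rw [MeasurableSpace.comap_id]
    refine indep_of_indep_of_le_right (P.sampling.indep_past t ht).symm ?_
    refine Measurable.comap_le ?_
    exact @measurable_pi_iff _ _ _ (drawSigma z t) _ _ |>.2
      fun i => IsRunOn.measurable_drawSigma t i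
  have hGint : Integrable (fun ω => ⟪payoffGrad X u i (x t ω), x t ω i - p⟫_ℝ +
      K * α * ‖x t ω i - p‖) μ := by
    have := (P.integrable_norm_sub_pow S ht i hp 1).const_mul (K * α)
    simp only [pow_one] at this
    exact (P.integrable_inner_payoffGrad S ht i hp).add this
  have hxeq : ∀ ω, u i (xhat t ω) = u i (playedAction (x t ω) (A t ω) fun i => z t i ω) :=
    fun ω => by rw [P.run.xhat_eq ht]
  have hmeas := @measurable_payoff_mul_inner _ _ _ _ _ _ _ _ _ _ _ _ _ _ _ _ (pastSigma z ξ t)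
    P.run S t ht (P.run.measurable_pivot S ht) i p
  simp_rw [hxeq] at hui ⊢
  refine @integral_le_of_indepFun Ω Ω _ _ μ _ (pastSigma z ξ t) _ id (fun ω i => z t i ω)
    (measurable_id'' (P.pastSigma_le t)) hZ hind
    (fun w => d i * (u i (playedAction (x t w.1) (A t w.1) w.2) *
        ⟪(w.2 i : EuclideanSpace ℝ (Fin (d i))), (A t w.1 i).inverse (x t w.1 i - p)⟫_ℝ))
    (hmeas.const_mul _) (hui.const_mul _) _ hGint fun ω => ?_
  rw [P.map_directions ht, integral_const_mul]
  have hmain := S.game.abs_integral_estimator_sub_le i hK (P.run.mem_pi ht ω) hα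
    (fun j y hy => P.run.add_apply_mem S ht ω j hy)
    (fun j y hy => by
      have h1 := mul_norm_sq_le (S.barrier j) (P.run.mem_interior ht ω j)
        (P.run.isInvSqrt ht ω j) y
      have h2 := S.proxWeight_pos ht j
      have h3 : ‖y‖ ^ 2 ≤ 1 := pow_le_one₀ (norm_nonneg _) hy
      refine le_of_sq_le_sq ?_ hα
      exact le_of_mul_le_mul_left ((h1.trans h3).trans (hAα j)) h2)
    ((A t ω i).inverse (x t ω i - p)) (x t ω i - p)
    ((P.run.isInvSqrt ht ω i).apply_inverse _)
  have := (abs_le.1 hmain).2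
  simp only [id]
  linarith

end IsBanditProcess

end Estimator

end BanditGame

namespace BanditGame

/-! ### Drift towards the equilibrium and the comparison point. -/

section Drift

variable {N : ℕ} {d : Fin N → ℕ} {X : ∀ i, Set (EuclideanSpace ℝ (Fin (d i)))}
  {u : Fin N → Profile d → ℝ} {R : ∀ i, EuclideanSpace ℝ (Fin (d i)) → ℝ} {ν lam : Fin N → ℝ}
  {β L σ : ℝ} {xstar : Profile d}

/-- First-order optimality on a convex set: the segment towards `y` gives an admissible tangent
direction at a maximiser. -/
theorem IsNash.inner_payoffGrad_nonpos (hnash : IsNash X u xstar) (hgame : IsSmoothConcaveGame X u)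
    (i : Fin N) {y : EuclideanSpace ℝ (Fin (d i))} (hy : y ∈ X i) :
    ⟪payoffGrad X u i xstar, y - xstar i⟫_ℝ ≤ 0 := by
  have hmem : xstar i ∈ X i := hnash.1 i trivial
  have hmax : IsMaxOn (fun y => u i (Function.update xstar i y)) (X i) (xstar i) := by
    intro w hw
    simpa using hnash.2 i w hw
  have h1 := hgame.hasFDerivWithinAt i hnash.1 hmem
  have h2 := hmax.localize.hasFDerivWithinAt_nonpos h1 (y := y - xstar i)
    (mem_posTangentConeAt_of_segment_subset (by
      rw [add_sub_cancel]
      exact (hgame.convex i).segment_subset hmem hy))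
  simpa using h2

theorem IsBanditSetting.exists_lipschitz (S : IsBanditSetting X u R ν lam β L σ) :
    ∃ K : NNReal, ∀ i, LipschitzOnWith K (payoffGrad X u i) (univ.pi X) := by
  choose K hK using S.game.lipschitz
  exact ⟨∑ i, K i, fun i => (hK i).weaken
    (Finset.single_le_sum (fun i _ => zero_le (a := K i)) (Finset.mem_univ i))⟩

/-- Strong monotonicity makes the pseudo-gradient point towards every point `p` close to the
equilibrium; the bias of the estimator is absorbed in half of the quadratic term. -/
theorem sum_inner_payoffGrad_add_le (S : IsBanditSetting X u R ν lam β L σ)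
    (hmono : IsStronglyMonotone X u lam β) (hnash : IsNash X u xstar) {K : NNReal}
    (hK : ∀ i, LipschitzOnWith K (payoffGrad X u i) (univ.pi X)) {D : ℝ}
    (hD : ∀ i, ∀ y ∈ X i, ∀ w ∈ X i, ‖y - w‖ ≤ D) {x p : Profile d} (hx : x ∈ univ.pi X)
    (hp : p ∈ univ.pi X) {δ α : ℝ} (hδ : 0 ≤ δ) (hpδ : ∀ i, ‖p i - xstar i‖ ≤ δ) :
    ∑ i, lam i * (⟪payoffGrad X u i x, x i - p i⟫_ℝ + K * α * ‖x i - p i‖) ≤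
      -(β / 2) * ∑ i, ‖x i - p i‖ ^ 2 +
        ((∑ i, lam i * (K * D + ‖payoffGrad X u i xstar‖)) * δ +
          (∑ i, lam i ^ 2) * K ^ 2 / (2 * β) * α ^ 2) := by
  have hβ := S.beta_pos
  have h1 := hmono p hp x hx
  have h2 : ∀ i, ⟪payoffGrad X u i p, x i - p i⟫_ℝ ≤
      (K * D + ‖payoffGrad X u i xstar‖) * δ := by
    intro i
    have hsplit : ⟪payoffGrad X u i p, x i - p i⟫_ℝ =
        ⟪payoffGrad X u i p - payoffGrad X u i xstar, x i - p i⟫_ℝ +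
          ⟪payoffGrad X u i xstar, x i - xstar i⟫_ℝ +
          ⟪payoffGrad X u i xstar, xstar i - p i⟫_ℝ := by
      simp only [inner_sub_left, inner_sub_right]
      ring
    have h3 := hnash.inner_payoffGrad_nonpos S.game i (hx i trivial)
    have h4 : ⟪payoffGrad X u i p - payoffGrad X u i xstar, x i - p i⟫_ℝ ≤ K * δ * D := by
      refine (real_inner_le_norm _ _).trans ?_
      refine mul_le_mul ?_ (hD i _ (hx i trivial) _ (hp i trivial)) (norm_nonneg _) (by positivity)
      refine ((hK i).norm_sub_le hp hnash.1).trans ?_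
      gcongr
      exact (pi_norm_le_iff_of_nonneg hδ).2 hpδ
    have h5 : ⟪payoffGrad X u i xstar, xstar i - p i⟫_ℝ ≤ ‖payoffGrad X u i xstar‖ * δ := by
      refine (real_inner_le_norm _ _).trans ?_
      rw [norm_sub_rev]
      gcongr
      exact hpδ i
    rw [hsplit]
    linarith
  have h3 : ∀ i, lam i * (⟪payoffGrad X u i x, x i - p i⟫_ℝ + K * α * ‖x i - p i‖) ≤
      lam i * ⟪x i - p i, payoffGrad X u i x - payoffGrad X u i p⟫_ℝ +
        (lam i * (K * D + ‖payoffGrad X u i xstar‖) * δ +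
          lam i ^ 2 * K ^ 2 / (2 * β) * α ^ 2 + β / 2 * ‖x i - p i‖ ^ 2) := by
    intro i
    have hl := S.lam_pos i
    have h4 := mul_le_mul_of_nonneg_left (h2 i) hl.le
    have h5 : ⟪x i - p i, payoffGrad X u i x - payoffGrad X u i p⟫_ℝ =
        ⟪payoffGrad X u i x, x i - p i⟫_ℝ - ⟪payoffGrad X u i p, x i - p i⟫_ℝ := by
      rw [real_inner_comm, inner_sub_left]
    have h6 : lam i * (K * α * ‖x i - p i‖) ≤
        lam i ^ 2 * K ^ 2 / (2 * β) * α ^ 2 + β / 2 * ‖x i - p i‖ ^ 2 := by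
      -- Young's inequality as a completed square, spending half of the monotonicity constant on the
      -- bias.
      have h7 : lam i ^ 2 * K ^ 2 / (2 * β) * α ^ 2 + β / 2 * ‖x i - p i‖ ^ 2 -
          lam i * (K * α * ‖x i - p i‖) =
          (lam i * K * α - β * ‖x i - p i‖) ^ 2 / (2 * β) := by
        field_simp
        ring
      have h8 : 0 ≤ (lam i * K * α - β * ‖x i - p i‖) ^ 2 / (2 * β) := by positivity
      linarith
    rw [h5]
    linarith
  have h4 := Finset.sum_le_sum fun i (_ : i ∈ Finset.univ) => h3 i
  refine h4.trans ?_
  simp only [Finset.sum_add_distrib, ← Finset.sum_mul, ← Finset.mul_sum, ← Finset.sum_div] at h1 ⊢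
  linarith

/-- The comparison point in the interior, at relative distance `1 / T` from the equilibrium. -/
theorem exists_comparison_point (S : IsBanditSetting X u R ν lam β L σ)
    (hmem : xstar ∈ univ.pi X) {D : ℝ} (hD0 : 0 ≤ D)
    (hD : ∀ i, ∀ y ∈ X i, ∀ w ∈ X i, ‖y - w‖ ≤ D) :
    ∃ B : ℝ, 0 ≤ B ∧ ∀ T : ℝ, 1 ≤ T → ∃ p : Profile d, (∀ i, p i ∈ interior (X i)) ∧
      (∀ i, ‖p i - xstar i‖ ≤ D / T) ∧
      ∀ i, ∀ y ∈ interior (X i), R i (p i) - R i y ≤ B + ν i * Real.log T := by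
  choose x0 hx0 using S.interior_nonempty
  refine ⟨∑ i, ‖gradient (R i) (x0 i)‖ * D, by positivity, fun T hT =>
    ⟨fun i => x0 i + (1 - 1 / T) • (xstar i - x0 i), fun i => ?_, fun i => ?_, fun i y hy => ?_⟩⟩
  · have hT0 : 0 < T := by linarith
    have h1 : 1 / T ≤ 1 := (div_le_one hT0).2 hT
    have := (S.game.convex i).combo_interior_self_mem_interior (hx0 i) (hmem i trivial)
      (a := 1 / T) (b := 1 - 1 / T) (by positivity) (by linarith) (by ring)
    convert this using 1
    module
  · have h1 : x0 i + (1 - 1 / T) • (xstar i - x0 i) - xstar i = (1 / T) • (x0 i - xstar i) := by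
      module
    have hT0 : 0 < T := by linarith
    rw [h1, norm_smul, Real.norm_eq_abs, abs_of_pos (by positivity), one_div, inv_mul_eq_div]
    gcongr
    exact hD i _ (interior_subset (hx0 i)) _ (hmem i trivial)
  · have h1 := (S.barrier i).sub_le_mul_log (S.game.convex i) (hx0 i) (hmem i trivial) hT
    -- The tangent plane at the fixed centre bounds `R i` from below uniformly in `y`, so `B` does
    -- not depend on `T`.
    have h2 := inner_gradient_le_sub isOpen_interior (S.barrier i).contDiffOn
      (S.barrier i).convexOn (hx0 i) hy
    have h3 : -(‖gradient (R i) (x0 i)‖ * D) ≤ ⟪gradient (R i) (x0 i), y - x0 i⟫_ℝ := by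
      refine (abs_le.1 ((abs_real_inner_le_norm _ _).trans ?_)).1
      gcongr
      exact hD i _ (interior_subset hy) _ (interior_subset (hx0 i))
    have h4 : ‖gradient (R i) (x0 i)‖ * D ≤ ∑ i, ‖gradient (R i) (x0 i)‖ * D :=
      Finset.single_le_sum (f := fun i => ‖gradient (R i) (x0 i)‖ * D)
        (fun i _ => by positivity) (Finset.mem_univ i)
    linarith

end Drift

end BanditGame

namespace BanditGame

/-! ### Recursion for the expected potential. -/

section Rate

variable {Ω : Type*} {N : ℕ} {d : Fin N → ℕ} {X : ∀ i, Set (EuclideanSpace ℝ (Fin (d i)))}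
  {u : Fin N → Profile d → ℝ} {R : ∀ i, EuclideanSpace ℝ (Fin (d i)) → ℝ} {ν lam : Fin N → ℝ}
  {β L σ : ℝ}
  {z : ℕ → ∀ i, Ω → Metric.sphere (0 : EuclideanSpace ℝ (Fin (d i))) 1}
  {ξ : ℕ → Fin N → Ω → ℝ} {x : ℕ → Ω → Profile d}
  {A : ℕ → Ω → ∀ i, EuclideanSpace ℝ (Fin (d i)) →L[ℝ] EuclideanSpace ℝ (Fin (d i))}
  {xhat : ℕ → Ω → Profile d} {xstar : Profile d}

/-- The potential of a joint action `y` with respect to the comparison point `p`. -/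
noncomputable def potential (R : ∀ i, EuclideanSpace ℝ (Fin (d i)) → ℝ) (lam : Fin N → ℝ)
    (p : Profile d) (b : ℝ) (y : Profile d) : ℝ :=
  ∑ i, (lam i * bregman (R i) (p i) (y i) + b * ‖y i - p i‖ ^ 2)

theorem potential_add (p : Profile d) (b b' : ℝ) (y : Profile d) :
    potential R lam p (b + b') y = potential R lam p b y + b' * ∑ i, ‖y i - p i‖ ^ 2 := by
  unfold potential
  rw [Finset.mul_sum, ← Finset.sum_add_distrib]
  exact Finset.sum_congr rfl fun i _ => by ring

theorem potential_mono (p : Profile d) {b b' : ℝ} (hb : b ≤ b') (y : Profile d) :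
    potential R lam p b y ≤ potential R lam p b' y := by
  unfold potential
  gcongr

theorem IsBanditSetting.mul_le_potential (S : IsBanditSetting X u R ν lam β L σ) {p y : Profile d}
    (hp : ∀ i, p i ∈ interior (X i)) (hy : ∀ i, y i ∈ interior (X i)) (b : ℝ) :
    b * ∑ i, ‖y i - p i‖ ^ 2 ≤ potential R lam p b y := by
  have h := potential_add (R := R) (lam := lam) p 0 b y
  rw [zero_add] at h
  rw [h]
  have h2 : 0 ≤ potential R lam p 0 y := Finset.sum_nonneg fun i _ => by
    have h3 := bregman_nonneg isOpen_interior (S.barrier i).contDiffOn (S.barrier i).convexOn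
      (hy i) (hp i)
    have h4 := S.lam_pos i
    rw [zero_mul, add_zero]
    positivity
  linarith

theorem IsBanditSetting.stepSize_mul_le (S : IsBanditSetting X u R ν lam β L σ) {t : ℕ}
    (ht : 1 ≤ t) (i : Fin N) :
    stepSize d L σ t * (d i * (L + σ)) ≤ 1 / (2 * √(t : ℝ)) := by
  have h1 : (0 : ℝ) < ((∑ i, d i : ℕ) : ℝ) := by exact_mod_cast S.dim_pos
  have h2 : 0 < √(t : ℝ) := Real.sqrt_pos.2 (by exact_mod_cast ht)
  have h3 := S.size_pos
  have h4 : (d i : ℝ) ≤ ((∑ i, d i : ℕ) : ℝ) := by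
    exact_mod_cast Finset.single_le_sum (f := d) (fun i _ => Nat.zero_le _) (Finset.mem_univ i)
  unfold stepSize
  rw [div_mul_eq_mul_div, one_mul, div_le_div_iff₀ (by positivity) (by positivity)]
  have h5 := mul_le_mul_of_nonneg_right h4 (show 0 ≤ (L + σ) * (2 * √(t : ℝ)) by positivity)
  linarith

namespace IsBanditProcess

variable [MeasurableSpace Ω] {μ : Measure Ω}

theorem ae_potential_succ_le (P : IsBanditProcess X u R lam β L σ μ z ξ x A xhat)
    (S : IsBanditSetting X u R ν lam β L σ) (p : Profile d) {t : ℕ} (ht : 1 ≤ t) :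
    ∀ᵐ ω ∂μ, potential R lam p (stepSize d L σ t * β * (t + 1) / 2) (x (t + 1) ω) ≤
      potential R lam p (stepSize d L σ t * β * (t + 1) / 2) (x t ω) +
        stepSize d L σ t * ∑ i, lam i * ⟪estimator u z ξ A xhat t i ω, x t ω i - p i⟫_ℝ +
        (∑ i, lam i) / (2 * t) := by
  have hpay : ∀ᵐ ω ∂μ, ∀ i, |u i (xhat t ω) + ξ t i ω| ≤ L + σ :=
    ae_all_iff.2 fun i => P.ae_abs_payoff_le S ht i
  filter_upwards [hpay] with ω hω
  have hη := S.stepSize_pos ht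
  have ht1 : (1 : ℝ) ≤ t := by exact_mod_cast ht
  have hst : 1 ≤ √(t : ℝ) := Real.one_le_sqrt.2 ht1
  unfold potential
  rw [Finset.mul_sum, Finset.sum_div, ← Finset.sum_add_distrib, ← Finset.sum_add_distrib]
  refine Finset.sum_le_sum fun i _ => ?_
  have hl := S.lam_pos i
  have ha : stepSize d L σ t * ‖A t ω i (estimator u z ξ A xhat t i ω)‖ ≤ 1 / (2 * √(t : ℝ)) := by
    rw [norm_apply_estimator P.run ht]
    refine le_trans ?_ (S.stepSize_mul_le ht i)
    gcongr
    exact hω i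
  have ha2 : 1 / (2 * √(t : ℝ)) ≤ 1 / 2 := by
    apply one_div_le_one_div_of_le <;> linarith
  have hstep := prox_step (S.barrier i) (S.game.convex i) (P.run.mem_interior ht ω i)
    (P.run.mem_interior (by omega) ω i) (S.proxWeight_pos ht i) hη.le (P.run.isInvSqrt ht ω i)
    (ha.trans ha2) (P.run.isMinOn ht ω i) (p i)
  have hsq := pow_le_pow_left₀ (by positivity) ha 2
  have h1 : (1 / (2 * √(t : ℝ))) ^ 2 = 1 / (4 * t) := by
    rw [div_pow, mul_pow, Real.sq_sqrt (by linarith)]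
    norm_num
  rw [h1] at hsq
  have h2 := mul_le_mul_of_nonneg_left hstep hl.le
  -- The factor `1 / lam i` in the prox weight cancels, leaving one quadratic coefficient for all
  -- players, as the unweighted monotonicity bound requires.
  have h3 : lam i * (proxWeight d lam β L σ t i / 2) = stepSize d L σ t * β * (t + 1) / 2 := by
    unfold proxWeight
    field_simp
  have h4 : lam i * (2 * (1 / (4 * (t : ℝ)))) = lam i / (2 * t) := by
    field_simp
    norm_num
  have h5 := mul_le_mul_of_nonneg_left (mul_le_mul_of_nonneg_left hsq zero_le_two) hl.le
  rw [h4] at h5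
  rw [← h3]
  linarith

variable [IsProbabilityMeasure μ]

theorem integrable_potential (P : IsBanditProcess X u R lam β L σ μ z ξ x A xhat)
    (S : IsBanditSetting X u R ν lam β L σ) {p : Profile d} (hp : p ∈ univ.pi X) (b : ℝ) {t : ℕ}
    (ht : 1 ≤ t) : Integrable (fun ω => potential R lam p b (x t ω)) μ :=
  integrable_finsetSum _ fun i _ => ((P.integrable_bregman S ht i (hp i trivial)).const_mul _).add
    ((P.integrable_norm_sub_pow S ht i (hp i trivial) 2).const_mul _)

/-- The expected potential increases by a summable error up to a logarithm. -/
theorem integral_potential_succ_le (P : IsBanditProcess X u R lam β L σ μ z ξ x A xhat)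
    (S : IsBanditSetting X u R ν lam β L σ) (hmono : IsStronglyMonotone X u lam β)
    (hnash : IsNash X u xstar) {K : NNReal}
    (hK : ∀ i, LipschitzOnWith K (payoffGrad X u i) (univ.pi X)) {D : ℝ}
    (hD : ∀ i, ∀ y ∈ X i, ∀ w ∈ X i, ‖y - w‖ ≤ D) {p : Profile d} (hp : p ∈ univ.pi X)
    {δ α : ℝ} (hδ : 0 ≤ δ) (hpδ : ∀ i, ‖p i - xstar i‖ ≤ δ) (hα : 0 ≤ α) {t : ℕ} (ht : 1 ≤ t)
    (hAα : ∀ j, 1 ≤ proxWeight d lam β L σ t j * α ^ 2) :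
    ∫ ω, potential R lam p (stepSize d L σ t * β * (t + 1) / 2) (x (t + 1) ω) ∂μ ≤
      ∫ ω, potential R lam p (stepSize d L σ t * β * t / 2) (x t ω) ∂μ +
        stepSize d L σ t * ((∑ i, lam i * (K * D + ‖payoffGrad X u i xstar‖)) * δ +
          (∑ i, lam i ^ 2) * K ^ 2 / (2 * β) * α ^ 2) + (∑ i, lam i) / (2 * t) := by
  set η := stepSize d L σ t with hη
  set C := (∑ i, lam i * (K * D + ‖payoffGrad X u i xstar‖)) * δ +
    (∑ i, lam i ^ 2) * K ^ 2 / (2 * β) * α ^ 2 with hC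
  have hη0 : 0 < η := S.stepSize_pos ht
  have hest := fun i => P.integral_inner_estimator_le S ht i (hp i trivial) (hK i) hα hAα
  have hE : Integrable (fun ω => ∑ i, lam i * ⟪estimator u z ξ A xhat t i ω, x t ω i - p i⟫_ℝ) μ :=
    integrable_finsetSum _ fun i _ => (hest i).1.const_mul _
  have hpot := fun b => P.integrable_potential S hp b ht
  have hG : ∀ i, Integrable (fun ω => ⟪payoffGrad X u i (x t ω), x t ω i - p i⟫_ℝ +
      K * α * ‖x t ω i - p i‖) μ := fun i => by
    have := (P.integrable_norm_sub_pow S ht i (hp i trivial) 1).const_mul (K * α)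
    simp only [pow_one] at this
    exact (P.integrable_inner_payoffGrad S ht i (hp i trivial)).add this
  have hpE : Integrable (fun ω => potential R lam p (η * β * (t + 1) / 2) (x t ω) +
      η * ∑ i, lam i * ⟪estimator u z ξ A xhat t i ω, x t ω i - p i⟫_ℝ) μ :=
    (hpot _).add (hE.const_mul η)
  have h1 := integral_mono_ae (P.integrable_potential S hp _ (by omega))
    (hpE.add (integrable_const ((∑ i, lam i) / (2 * t)))) (P.ae_potential_succ_le S p ht)
  simp only [Pi.add_apply] at h1
  rw [integral_add hpE (integrable_const _),
    integral_add (hpot _) (hE.const_mul η), integral_const_mul η,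
    integral_finsetSum _ fun i _ => (hest i).1.const_mul _] at h1
  have h2 : ∑ i, ∫ ω, lam i * ⟪estimator u z ξ A xhat t i ω, x t ω i - p i⟫_ℝ ∂μ ≤
      ∫ ω, ∑ i, lam i * (⟪payoffGrad X u i (x t ω), x t ω i - p i⟫_ℝ +
        K * α * ‖x t ω i - p i‖) ∂μ := by
    rw [integral_finsetSum _ fun i _ => (hG i).const_mul _]
    refine Finset.sum_le_sum fun i _ => ?_
    rw [integral_const_mul, integral_const_mul]
    exact mul_le_mul_of_nonneg_left (hest i).2 (S.lam_pos i).le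
  have hGs : Integrable (fun ω => ∑ i, lam i * (⟪payoffGrad X u i (x t ω), x t ω i - p i⟫_ℝ +
        K * α * ‖x t ω i - p i‖)) μ := integrable_finsetSum _ fun i _ => (hG i).const_mul _
  have h3 : ∫ ω, potential R lam p (η * β * (t + 1) / 2) (x t ω) ∂μ +
      η * ∫ ω, ∑ i, lam i * (⟪payoffGrad X u i (x t ω), x t ω i - p i⟫_ℝ +
        K * α * ‖x t ω i - p i‖) ∂μ ≤
      ∫ ω, potential R lam p (η * β * t / 2) (x t ω) ∂μ + η * C := by
    rw [← integral_const_mul, ← integral_add (hpot _) (hGs.const_mul η)]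
    have h4 : ∫ ω, potential R lam p (η * β * t / 2) (x t ω) ∂μ + η * C =
        ∫ ω, (potential R lam p (η * β * t / 2) (x t ω) + η * C) ∂μ := by
      rw [integral_add (hpot _) (integrable_const _)]
      simp
    rw [h4]
    refine integral_mono ((hpot _).add (hGs.const_mul η)) ((hpot _).add (integrable_const _))
      fun ω => ?_
    have h5 := sum_inner_payoffGrad_add_le S hmono hnash hK hD (P.run.mem_pi ht ω) hp (α := α)
      hδ hpδ
    have h6 := mul_le_mul_of_nonneg_left h5 hη0.le
    -- The remaining half of the monotonicity drift cancels precisely the increment from `t` to `t +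
    -- 1`.
    have h7 : η * β * (t + 1) / 2 = η * β * t / 2 + η * β / 2 := by ring
    rw [h7, potential_add]
    linarith
  have h4 := mul_le_mul_of_nonneg_left h2 hη0.le
  simp only [integral_const, probReal_univ, one_smul] at h1
  linarith

/-- The gradient vanishes at the initial pivot, so the divergence there is a plain difference of
barrier values. -/
theorem integral_potential_one_le (P : IsBanditProcess X u R lam β L σ μ z ξ x A xhat)
    (S : IsBanditSetting X u R ν lam β L σ) {D : ℝ}
    (hD : ∀ i, ∀ y ∈ X i, ∀ w ∈ X i, ‖y - w‖ ≤ D) {p : Profile d}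
    (hp : p ∈ univ.pi X) {H : Fin N → ℝ}
    (hH : ∀ i, ∀ y ∈ interior (X i), R i (p i) - R i y ≤ H i) {b : ℝ} (hb : 0 ≤ b) :
    ∫ ω, potential R lam p b (x 1 ω) ∂μ ≤ ∑ i, (lam i * H i + b * D ^ 2) := by
  have h := integral_mono (P.integrable_potential S hp b le_rfl)
    (integrable_const (∑ i, (lam i * H i + b * D ^ 2))) (fun ω => by
      refine Finset.sum_le_sum fun i _ => ?_
      have hl := S.lam_pos i
      have hx := P.run.mem_interior le_rfl ω i
      have h1 : bregman (R i) (p i) (x 1 ω i) ≤ H i := by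
        unfold bregman
        rw [IsSelfConcordantBarrier.gradient_eq_zero hx ((P.run ω).init i).2, inner_zero_left,
          sub_zero]
        exact hH i _ hx
      have h2 := hD i _ (interior_subset hx) _ (hp i trivial)
      gcongr)
  simpa using h

end IsBanditProcess

end Rate

end BanditGame

namespace BanditGame

/-! ### Summation and final constants. -/

section Main

variable {N : ℕ} {d : Fin N → ℕ} {X : ∀ i, Set (EuclideanSpace ℝ (Fin (d i)))}
  {u : Fin N → Profile d → ℝ} {R : ∀ i, EuclideanSpace ℝ (Fin (d i)) → ℝ} {ν lam : Fin N → ℝ}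
  {β L σ : ℝ} {xstar : Profile d}

theorem IsBanditSetting.exists_stepSize_eq (S : IsBanditSetting X u R ν lam β L σ) :
    ∃ κ : ℝ, 0 < κ ∧ ∀ t : ℕ, stepSize d L σ t = κ / √(t : ℝ) := by
  have h1 : (0 : ℝ) < ((∑ i, d i : ℕ) : ℝ) := by exact_mod_cast S.dim_pos
  have h3 := S.size_pos
  refine ⟨1 / (2 * ((∑ i, d i : ℕ) : ℝ) * (L + σ)), by positivity, fun t => ?_⟩
  unfold stepSize
  rw [div_div]

theorem IsBanditProcess.integrable_norm_xhat_sub_sq {Ω : Type*} [MeasurableSpace Ω]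
    {μ : Measure Ω} [IsProbabilityMeasure μ]
    {z : ℕ → ∀ i, Ω → Metric.sphere (0 : EuclideanSpace ℝ (Fin (d i))) 1}
    {ξ : ℕ → Fin N → Ω → ℝ} {x : ℕ → Ω → Profile d}
    {A : ℕ → Ω → ∀ i, EuclideanSpace ℝ (Fin (d i)) →L[ℝ] EuclideanSpace ℝ (Fin (d i))}
    {xhat : ℕ → Ω → Profile d} (P : IsBanditProcess X u R lam β L σ μ z ξ x A xhat)
    (S : IsBanditSetting X u R ν lam β L σ) {y : Profile d} (hy : y ∈ univ.pi X) {t : ℕ}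
    (ht : 1 ≤ t) : Integrable (fun ω => ∑ i, ‖xhat t ω i - y i‖ ^ 2) μ := by
  obtain ⟨D, hD0, hD⟩ := S.exists_diameter
  refine integrable_finsetSum _ fun i _ => Integrable.of_bound (C := D ^ 2) ?_
    (ae_of_all _ fun ω => ?_)
  · have h := P.run.measurable_xhat S ht (P.measurable_x S ht) (P.sampling.measurable t ht)
    exact ((((measurable_pi_apply i).comp h).sub_const (y i)).norm.pow_const 2).aestronglyMeasurable
  · rw [norm_pow, norm_norm]
    exact pow_le_pow_left₀ (norm_nonneg _)
      (hD i _ (P.run.xhat_mem S ht ω i trivial) _ (hy i trivial)) 2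

theorem IsBanditProcess.integral_norm_xhat_sub_sq_le {Ω : Type*} [MeasurableSpace Ω]
    {μ : Measure Ω} [IsProbabilityMeasure μ]
    {z : ℕ → ∀ i, Ω → Metric.sphere (0 : EuclideanSpace ℝ (Fin (d i))) 1}
    {ξ : ℕ → Fin N → Ω → ℝ} {x : ℕ → Ω → Profile d}
    {A : ℕ → Ω → ∀ i, EuclideanSpace ℝ (Fin (d i)) →L[ℝ] EuclideanSpace ℝ (Fin (d i))}
    {xhat : ℕ → Ω → Profile d} (P : IsBanditProcess X u R lam β L σ μ z ξ x A xhat)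
    (S : IsBanditSetting X u R ν lam β L σ) {y p : Profile d} (hy : y ∈ univ.pi X)
    (hp : p ∈ univ.pi X) {δ α : ℝ} (hpδ : ∀ i, ‖p i - y i‖ ≤ δ) {t : ℕ} (ht : 1 ≤ t)
    (hAα : ∀ j, 1 ≤ proxWeight d lam β L σ t j * α ^ 2) :
    ∫ ω, ∑ i, ‖xhat t ω i - y i‖ ^ 2 ∂μ ≤
      3 * (N * α ^ 2 + ∫ ω, ∑ i, ‖x t ω i - p i‖ ^ 2 ∂μ + N * δ ^ 2) := by
  have hEi : Integrable (fun ω => ∑ i, ‖x t ω i - p i‖ ^ 2) μ :=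
    integrable_finsetSum _ fun i _ => P.integrable_norm_sub_pow S ht i (hp i trivial) 2
  have h1 : 3 * (N * α ^ 2 + ∫ ω, ∑ i, ‖x t ω i - p i‖ ^ 2 ∂μ + N * δ ^ 2) =
      ∫ ω, (3 * (N * α ^ 2 + N * δ ^ 2) + 3 * ∑ i, ‖x t ω i - p i‖ ^ 2) ∂μ := by
    rw [integral_add (integrable_const _) (hEi.const_mul 3),
      integral_const_mul (3 : ℝ) (fun ω => ∑ i, ‖x t ω i - p i‖ ^ 2)]
    simp only [integral_const, probReal_univ, one_smul]
    ring
  rw [h1]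
  refine integral_mono (P.integrable_norm_xhat_sub_sq S hy ht)
    ((integrable_const _).add (hEi.const_mul 3)) fun ω => ?_
  have h2 : ∀ i, ‖xhat t ω i - y i‖ ^ 2 ≤ 3 * (α ^ 2 + δ ^ 2) + 3 * ‖x t ω i - p i‖ ^ 2 := by
    intro i
    have h3 : ‖A t ω i (z t i ω)‖ ^ 2 ≤ α ^ 2 := by
      have h4 := mul_norm_sq_le (S.barrier i) (P.run.mem_interior ht ω i)
        (P.run.isInvSqrt ht ω i) (z t i ω)
      rw [norm_eq_of_mem_sphere, one_pow] at h4
      exact le_of_mul_le_mul_left (h4.trans (hAα i)) (S.proxWeight_pos ht i)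
    have h4 : ‖p i - y i‖ ^ 2 ≤ δ ^ 2 := pow_le_pow_left₀ (norm_nonneg _) (hpδ i) 2
    have h5 : xhat t ω i - y i = A t ω i (z t i ω) + (x t ω i - p i) + (p i - y i) := by
      rw [(P.run ω).play t ht i]
      abel
    have h6 : ‖xhat t ω i - y i‖ ≤
        ‖A t ω i (z t i ω)‖ + ‖x t ω i - p i‖ + ‖p i - y i‖ := by
      rw [h5]
      exact norm_add₃_le
    have h7 := pow_le_pow_left₀ (norm_nonneg _) h6 2
    nlinarith [sq_nonneg (‖A t ω i (z t i ω)‖ - ‖x t ω i - p i‖),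
      sq_nonneg (‖A t ω i (z t i ω)‖ - ‖p i - y i‖),
      sq_nonneg (‖x t ω i - p i‖ - ‖p i - y i‖)]
  have h3 := Finset.sum_le_sum fun i (_ : i ∈ Finset.univ) => h2 i
  rw [Finset.sum_add_distrib] at h3
  simp only [Finset.sum_const, Finset.card_univ, Fintype.card_fin, nsmul_eq_mul,
    ← Finset.mul_sum] at h3
  refine h3.trans (le_of_eq ?_)
  ring

/-- The rate of convergence with a single logarithm. -/
theorem IsBanditSetting.exists_rate (S : IsBanditSetting X u R ν lam β L σ)
    (hmono : IsStronglyMonotone X u lam β) (hnash : IsNash X u xstar) :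
    ∃ C₀ C₁ : ℝ, 0 ≤ C₀ ∧
      ∀ (Ω : Type*) [MeasurableSpace Ω] (μ : Measure Ω) [IsProbabilityMeasure μ]
        (z : ℕ → ∀ i, Ω → Metric.sphere (0 : EuclideanSpace ℝ (Fin (d i))) 1)
        (ξ : ℕ → Fin N → Ω → ℝ) (x : ℕ → Ω → Profile d)
        (A : ℕ → Ω → ∀ i, EuclideanSpace ℝ (Fin (d i)) →L[ℝ] EuclideanSpace ℝ (Fin (d i)))
        (xhat : ℕ → Ω → Profile d), IsBanditProcess X u R lam β L σ μ z ξ x A xhat →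
        ∀ T : ℕ, 1 ≤ T →
          ∫ ω, ∑ i, ‖xhat T ω i - xstar i‖ ^ 2 ∂μ ≤ (C₀ + C₁ * Real.log T) / √(T : ℝ) := by
  obtain ⟨D, hD0, hD⟩ := S.exists_diameter
  obtain ⟨K, hK⟩ := S.exists_lipschitz
  obtain ⟨κ, hκ, hη⟩ := S.exists_stepSize_eq
  obtain ⟨B, hB0, hB⟩ := exists_comparison_point S hnash.1 hD0 hD
  have hβ := S.beta_pos
  have hlam := S.lam_pos
  have hlams : 0 ≤ ∑ i, lam i := Finset.sum_nonneg fun i _ => (hlam i).le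
  -- With `α² = Λ / √t`, the product of prox weight and `α²` is `(t + 1) ∑ lam / (t lam j) ≥ 1`, for
  -- all players at once.
  set Λ := (∑ i, lam i) / (κ * β) with hΛ
  have hΛ0 : 0 ≤ Λ := by positivity
  set C4 := ∑ i, lam i * (K * D + ‖payoffGrad X u i xstar‖) with hC4
  have hC40 : 0 ≤ C4 := Finset.sum_nonneg fun i _ => by have := hlam i; positivity
  set C5 := (∑ i, lam i ^ 2) * K ^ 2 / (2 * β) with hC5
  have hC50 : 0 ≤ C5 := by positivity
  -- Coefficient of `1/t` in the recursion: comparison-point error (using `η_t ≤ κ` and `D/T ≤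
  -- D/t`), bias (`η_t α² = κ Λ / t`) and estimator variance.
  set C6 := κ * (C4 * D + C5 * Λ) + (∑ i, lam i) / 2 with hC6
  have hC60 : 0 ≤ C6 := by positivity
  have hBs : 0 ≤ ∑ i, lam i * B := Finset.sum_nonneg fun i _ => by have := hlam i; positivity
  set Q := ∑ i, lam i * B
  refine ⟨3 * (N * Λ + N * D ^ 2 + 2 / (κ * β) *
      (Q + N * (κ * β / 2 * D ^ 2) + C6)),
    3 * (2 / (κ * β) * (∑ i, lam i * ν i + C6)), by positivity, ?_⟩
  intro Ω _ μ _ z ξ x A xhat P T hT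
  have hT1 : (1 : ℝ) ≤ T := by exact_mod_cast hT
  have hT0 : (0 : ℝ) < T := by linarith
  obtain ⟨p, hpi, hpδ, hpR⟩ := hB T hT1
  have hp : p ∈ univ.pi X := fun i _ => interior_subset (hpi i)
  have hAα : ∀ t : ℕ, 1 ≤ t → ∀ j,
      1 ≤ proxWeight d lam β L σ t j * √(Λ / √(t : ℝ)) ^ 2 := by
    intro t ht j
    have ht0 : (0 : ℝ) < t := by exact_mod_cast ht
    have hs : 0 < √(t : ℝ) := Real.sqrt_pos.2 ht0
    have hl := hlam j
    have hsum : lam j ≤ ∑ i, lam i :=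
      Finset.single_le_sum (fun i _ => (hlam i).le) (Finset.mem_univ j)
    rw [Real.sq_sqrt (by positivity)]
    have h1 : proxWeight d lam β L σ t j * (Λ / √(t : ℝ)) =
        (t + 1) * (∑ i, lam i) / (√(t : ℝ) ^ 2 * lam j) := by
      unfold proxWeight
      rw [hη, hΛ]
      field_simp
    rw [h1, Real.sq_sqrt ht0.le, one_le_div (by positivity)]
    nlinarith
  set V : ℕ → ℝ := fun t =>
    ∫ ω, potential R lam p (stepSize d L σ t * β * t / 2) (x t ω) ∂μ with hV
  have hstep : ∀ t : ℕ, 1 ≤ t → t + 1 ≤ T → V (t + 1) ≤ V t + C6 * (t : ℝ)⁻¹ := by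
    intro t ht htT
    have ht1 : (1 : ℝ) ≤ t := by exact_mod_cast ht
    have ht0 : (0 : ℝ) < t := by linarith
    have htT' : (t : ℝ) ≤ T := by exact_mod_cast (by omega : t ≤ T)
    have hs : 1 ≤ √(t : ℝ) := Real.one_le_sqrt.2 ht1
    have h1 := P.integral_potential_succ_le S hmono hnash hK hD hp (δ := D / T) (by positivity)
      hpδ (Real.sqrt_nonneg _) ht (hAα t ht)
    have h2 : V (t + 1) ≤
        ∫ ω, potential R lam p (stepSize d L σ t * β * (t + 1) / 2) (x (t + 1) ω) ∂μ := by
      refine integral_mono (P.integrable_potential S hp _ (by omega))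
        (P.integrable_potential S hp _ (by omega)) fun ω => potential_mono p ?_ _
      have h3 : stepSize d L σ (t + 1) ≤ stepSize d L σ t := by
        rw [hη, hη]
        push_cast
        gcongr
        linarith
      push_cast
      gcongr
    have h3 : stepSize d L σ t * (C4 * (D / T) + C5 * √(Λ / √(t : ℝ)) ^ 2) +
        (∑ i, lam i) / (2 * t) ≤ C6 * (t : ℝ)⁻¹ := by
      rw [hη, Real.sq_sqrt (by positivity)]
      have h4 : κ / √(t : ℝ) * (C4 * (D / T)) ≤ κ * (C4 * (D / t)) := by
        have h5 : κ / √(t : ℝ) ≤ κ := div_le_self hκ.le hs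
        gcongr
      have h5 : κ / √(t : ℝ) * (C5 * (Λ / √(t : ℝ))) = κ * (C5 * (Λ / t)) := by
        have : κ / √(t : ℝ) * (C5 * (Λ / √(t : ℝ))) = κ * (C5 * (Λ / √(t : ℝ) ^ 2)) := by
          field_simp
        rw [this, Real.sq_sqrt ht0.le]
      have h6 : C6 * (t : ℝ)⁻¹ = κ * (C4 * (D / t)) + κ * (C5 * (Λ / t)) +
          (∑ i, lam i) / (2 * t) := by
        rw [hC6]
        field_simp
      rw [mul_add, h5, h6]
      linarith
    linarith
  have hsum : ∀ t : ℕ, t + 1 ≤ T → V (t + 1) ≤ V 1 + C6 * (harmonic t : ℝ) := by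
    intro t
    induction t with
    | zero => intro _; simp
    | succ t ih =>
      intro ht
      have h1 := ih (by omega)
      have h2 := hstep (t + 1) (by omega) ht
      rw [harmonic_succ]
      push_cast at h2 ⊢
      linarith
  have hlog0 : 0 ≤ Real.log T := Real.log_nonneg hT1
  have hVT : V T ≤ V 1 + C6 * (1 + Real.log T) := by
    obtain ⟨s, rfl⟩ : ∃ s, T = s + 1 := ⟨T - 1, by omega⟩
    refine (hsum s le_rfl).trans ?_
    gcongr
    refine (harmonic_le_one_add_log s).trans ?_
    rcases Nat.eq_zero_or_pos s with h | h
    · subst h; simp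
    · have : (0 : ℝ) < s := by exact_mod_cast h
      gcongr
      linarith
  have hV1 : V 1 ≤ Q + (∑ i, lam i * ν i) * Real.log T +
      N * (κ * β / 2 * D ^ 2) := by
    have h1 := P.integral_potential_one_le S hD hp hpR (b := κ * β / 2) (by positivity)
    have h2 : V 1 = ∫ ω, potential R lam p (κ * β / 2) (x 1 ω) ∂μ := by
      simp [hV, hη]
    rw [h2]
    refine h1.trans (le_of_eq ?_)
    simp only [mul_add, Finset.sum_add_distrib, Finset.sum_mul, mul_assoc]
    simp
    rfl
  have hsT : 0 < √(T : ℝ) := Real.sqrt_pos.2 hT0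
  have hsq : √(T : ℝ) ^ 2 = T := Real.sq_sqrt hT0.le
  -- The divergence part is nonnegative and may be dropped; `η_T T = κ √T` is the source of the
  -- rate.
  have he : κ * β / 2 * √(T : ℝ) * ∫ ω, ∑ i, ‖x T ω i - p i‖ ^ 2 ∂μ ≤ V T := by
    rw [← integral_const_mul]
    have hEi : Integrable (fun ω => ∑ i, ‖x T ω i - p i‖ ^ 2) μ :=
      integrable_finsetSum _ fun i _ => P.integrable_norm_sub_pow S hT i (hp i trivial) 2
    refine integral_mono (hEi.const_mul _) (P.integrable_potential S hp _ hT) fun ω => ?_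
    have h1 := S.mul_le_potential hpi (P.run.mem_interior hT ω) (stepSize d L σ T * β * T / 2)
    have h2 : stepSize d L σ T * β * T / 2 = κ * β / 2 * √(T : ℝ) := by
      rw [hη, div_mul_eq_mul_div, div_mul_eq_mul_div, div_div, div_eq_iff (by positivity)]
      rw [← hsq]
      ring_nf
      rw [Real.sqrt_sq hsT.le]
    rw [h2] at h1 ⊢
    exact h1
  have hfin := P.integral_norm_xhat_sub_sq_le S hnash.1 hp (α := √(Λ / √(T : ℝ))) hpδ hT (hAα T hT)
  rw [Real.sq_sqrt (by positivity)] at hfin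
  have hDT : (D / T) ^ 2 ≤ D ^ 2 / √(T : ℝ) := by
    rw [div_pow]
    have h1 : 1 ≤ √(T : ℝ) := Real.one_le_sqrt.2 hT1
    have h2 : √(T : ℝ) ≤ (T : ℝ) ^ 2 := by nlinarith
    gcongr
  have he2 : ∫ ω, ∑ i, ‖x T ω i - p i‖ ^ 2 ∂μ ≤ 2 / (κ * β) * V T / √(T : ℝ) := by
    rw [le_div_iff₀ hsT, div_mul_eq_mul_div, le_div_iff₀ (by positivity)]
    linarith
  have hVT2 := (hVT.trans (add_le_add_left hV1 _))
  have h1 : 2 / (κ * β) * V T / √(T : ℝ) ≤ 2 / (κ * β) * (Q +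
      (∑ i, lam i * ν i) * Real.log T + N * (κ * β / 2 * D ^ 2) + C6 * (1 + Real.log T)) /
        √(T : ℝ) := by
    gcongr
  have h2 : (N : ℝ) * (D / T) ^ 2 ≤ N * (D ^ 2 / √(T : ℝ)) := by gcongr
  refine hfin.trans ((mul_le_mul_of_nonneg_left (add_le_add (add_le_add le_rfl (he2.trans h1)) h2)
    (by norm_num : (0 : ℝ) ≤ 3)).trans (le_of_eq ?_))
  field_simp
  ring

theorem payoffGrad_eq_zero {i : Fin N} (hz : ∀ x ∈ univ.pi X, u i x = 0) {x : Profile d}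
    (hx : x ∈ univ.pi X) : payoffGrad X u i x = 0 := by
  unfold payoffGrad gradientWithin
  have h : fderivWithin ℝ (fun y => u i (Function.update x i y)) (X i) (x i) =
      fderivWithin ℝ (fun _ => (0 : ℝ)) (X i) (x i) :=
    fderivWithin_congr' (fun y hy => hz _ (update_mem_pi hx hy)) (hx i trivial)
  rw [h]
  simp

/-- The payoff bound of a strongly monotone game on nontrivial action sets is positive. -/
theorem payoff_bound_pos (hint : ∀ i, (interior (X i)).Nonempty) (hβ : 0 < β)
    (hmono : IsStronglyMonotone X u lam β) (hL : ∀ i, ∀ x ∈ univ.pi X, |u i x| ≤ L) (i : Fin N)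
    (hd : d i ≠ 0) : 0 < L := by
  choose x0 hx0 using hint
  have hx : x0 ∈ univ.pi X := fun i _ => interior_subset (hx0 i)
  have hL0 : 0 ≤ L := (abs_nonneg _).trans (hL i _ hx)
  refine lt_of_le_of_ne hL0 fun h => ?_
  have hz : ∀ i, ∀ x ∈ univ.pi X, u i x = 0 := fun i x hx =>
    abs_nonpos_iff.1 ((hL i x hx).trans h.symm.le)
  have : Nonempty (Fin (d i)) := ⟨⟨0, by omega⟩⟩
  have hnt : (interior (X i)).Nontrivial :=
    (infinite_of_mem_nhds (x0 i) (isOpen_interior.mem_nhds (hx0 i))).nontrivial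
  obtain ⟨y, hy, hne⟩ := hnt.exists_ne (x0 i)
  have hx' := update_mem_pi hx (interior_subset hy)
  have h1 := hmono x0 hx _ hx'
  simp only [payoffGrad_eq_zero (hz _) hx, payoffGrad_eq_zero (hz _) hx', sub_self,
    inner_zero_right, mul_zero, Finset.sum_const_zero] at h1
  have h2 : ‖y - x0 i‖ ^ 2 ≤ ∑ j, ‖Function.update x0 i y j - x0 j‖ ^ 2 := by
    have := Finset.single_le_sum (f := fun j => ‖Function.update x0 i y j - x0 j‖ ^ 2)
      (fun j _ => by positivity) (Finset.mem_univ i)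
    simpa using this
  have h3 : 0 < ‖y - x0 i‖ := norm_pos_iff.2 (sub_ne_zero.2 hne)
  have h4 : 0 < ‖y - x0 i‖ ^ 2 := by positivity
  nlinarith

end Main

end BanditGame

/-! ### Degenerate cases and conclusion. -/

open BanditGame in
theorem mainTheorem3 {N : ℕ} (d : Fin N → ℕ)
    (X : ∀ i, Set (EuclideanSpace ℝ (Fin (d i)))) (u : Fin N → Profile d → ℝ)
    (hgame : IsSmoothConcaveGame X u) (hint : ∀ i, (interior (X i)).Nonempty)
    (lam : Fin N → ℝ) (hlam : ∀ i, 0 < lam i) (β : ℝ) (hβ : 0 < β)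
    (hmono : IsStronglyMonotone X u lam β)
    (xstar : Profile d) (hnash : IsNash X u xstar)
    (L : ℝ) (hL : ∀ i, ∀ x ∈ univ.pi X, |u i x| ≤ L)
    (ν : Fin N → ℝ) (R : ∀ i, EuclideanSpace ℝ (Fin (d i)) → ℝ)
    (hR : ∀ i, IsSelfConcordantBarrier (X i) (ν i) (R i))
    (σ : ℝ) (hσ : 0 ≤ σ) :
    ∃ (C : ℝ) (k : ℕ),
      ∀ (Ω : Type*) [MeasurableSpace Ω] (μ : Measure Ω) [IsProbabilityMeasure μ]
        (z : ℕ → ∀ i, Ω → Metric.sphere (0 : EuclideanSpace ℝ (Fin (d i))) 1)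
        (ξ : ℕ → Fin N → Ω → ℝ)
        (x : ℕ → Ω → Profile d)
        (A : ℕ → Ω → ∀ i, EuclideanSpace ℝ (Fin (d i)) →L[ℝ] EuclideanSpace ℝ (Fin (d i)))
        (xhat : ℕ → Ω → Profile d),
        IsSphereSampling μ z ξ →
        IsBoundedNoise μ σ z ξ →
        (∀ ω, IsRun X u R lam β (stepSize d L σ) (fun t i => z t i ω) (fun t i => ξ t i ω)
          (fun t => x t ω) (fun t => A t ω) (fun t => xhat t ω)) →
        ∀ T : ℕ, 2 ≤ T →
          Integrable (fun ω => ∑ i, ‖xhat T ω i - xstar i‖ ^ 2) μ ∧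
          ∫ ω, ∑ i, ‖xhat T ω i - xstar i‖ ^ 2 ∂μ
            ≤ C * Real.log T ^ k / √(T : ℝ) := by
  -- In dimension zero the unit sphere is empty, so no directions can be drawn on a nonempty sample
  -- space.
  by_cases hdim : ∃ i, d i = 0
  · obtain ⟨i, hi⟩ := hdim
    refine ⟨0, 0, fun Ω _ μ _ z ξ x A xhat hs _ _ T _ => ?_⟩
    exfalso
    have : Nonempty Ω := nonempty_of_isProbabilityMeasure μ
    obtain ⟨ω⟩ := this
    have h := norm_eq_of_mem_sphere (z 1 i ω)
    have : IsEmpty (Fin (d i)) := by rw [hi]; infer_instance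
    rw [Subsingleton.elim (z 1 i ω : EuclideanSpace ℝ (Fin (d i))) 0, norm_zero] at h
    exact zero_ne_one h
  push Not at hdim
  rcases Nat.eq_zero_or_pos N with hN | hN
  · subst hN
    exact ⟨0, 0, fun Ω _ μ _ z ξ x A xhat _ _ _ T _ => by simp⟩
  -- Needed because the step size divides by `L + σ`, and `σ` may be zero.
  have hL0 : 0 < L := payoff_bound_pos hint hβ hmono hL ⟨0, hN⟩ (hdim _)
  have S : IsBanditSetting X u R ν lam β L σ :=
    { game := hgame
      interior_nonempty := hint
      barrier := hR
      lam_pos := hlam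
      beta_pos := hβ
      payoff_le := hL
      sigma_nonneg := hσ
      size_pos := by linarith
      dim_pos := (Nat.pos_of_ne_zero (hdim ⟨0, hN⟩)).trans_le
        (Finset.single_le_sum (fun i _ => Nat.zero_le (d i)) (Finset.mem_univ _)) }
  obtain ⟨C₀, C₁, hC₀, hrate⟩ := S.exists_rate hmono hnash
  -- For `T ≥ 2` the constant term is absorbed into the logarithm, using `C₀ ≥ 0`.
  refine ⟨C₀ / Real.log 2 + C₁, 1, fun Ω _ μ _ z ξ x A xhat hs hn hrun T hT => ?_⟩
  have P : IsBanditProcess X u R lam β L σ μ z ξ x A xhat := ⟨hs, hn, hrun⟩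
  refine ⟨P.integrable_norm_xhat_sub_sq S hnash.1 (by omega), ?_⟩
  refine (hrate Ω μ z ξ x A xhat P T (by omega)).trans ?_
  have hlog2 : 0 < Real.log 2 := Real.log_pos one_lt_two
  have hlog : Real.log 2 ≤ Real.log T := Real.log_le_log two_pos (by exact_mod_cast hT)
  have h1 : C₀ ≤ C₀ / Real.log 2 * Real.log T := by
    rw [div_mul_eq_mul_div, le_div_iff₀ hlog2]
    exact mul_le_mul_of_nonneg_left hlog hC₀
  rw [pow_one]
  gcongr
  linarith
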